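/- Indices $i\in\{1,2,3\}$ are taken cyclically ($3+1=1$). A $3$-polytope is a full-dimensional convex polytope in $\mathbb R^3$. For a facet $F$ of a $3$-polytope $P$, let $P_{\mathrm{beyond}\,F}$ be the closure of the set of points that strictly violate the inequality of $F$ and strictly satisfy the inequalities of all other facets of $P$. A *triangulation* of a $3$-polytope $Q$ is a finite set of (nondegenerate) tetrahedra with vertices among the extreme points of $Q$, whose union is $Q$, and any two of which meet in a common (possibly empty) face. Six points $A_1,A_2,A_3,B_1,B_2,B_3\in\mathbb R^3$ are in *Schönhardt position* if they are the vertices of a non-convex polytope with facets $(A_1,A_2,A_3)$, $(B_1,B_2,B_3)$, $(A_i,B_i,A_{i+1})$, $(B_i,A_{i+1},B_{i+1})$ $(i=1,2,3)$ whose interior angle is greater than $\pi$ at the three diagonals $(B_i,A_{i+1})$ and less than $\pi$ at the nine other edges. The *visibility cone* $V$ is the region bounded by the three planes $B_iB_{i+1}A_{i+1}$ consisting of the points that lie, for each $i$, on the same (closed) side of the plane $B_iB_{i+1}A_{i+1}$ as $B_{i+2}$. For $m\ge 0$, a $3$-polytope $C$ is an *$m$-cupola* if (1) its vertices are the pairwise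 distinct points $q^i_k$ ($i=1,2,3$, $0\le k\le m+1$), where $q^i_0=A_i$ and $q^i_{m+1}=B_{i+1}$; (2) $A_1,A_2,A_3,B_1,B_2,B_3$ are in Schönhardt position; (3) its facets are exactly the triangles $(A_1,A_2,A_3)$, $(B_1,B_2,B_3)$, $(B_i,q^i_k,q^i_{k+1})$ and $(A_{i+1},q^i_k,q^i_{k+1})$ for $i=1,2,3$, $0\le k\le m$; (4) for $1\le k\le m$, $q^i_k$ lies strictly on the side of the plane $B_iA_{i+1}B_{i+2}$ opposite to $B_{i+1}$. **Proposition.** Let $P$ be a $3$-polytope, $F$ a triangular facet of $P$, and $C$ an $m$-cupola with visibility cone $V$ that is attached to $P$ over $F$, i.e. $C\subseteq P_{\mathrm{beyond}\,F}$ and $P\subseteq C_{\mathrm{beyond}\,(A_1,A_2,A_3)}$, in such a way that $F\cap V$ is a triangle contained in the relative interior of $F$. Let $v$ be a vertex of $P$ in the interior of the visibility cone $V$. Then $\mathrm{conv}(\{v\}\cup F\cup C)$ has a triangulation with at most $3m+16$ tetrahedra. -/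

import Mathlib

open Set

/-- Euclidean three-space. -/
abbrev E3 : Type := EuclideanSpace ℝ (Fin 3)

/-! ### Polytopes, facets, points beyond a face -/

/-- A (full-dimensional, convex) 3-polytope. -/
def IsPolytope3 (P : Set E3) : Prop :=
  (∃ S : Finset E3, P = convexHull ℝ (S : Set E3)) ∧ (interior P).Nonempty

/-- A facet of a 3-polytope: a two-dimensional exposed face. -/
def IsFacet (P F : Set E3) : Prop :=
  IsExposed ℝ P F ∧ Module.finrank ℝ (vectorSpan ℝ F) = 2

/-- A (nondegenerate) triangle. -/
def IsTriangle (F : Set E3) : Prop :=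
  ∃ f : Fin 3 → E3, AffineIndependent ℝ f ∧ F = convexHull ℝ (range f)

/-- The points beyond the face `F` of the 3-polytope `P`: they strictly violate the inequality of
every facet containing `F`, and strictly satisfy the inequalities of all the other facets. -/
def beyondPoints (P F : Set E3) : Set E3 :=
  {p | ∀ G, IsFacet P G → ∀ x ∈ interior P,
    (F ⊆ G → (affineSpan ℝ G).SOppSide x p) ∧ (¬ F ⊆ G → (affineSpan ℝ G).SSameSide x p)}

/-- The polytope (or polyhedron) of all points beyond `F`, closed up. -/
def polytopeBeyond (P F : Set E3) : Set E3 := closure (beyondPoints P F)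

/-- `P` and `Q` are attached along their facets `F` and `G`. -/
structure AttachedAlong (P F Q G : Set E3) : Prop where
  facet_left : IsFacet P F
  facet_right : IsFacet Q G
  left_beyond : P ⊆ polytopeBeyond Q G
  right_beyond : Q ⊆ polytopeBeyond P F

/-! ### Triangulations -/

/-- A triangulation of the 3-polytope `Q`, given by the vertex sets of its tetrahedra: the
tetrahedra are nondegenerate, their vertices are extreme points of `Q`, their union is `Q`, and any
two of them meet in a common (possibly empty) face. Its size is `T.card`. -/
structure IsTriangulation (Q : Set E3) (T : Finset (Finset E3)) : Prop where
  card_eq : ∀ t ∈ T, t.card = 4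
  affineIndependent : ∀ t ∈ T, AffineIndependent ℝ ((↑) : t → E3)
  subset_extremePoints : ∀ t ∈ T, (t : Set E3) ⊆ Q.extremePoints ℝ
  iUnion_eq : (⋃ t ∈ T, convexHull ℝ (t : Set E3)) = Q
  inter_eq : ∀ s ∈ T, ∀ t ∈ T,
    convexHull ℝ (s : Set E3) ∩ convexHull ℝ (t : Set E3) = convexHull ℝ ((s : Set E3) ∩ t)

/-! ### Schönhardt polytopes

Indices are in `Fin 3`, so that `i + 1` and `i + 2` are cyclic. -/

/-- The orientation of the simplex `(a, b, c, d)`. -/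
noncomputable def orientation4 (a b c d : E3) : SignType :=
  SignType.sign (Matrix.det
    !![a 0, b 0, c 0, d 0;
       a 1, b 1, c 1, d 1;
       a 2, b 2, c 2, d 2;
       1,   1,   1,   1])

/-- The vertex sets of the eight facets of a Schönhardt polytope. -/
def schonhardtFacets (A B : Fin 3 → E3) : Set (Set E3) :=
  {range A, range B} ∪ (range fun i => {A i, B i, A (i + 1)})
    ∪ (range fun i => {B i, A (i + 1), B (i + 1)})

/-- The six points are in Schönhardt position: they are the vertices of a nonconvex polytope with
the facets `schonhardtFacets A B`, whose interior angle is greater than `π` exactly at the three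
edges `(B i, A (i + 1))`.

The boundary surface is embedded. It is oriented coherently by the oriented triangles
`(A 0, A 1, A 2)`, `(B 2, B 1, B 0)`, `(A (i+1), A i, B i)` and `(A (i+1), B i, B (i+1))`, and `ε`
is the sign of the simplices formed by such a triangle and a point on the inner side of its plane.
Let `(a, b, c)` and `(b, a, d)` be the two oriented triangles at an edge. The interior angle at that
edge is less than `π` if and only if `d` is on the inner side of the plane of `(a, b, c)`,
i.e. `orientation4 a b c d = ε`, and it is greater than `π` if and only if `d` is on the outer side,
i.e. `orientation4 a b c d = -ε`. -/
structure IsSchonhardt (A B : Fin 3 → E3) : Prop where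
  embedded : ∀ s ∈ schonhardtFacets A B, ∀ t ∈ schonhardtFacets A B,
    convexHull ℝ s ∩ convexHull ℝ t = convexHull ℝ (s ∩ t)
  angles : ∃ ε : SignType, ε ≠ 0 ∧ ∀ i : Fin 3,
    -- the edge from `A i` to `A (i + 1)` is convex
    orientation4 (A i) (A (i + 1)) (A (i + 2)) (B i) = ε ∧
    -- the edge from `B i` to `B (i + 1)` is convex
    orientation4 (B (i + 1)) (B i) (B (i + 2)) (A (i + 1)) = ε ∧
    -- the edge from `A (i + 1)` to `B (i + 1)` is convex
    orientation4 (B (i + 1)) (A (i + 1)) (B i) (A (i + 2)) = ε ∧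
    -- the diagonal from `B i` to `A (i + 1)` is reflex
    orientation4 (B i) (A (i + 1)) (A i) (B (i + 1)) = -ε

/-- The visibility cone: the (closed) region containing the skylight that is bounded by the three
planes through `B i, B (i + 1), A (i + 1)`. -/
def visibilityCone (A B : Fin 3 → E3) : Set E3 :=
  {x | ∀ i : Fin 3, (affineSpan ℝ {B i, B (i + 1), A (i + 1)}).WSameSide x (B (i + 2))}

/-! ### Cupolas -/

/-- `C` is an `m`-cupola with bottom facet `A`, skylight `B`, and vertex-edge chains
`q i 0 = A i, q i 1, …, q i m, q i (m + 1) = B (i + 1)`. -/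
structure IsCupola (m : ℕ) (A B : Fin 3 → E3) (q : Fin 3 → Fin (m + 2) → E3) (C : Set E3) :
    Prop where
  isPolytope : IsPolytope3 C
  q_zero : ∀ i, q i 0 = A i
  q_last : ∀ i, q i (Fin.last (m + 1)) = B (i + 1)
  /-- the vertices named above are pairwise distinct -/
  injective : Function.Injective fun x : Fin 3 × Fin (m + 2) => q x.1 x.2
  vertices : C.extremePoints ℝ = ⋃ i, range (q i)
  schonhardt : IsSchonhardt A B
  facets : {G | IsFacet C G} =
    {convexHull ℝ (range A), convexHull ℝ (range B)}
      ∪ {G | ∃ (i : Fin 3) (k : Fin (m + 1)),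
          G = convexHull ℝ {B i, q i k.castSucc, q i k.succ}}
      ∪ {G | ∃ (i : Fin 3) (k : Fin (m + 1)),
          G = convexHull ℝ {A (i + 1), q i k.castSucc, q i k.succ}}
  chain_side : ∀ (i : Fin 3) (k : Fin (m + 2)), k ≠ 0 → k ≠ Fin.last (m + 1) →
    (affineSpan ℝ {B i, A (i + 1), B (i + 2)}).SOppSide (q i k) (B (i + 1))

open scoped Classical

/-! ### Determinants and oriented volumes -/

/-! Write `Q` for the convex hull to be triangulated, `p i k` for the chain vertices and `f j` for
the vertices of `F`. Seen from `v`, the Schönhardt polytope is entered through the bottom triangle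
`A`, and behind it the point sees exactly the other seven Schönhardt facets: the skylight `B`, and
for each `i` a quadrangle cut by the reflex diagonal `B i`, `A (i + 1)` into two triangles. Coning
these seven facets from `v` fills the part of the cone over `A` in front of them. What remains of
the cupola is, for each `i`, a cap behind the diagonal; the planes through the diagonal and the
successive chain vertices slice it into `m + 1` tetrahedra. This makes `7 + 3 (m + 1) = 3 m + 10`
inner tetrahedra. The rest of `Q` lies below the plane of `A` and outside the cone over `A`. Below
that plane, `Q` is the hull of `v`, the `A i` and those `f j` that are extreme in `Q`
(`mem_hull_outer`), so it is enough to cone from `v` over the far side of this hull. The triangle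
`A` belongs to the far side, and each other far triangle either shares an edge with `A`, at most one
per edge, or has one vertex in `A` and two among the `f j`, at most one per pair. Hence at most six
more tetrahedra occur (`card_farTriangles_le`). All positions are expressed as signs of oriented
volumes. The cupola is turned into a list of signs by `IsCupola.exists_signs`, normalized by a
factor `e` so that inward orientation is positive for the bottom facet; further signs follow from
Grassmann–Plücker relations around a common line. They give the covering of the inner part
(`mem_inner`) and separating planes for pairs of inner tetrahedra (`meet_inner`). The far side may
contain coplanar quadruples, so it is refined by generic heights close to `1`. Far triangles are the
optimal bases of the linear program that writes a point of the cone at `v` as a cheapest conic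
combination; pivoting proves their existence (`exists_optimal_triangle`), and the dual functionals
prove that their cones meet face to face (`meetInFace_of_lifting`) and are compatible with the inner
ones (`meet_far_inner`). The covering is checked only at generic points: the union is closed, so an
uncovered point would produce an uncovered open set. -/

/-- The determinant of three vectors. -/
noncomputable def det3 (x y z : E3) : ℝ :=
  x 0 * (y 1 * z 2 - y 2 * z 1) - x 1 * (y 0 * z 2 - y 2 * z 0) + x 2 * (y 0 * z 1 - y 1 * z 0)

/-- The oriented volume of the simplex `(a, b, c, d)`, scaled by `e`. -/
noncomputable def vol (e : ℝ) (a b c d : E3) : ℝ := e * det3 (b - a) (c - a) (d - a)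

theorem det3_smul_eq (a b c x : E3) :
    det3 a b c • x = det3 x b c • a + det3 a x c • b + det3 a b x • c := by
  ext i
  fin_cases i <;> simp [det3] <;> ring

/-- `det3` as a linear map of its last argument. -/
noncomputable def det3Map (x y : E3) : E3 →ₗ[ℝ] ℝ where
  toFun := det3 x y
  map_add' z w := by simp [det3]; ring
  map_smul' r z := by simp [det3]; ring

/-- `vol` as an affine map of its last argument. -/
noncomputable def volMap (e : ℝ) (a b c : E3) : E3 →ᵃ[ℝ] ℝ where
  toFun := vol e a b c
  linear := e • det3Map (b - a) (c - a)
  map_vadd' p w := by simp [vol, det3Map, det3]; ring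

@[simp] theorem volMap_apply (e : ℝ) (a b c d : E3) : volMap e a b c d = vol e a b c d := rfl

theorem vol_swap₁₂ (e : ℝ) (a b c d : E3) : vol e b a c d = -vol e a b c d := by
  simp only [vol, det3, PiLp.sub_apply]; ring

theorem vol_swap₂₃ (e : ℝ) (a b c d : E3) : vol e a c b d = -vol e a b c d := by
  simp only [vol, det3, PiLp.sub_apply]; ring

theorem vol_swap₃₄ (e : ℝ) (a b c d : E3) : vol e a b d c = -vol e a b c d := by
  simp only [vol, det3, PiLp.sub_apply]; ring

theorem vol_rotate (e : ℝ) (a b c d : E3) : vol e b c a d = vol e a b c d := by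
  simp only [vol, det3, PiLp.sub_apply]; ring

theorem vol_rotate_last (e : ℝ) (a b c d : E3) : vol e a c d b = vol e a b c d := by
  simp only [vol, det3, PiLp.sub_apply]; ring

theorem vol_self₂₃ (e : ℝ) (a b d : E3) : vol e a b b d = 0 := by simp only [vol, det3, PiLp.sub_apply]; ring
theorem vol_self₁₄ (e : ℝ) (a b c : E3) : vol e a b c a = 0 := by simp [vol, det3]
theorem vol_self₂₄ (e : ℝ) (a b c : E3) : vol e a b c b = 0 := by simp only [vol, det3, PiLp.sub_apply]; ring
theorem vol_self₃₄ (e : ℝ) (a b c : E3) : vol e a b c c = 0 := by simp only [vol, det3, PiLp.sub_apply]; ring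

/-- The three-term Grassmann–Plücker relation. -/
theorem vol_plucker (e : ℝ) (a b p q r s : E3) :
    vol e a b p q * vol e a b r s - vol e a b p r * vol e a b q s
      + vol e a b p s * vol e a b q r = 0 := by
  simp only [vol, det3, PiLp.sub_apply]; ring

theorem vol_sum (e : ℝ) (a b c d x : E3) :
    vol e x b c d + vol e a x c d + vol e a b x d + vol e a b c x = vol e a b c d := by
  simp only [vol, det3, PiLp.sub_apply]; ring

theorem vol_smul_eq (e : ℝ) (a b c d x : E3) :
    vol e a b c d • x =
      vol e x b c d • a + vol e a x c d • b + vol e a b x d • c + vol e a b c x • d := by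
  ext i
  fin_cases i <;> simp [vol, det3] <;> ring

theorem vol_smul_sub_eq (e : ℝ) (v a b c x : E3) :
    vol e v a b c • (x - v) =
      vol e v x b c • (a - v) + vol e v a x c • (b - v) + vol e v a b x • (c - v) := by
  have := det3_smul_eq (a - v) (b - v) (c - v) (x - v)
  simp only [vol, mul_smul, this, smul_add]

/-- The four volumes divided by the total volume are the barycentric coordinates of `x`. -/
theorem mem_convexHull_four {e : ℝ} {a b c d x : E3} (h : 0 < vol e a b c d)
    (ha : 0 ≤ vol e x b c d) (hb : 0 ≤ vol e a x c d) (hc : 0 ≤ vol e a b x d)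
    (hd : 0 ≤ vol e a b c x) : x ∈ convexHull ℝ ({a, b, c, d} : Set E3) := by
  have hx : x = (vol e x b c d / vol e a b c d) • a + (vol e a x c d / vol e a b c d) • b
      + (vol e a b x d / vol e a b c d) • c + (vol e a b c x / vol e a b c d) • d := by
    have := congrArg (fun y => (vol e a b c d)⁻¹ • y) (vol_smul_eq e a b c d x)
    simp only [smul_smul, smul_add, inv_mul_cancel₀ h.ne', one_smul] at this
    simpa only [div_eq_inv_mul] using this
  have hs : vol e x b c d / vol e a b c d + vol e a x c d / vol e a b c d
      + vol e a b x d / vol e a b c d + vol e a b c x / vol e a b c d = 1 := by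
    rw [← add_div, ← add_div, ← add_div, vol_sum, div_self h.ne']
  have key := (convex_convexHull ℝ ({a, b, c, d} : Set E3)).sum_mem
    (t := (Finset.univ : Finset (Fin 4)))
    (w := ![vol e x b c d / vol e a b c d, vol e a x c d / vol e a b c d,
      vol e a b x d / vol e a b c d, vol e a b c x / vol e a b c d]) (z := ![a, b, c, d])
    (by intro i _; fin_cases i <;> simp <;> positivity)
    (by simpa [Fin.sum_univ_four] using hs)
    (by intro i _; apply subset_convexHull; fin_cases i <;> simp)
  rw [hx]
  simpa [Fin.sum_univ_four] using key

theorem affineIndependent_of_vol_ne_zero {e : ℝ} {a b c d : E3} (h : vol e a b c d ≠ 0) :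
    AffineIndependent ℝ ![a, b, c, d] := by
  rw [affineIndependent_iff_of_fintype]
  intro w hw hw'
  rw [Finset.weightedVSub_eq_weightedVSubOfPoint_of_sum_eq_zero _ _ _ hw a,
    Finset.weightedVSubOfPoint_apply] at hw'
  simp only [Fin.sum_univ_four, vsub_eq_sub] at hw'
  simp at hw'
  have h0 := congrArg (fun x : E3 => x 0) hw'
  have h1 := congrArg (fun x : E3 => x 1) hw'
  have h2 := congrArg (fun x : E3 => x 2) hw'
  simp at h0 h1 h2
  have e1 : w 1 = 0 := by
    refine (mul_eq_zero.1 ?_).resolve_right h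
    simp only [vol, det3, PiLp.sub_apply]
    linear_combination (e * ((c 1 - a 1) * (d 2 - a 2) - (c 2 - a 2) * (d 1 - a 1))) * h0
      - (e * ((c 0 - a 0) * (d 2 - a 2) - (c 2 - a 2) * (d 0 - a 0))) * h1
      + (e * ((c 0 - a 0) * (d 1 - a 1) - (c 1 - a 1) * (d 0 - a 0))) * h2
  have e2 : w 2 = 0 := by
    refine (mul_eq_zero.1 ?_).resolve_right h
    simp only [vol, det3, PiLp.sub_apply]
    linear_combination (-e * ((b 1 - a 1) * (d 2 - a 2) - (b 2 - a 2) * (d 1 - a 1))) * h0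
      + (e * ((b 0 - a 0) * (d 2 - a 2) - (b 2 - a 2) * (d 0 - a 0))) * h1
      - (e * ((b 0 - a 0) * (d 1 - a 1) - (b 1 - a 1) * (d 0 - a 0))) * h2
  have e3 : w 3 = 0 := by
    refine (mul_eq_zero.1 ?_).resolve_right h
    simp only [vol, det3, PiLp.sub_apply]
    linear_combination (e * ((b 1 - a 1) * (c 2 - a 2) - (b 2 - a 2) * (c 1 - a 1))) * h0
      - (e * ((b 0 - a 0) * (c 2 - a 2) - (b 2 - a 2) * (c 0 - a 0))) * h1
      + (e * ((b 0 - a 0) * (c 1 - a 1) - (b 1 - a 1) * (c 0 - a 0))) * h2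
  have e0 : w 0 = 0 := by
    simp only [Fin.sum_univ_four] at hw
    linarith
  intro i
  fin_cases i <;> assumption

theorem affineIndependent_coe_of_vol_ne_zero {e : ℝ} {a b c d : E3} (h : vol e a b c d ≠ 0) :
    AffineIndependent ℝ ((↑) : (({a, b, c, d} : Finset E3)) → E3) := by
  have := (affineIndependent_of_vol_ne_zero h).range
  refine this.mono ?_
  intro x hx
  simp at hx
  rcases hx with rfl | rfl | rfl | rfl
  exacts [⟨0, rfl⟩, ⟨1, rfl⟩, ⟨2, rfl⟩, ⟨3, rfl⟩]

theorem card_of_vol_ne_zero {e : ℝ} {a b c d : E3} (h : vol e a b c d ≠ 0) :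
    ({a, b, c, d} : Finset E3).card = 4 := by
  have hi := (affineIndependent_of_vol_ne_zero h).injective
  have : ({a, b, c, d} : Finset E3) = Finset.univ.image ![a, b, c, d] := by
    ext x; simp [Fin.exists_fin_succ, eq_comm]
  rw [this, Finset.card_image_of_injective _ hi]
  rfl

/-! ### Affine functionals on convex hulls -/

theorem nonneg_of_mem_convexHull {s : Set E3} {f : E3 →ᵃ[ℝ] ℝ} (h : ∀ y ∈ s, 0 ≤ f y) {x : E3}
    (hx : x ∈ convexHull ℝ s) : 0 ≤ f x :=
  convexHull_min (t := f ⁻¹' Ici 0) h ((convex_Ici 0).affine_preimage f) hx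

/-- A convex combination of nonnegative values can vanish only if every vertex with positive weight
has value zero. -/
theorem mem_convexHull_zeros {s : Finset E3} {f : E3 →ᵃ[ℝ] ℝ} (h : ∀ y ∈ s, 0 ≤ f y) {x : E3}
    (hx : x ∈ convexHull ℝ (s : Set E3)) (hfx : f x ≤ 0) :
    x ∈ convexHull ℝ ((s.filter fun y => f y = 0 : Finset E3) : Set E3) := by
  obtain ⟨w, hw0, hw1, rfl⟩ := Finset.mem_convexHull'.1 hx
  have hf : f (∑ y ∈ s, w y • y) = ∑ y ∈ s, w y * f y := by
    have := s.map_affineCombination (fun y => y) w hw1 f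
    rw [Finset.affineCombination_eq_linear_combination _ _ _ hw1,
      Finset.affineCombination_eq_linear_combination _ _ _ hw1] at this
    simpa using this
  have hz : ∀ y ∈ s, w y * f y = 0 := by
    refine (Finset.sum_eq_zero_iff_of_nonneg fun y hy => mul_nonneg (hw0 y hy) (h y hy)).1 ?_
    refine le_antisymm (hf ▸ hfx) (Finset.sum_nonneg fun y hy => mul_nonneg (hw0 y hy) (h y hy))
  have hw : ∀ y ∈ s, ¬ f y = 0 → w y = 0 := fun y hy hne => (mul_eq_zero.1 (hz y hy)).resolve_right hne
  refine Finset.mem_convexHull'.2 ⟨w, fun y hy => hw0 y (Finset.mem_filter.1 hy).1, ?_, ?_⟩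
  · rw [Finset.sum_filter_of_ne]
    · exact hw1
    · intro y hy hne; by_contra hc; exact hne (hw y hy hc)
  · rw [Finset.sum_filter_of_ne]
    intro y hy hne; by_contra hc; exact hne (by rw [hw y hy hc, zero_smul])

/-- Two simplices weakly separated by a plane meet in a common face if their vertices on the plane
belong to an affinely independent set. -/
theorem convexHull_inter_of_separated {s t r : Finset E3} (f : E3 →ᵃ[ℝ] ℝ)
    (hr : AffineIndependent ℝ ((↑) : r → E3)) (hs : ∀ x ∈ s, 0 ≤ f x ∧ (f x = 0 → x ∈ r))
    (ht : ∀ x ∈ t, f x ≤ 0 ∧ (f x = 0 → x ∈ r)) :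
    convexHull ℝ (s : Set E3) ∩ convexHull ℝ (t : Set E3) = convexHull ℝ ((s : Set E3) ∩ t) := by
  refine Subset.antisymm ?_ (subset_inter (convexHull_mono inter_subset_left)
    (convexHull_mono inter_subset_right))
  rintro x ⟨hxs, hxt⟩
  have h1 : 0 ≤ f x := nonneg_of_mem_convexHull (fun y hy => (hs y hy).1) hxs
  have h2 : 0 ≤ (-f) x :=
    nonneg_of_mem_convexHull (fun y hy => by simpa using (ht y hy).1) hxt
  have hxs' := mem_convexHull_zeros (fun y hy => (hs y hy).1) hxs (by simpa using h2)
  have hxt' := mem_convexHull_zeros (f := -f) (fun y hy => by simpa using (ht y hy).1) hxt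
    (by simpa using h1)
  have hxs'' := convexHull_mono (t := ((s ∩ r : Finset E3) : Set E3)) (by
    intro y hy
    simp only [Finset.coe_filter, mem_ofPred_eq] at hy
    simp [hy.1, (hs y hy.1).2 hy.2]) hxs'
  have hxt'' := convexHull_mono (t := ((t ∩ r : Finset E3) : Set E3)) (by
    intro y hy
    simp only [Finset.coe_filter, mem_ofPred_eq] at hy
    simp [hy.1, (ht y hy.1).2 (by simpa using hy.2)]) hxt'
  have := hr.convexHull_inter (t₁ := s ∩ r) (t₂ := t ∩ r) Finset.inter_subset_right
    Finset.inter_subset_right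
  have hx : x ∈ convexHull ℝ (((s ∩ r : Finset E3) : Set E3) ∩ (t ∩ r : Finset E3)) := by
    rw [this]
    exact ⟨hxs'', hxt''⟩
  refine convexHull_mono ?_ hx
  intro y hy
  simp at hy ⊢
  tauto

/-- Cramer's rule in the vector space with origin `a`: both sides expand `w` in the basis `x`, `y`,
`z` and then apply the linear form `vol e a p q`. -/
theorem vol_cramer (e : ℝ) (a x y z p q w : E3) :
    vol e a x y z * vol e a p q w = vol e a w y z * vol e a p q x
      + vol e a x w z * vol e a p q y + vol e a x y w * vol e a p q z := by
  simp only [vol, det3, PiLp.sub_apply]; ring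

theorem fin3_add_one_add_one (i : Fin 3) : i + 1 + 1 = i + 2 := by fin_cases i <;> rfl
theorem fin3_add_two_add_one (i : Fin 3) : i + 2 + 1 = i := by fin_cases i <;> rfl
theorem vol_reverse (e : ℝ) (a b c d : E3) : vol e d c b a = vol e a b c d := by
  simp only [vol, det3, PiLp.sub_apply]; ring

/-- The vertices of a cupola with chains `p`. -/
def chainVertices (m : ℕ) (p : Fin 3 → ℕ → E3) : Set E3 := {x | ∃ i, ∃ k ≤ m + 1, x = p i k}

/-- The points that satisfy the inequalities of all the facets of a cupola but the bottom one. -/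
def cupolaRegion (e : ℝ) (m : ℕ) (A B : Fin 3 → E3) (p : Fin 3 → ℕ → E3) : Set E3 :=
  {x | (∀ i, 0 ≤ vol e (B (i + 1)) (B i) (B (i + 2)) x) ∧
    (∀ i, ∀ k ≤ m, 0 ≤ vol e (A (i + 1)) (p i k) (p i (k + 1)) x) ∧
    (∀ i, ∀ k ≤ m, vol e (B i) (p i k) (p i (k + 1)) x ≤ 0)}

/-- The sign conditions satisfied by the vertices of a cupola and a point `v` below its bottom facet
in the interior of its visibility cone. -/
structure CupolaSigns (e : ℝ) (m : ℕ) (A B : Fin 3 → E3) (p : Fin 3 → ℕ → E3) (v : E3) : Prop where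
  zero : ∀ i, p i 0 = A i
  last : ∀ i, p i (m + 1) = B (i + 1)
  inj : ∀ i j k l, k ≤ m + 1 → l ≤ m + 1 → p i k = p j l → i = j ∧ k = l
  bottom : ∀ i, ∀ x ∈ chainVertices m p, x ≠ A i → x ≠ A (i + 1) → x ≠ A (i + 2) →
    0 < vol e (A i) (A (i + 1)) (A (i + 2)) x
  top : ∀ i, ∀ x ∈ chainVertices m p, x ≠ B i → x ≠ B (i + 1) → x ≠ B (i + 2) →
    0 < vol e (B (i + 1)) (B i) (B (i + 2)) x
  facetA : ∀ i, ∀ k ≤ m, ∀ x ∈ chainVertices m p, x ≠ A (i + 1) → x ≠ p i k → x ≠ p i (k + 1) →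
    0 < vol e (A (i + 1)) (p i k) (p i (k + 1)) x
  facetB : ∀ i, ∀ k ≤ m, ∀ x ∈ chainVertices m p, x ≠ B i → x ≠ p i k → x ≠ p i (k + 1) →
    vol e (B i) (p i k) (p i (k + 1)) x < 0
  reflex : ∀ i, vol e (B i) (A (i + 1)) (A i) (B (i + 1)) < 0
  v_bottom : ∀ i, vol e (A i) (A (i + 1)) (A (i + 2)) v < 0
  v_region : v ∈ cupolaRegion e m A B p
  v_cone : ∀ i, 0 < vol e (B i) (B (i + 1)) (A (i + 1)) v

/-! ### How the vertices of a cupola are seen from `v` -/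

namespace CupolaSigns

variable {e : ℝ} {m : ℕ} {A B : Fin 3 → E3} {p : Fin 3 → ℕ → E3} {v : E3}

theorem p_mem (_ : CupolaSigns e m A B p v) (i : Fin 3) {k : ℕ} (hk : k ≤ m + 1) :
    p i k ∈ chainVertices m p := ⟨i, k, hk, rfl⟩

theorem A_mem (H : CupolaSigns e m A B p v) (i : Fin 3) : A i ∈ chainVertices m p :=
  ⟨i, 0, by omega, (H.zero i).symm⟩

theorem B_eq (H : CupolaSigns e m A B p v) (i : Fin 3) : B i = p (i + 2) (m + 1) := by
  rw [H.last, fin3_add_two_add_one]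

theorem B_mem (H : CupolaSigns e m A B p v) (i : Fin 3) : B i ∈ chainVertices m p :=
  ⟨i + 2, m + 1, le_rfl, H.B_eq i⟩

theorem p_ne (H : CupolaSigns e m A B p v) {i j : Fin 3} {k l : ℕ} (hk : k ≤ m + 1)
    (hl : l ≤ m + 1) (h : i ≠ j ∨ k ≠ l) : p i k ≠ p j l := fun h' => by
  have := H.inj _ _ _ _ hk hl h'
  tauto

theorem p_ne_A (H : CupolaSigns e m A B p v) {i j : Fin 3} {k : ℕ} (hk : k ≤ m + 1)
    (h : i ≠ j ∨ k ≠ 0) : p i k ≠ A j := by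
  rw [← H.zero]; exact H.p_ne hk (by omega) h

theorem p_ne_B (H : CupolaSigns e m A B p v) {i j : Fin 3} {k : ℕ} (hk : k ≤ m + 1)
    (h : i ≠ j + 2 ∨ k ≠ m + 1) : p i k ≠ B j := by
  rw [H.B_eq]; exact H.p_ne hk (by omega) h

theorem A_ne_A (H : CupolaSigns e m A B p v) {i j : Fin 3} (h : i ≠ j) : A i ≠ A j := by
  rw [← H.zero]; exact H.p_ne_A (by omega) (Or.inl h)

theorem A_ne_B (H : CupolaSigns e m A B p v) (i j : Fin 3) : A i ≠ B j := by
  rw [← H.zero]; exact H.p_ne_B (by omega) (Or.inr (by omega))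

theorem B_ne_B (H : CupolaSigns e m A B p v) {i j : Fin 3} (h : i ≠ j) : B i ≠ B j := by
  rw [H.B_eq i]; exact H.p_ne_B le_rfl (Or.inl (by simpa using h))

/-- Turn around the edge from `A i` to `A (i + 1)`. The wedge of its two facets contains `B i`; the
point `v` has crossed the bottom plane but is still on the inner side of the other one, so the plane
through `v` and the edge leaves `B i` on the inner side. -/
theorem vol_v_A_A_B_self (H : CupolaSigns e m A B p v) (i : Fin 3) :
    0 < vol e v (A i) (A (i + 1)) (B i) := by
  have h1 : 0 < vol e (A (i + 1)) (A i) (p i 1) (B i) := by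
    have := H.facetA i 0 (by omega) (B i) (H.B_mem i) (H.A_ne_B _ _).symm
      (by rw [H.zero]; exact (H.A_ne_B _ _).symm)
      (H.p_ne_B (by omega) (Or.inl (by simp))).symm
    rwa [H.zero] at this
  have h2 : 0 ≤ vol e (A (i + 1)) (A i) (p i 1) v := by
    have := H.v_region.2.1 i 0 (by omega)
    rwa [H.zero] at this
  have h3 := H.v_bottom i
  have h4 := H.bottom i (p i 1) (H.p_mem i (by omega)) (H.p_ne_A (by omega) (Or.inr (by omega)))
    (H.p_ne_A (by omega) (Or.inr (by omega))) (H.p_ne_A (by omega) (Or.inr (by omega)))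
  have h5 := H.bottom i (B i) (H.B_mem i) (H.A_ne_B _ _).symm (H.A_ne_B _ _).symm
    (H.A_ne_B _ _).symm
  have key := vol_cramer e (A i) (p i 1) (A (i + 1)) (B i) (A (i + 1)) (A (i + 2)) v
  rw [← vol_rotate] at h1 h2
  rw [show vol e (A i) (A (i + 1)) (A (i + 2)) (A (i + 1)) = 0 from vol_self₂₄ _ _ _ _, mul_zero,
    add_zero] at key
  rw [vol_swap₁₂]
  have h6 := mul_neg_of_pos_of_neg h1 h3
  have h7 := mul_nonneg h2 h5.le
  by_contra hc
  have h8 := mul_nonneg (show 0 ≤ vol e (A i) v (A (i + 1)) (B i) by linarith) h4.le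
  linarith

/-- The same rotation around a bottom edge, for an arbitrary vertex. Strictness may fail only at `p
j 1`, because `v` may lie in the plane of the second facet at that edge. -/
theorem vol_v_A_A_aux (H : CupolaSigns e m A B p v) (j : Fin 3) {x : E3}
    (hx : x ∈ chainVertices m p) (h1 : x ≠ A j) (h2 : x ≠ A (j + 1)) :
    0 ≤ vol e v (A j) (A (j + 1)) x ∧ (x ≠ p j 1 → 0 < vol e v (A j) (A (j + 1)) x) := by
  have hv1 := H.v_bottom j
  have hv2 : vol e (A j) (A (j + 1)) (p j 1) v ≤ 0 := by
    have := H.v_region.2.1 j 0 (by omega)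
    rw [H.zero, zero_add, vol_swap₁₂] at this
    linarith
  have haq : 0 < vol e (A j) (A (j + 1)) (A (j + 2)) (p j 1) :=
    H.bottom j (p j 1) (H.p_mem j (by omega)) (H.p_ne_A (by omega) (Or.inr (by omega)))
    (H.p_ne_A (by omega) (Or.inr (by omega))) (H.p_ne_A (by omega) (Or.inr (by omega)))
  have hq : x ≠ p j 1 → vol e (A j) (A (j + 1)) (p j 1) x < 0 := by
    intro hne
    have := H.facetA j 0 (by omega) x hx h2 (by rwa [H.zero]) hne
    rw [H.zero, zero_add, vol_swap₁₂] at this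
    linarith
  have hq' : vol e (A j) (A (j + 1)) (p j 1) x ≤ 0 := by
    by_cases h : x = p j 1
    · rw [h, vol_self₃₄]
    · exact (hq h).le
  by_cases h3 : x = A (j + 2)
  · have : vol e v (A j) (A (j + 1)) x = -vol e (A j) (A (j + 1)) (A (j + 2)) v := by
      rw [h3, ← vol_rotate, vol_swap₃₄]
    rw [this]
    exact ⟨by linarith, fun _ => by linarith⟩
  have hax := H.bottom j x hx h1 h2 h3
  have key := vol_plucker e (A j) (A (j + 1)) (A (j + 2)) (p j 1) v x
  have hrot : vol e v (A j) (A (j + 1)) x = vol e (A j) (A (j + 1)) v x := (vol_rotate _ _ _ _ _).symm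
  rw [hrot]
  have h4 := mul_nonneg_of_nonpos_of_nonpos hv1.le hq'
  have h5 := mul_nonneg_of_nonpos_of_nonpos (neg_nonpos.2 hax.le) hv2
  refine ⟨?_, fun hne => ?_⟩
  · by_contra hc
    have := mul_neg_of_pos_of_neg haq (not_le.1 hc)
    linarith
  · by_contra hc
    have := mul_nonpos_of_nonneg_of_nonpos haq.le (not_lt.1 hc)
    have := mul_pos_of_neg_of_neg hv1 (hq hne)
    linarith

theorem vol_v_A_B_B (H : CupolaSigns e m A B p v) (i : Fin 3) :
    0 < vol e v (A (i + 1)) (B (i + 1)) (B i) := by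
  rw [← vol_reverse]
  exact H.v_cone i

/-- Every `B i` is strictly inside the cone from `v` over the bottom triangle. The delicate case is
a skylight vertex equal to `p j 1`, which needs a chain without intermediate vertices and `i = j +
1`. There coplanarity with `v` is excluded by the strict cone inequality for `v`, through a Plücker
relation around the line from `v` to `A (j + 1)`. -/
theorem vol_v_A_A_B (H : CupolaSigns e m A B p v) (i j : Fin 3) :
    0 < vol e v (A j) (A (j + 1)) (B i) := by
  by_cases hij : B i = p j 1
  · have h' := H.inj _ _ _ _ le_rfl (by omega) (H.B_eq i ▸ hij)
    have hi : i = j + 1 := by rw [← h'.1, fin3_add_two_add_one]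
    subst hi
    have h1 := H.vol_v_A_B_B j
    have h2 := H.vol_v_A_A_B_self (j + 1)
    have h3 := H.vol_v_A_A_B_self j
    have h4 := (H.vol_v_A_A_aux j (H.B_mem (j + 1)) (H.A_ne_B _ _).symm (H.A_ne_B _ _).symm).1
    refine lt_of_le_of_ne h4 fun h0 => ?_
    rw [fin3_add_one_add_one] at h2
    have h5 : 0 < vol e v (A (j + 1)) (A (j + 2)) (A j) := by
      have := H.v_bottom j
      have e1 : vol e v (A (j + 1)) (A (j + 2)) (A j) = -vol e (A j) (A (j + 1)) (A (j + 2)) v := by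
        simp only [vol, det3, PiLp.sub_apply]; ring
      linarith
    have key := vol_plucker e v (A (j + 1)) (A j) (B (j + 1)) (A (j + 2)) (B j)
    rw [vol_swap₂₃, ← h0, neg_zero, zero_mul, zero_sub] at key
    rw [vol_swap₂₃] at h3
    have e2 : vol e v (A (j + 1)) (A j) (A (j + 2)) = -vol e v (A (j + 1)) (A (j + 2)) (A j) :=
      vol_swap₃₄ _ _ _ _ _
    have e3 : vol e v (A (j + 1)) (B (j + 1)) (A (j + 2))
      = -vol e v (A (j + 1)) (A (j + 2)) (B (j + 1)) := vol_swap₃₄ _ _ _ _ _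
    rw [e2, e3] at key
    rw [vol_swap₂₃ e v (A j) (A (j + 1)) (B j)] at key
    have := mul_pos h5 h1
    rw [vol_swap₂₃] at h3
    have := mul_pos h3 h2
    nlinarith
  · exact (H.vol_v_A_A_aux j (H.B_mem i) (H.A_ne_B _ _).symm (H.A_ne_B _ _).symm).2 hij

/-- Consecutive chain vertices turn in a constant direction around the diagonal. -/
theorem vol_B_A_p_succ (H : CupolaSigns e m A B p v) (i : Fin 3) {k : ℕ} (hk : k ≤ m) :
    vol e (B i) (A (i + 1)) (p i k) (p i (k + 1)) < 0 := by
  have := H.facetB i k hk (A (i + 1)) (H.A_mem _) (H.A_ne_B _ _)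
    (H.p_ne_A (by omega) (Or.inl (by simp))).symm (H.p_ne_A (by omega) (Or.inl (by simp))).symm
  rwa [vol_rotate_last] at this

/-- The reflex angle gives the sign at the far end of the chain. It propagates backwards: a chain
vertex on the wrong side would contradict, around the line from `B i` to `A i`, the facet
inequalities for `B i` and two consecutive chain vertices. -/
theorem vol_B_A_A_p (H : CupolaSigns e m A B p v) (i : Fin 3) {l : ℕ} (hl : 1 ≤ l)
    (hl' : l ≤ m + 1) : vol e (B i) (A (i + 1)) (A i) (p i l) < 0 := by
  induction hl' using Nat.decreasingInduction with
  | self => rw [H.last]; exact H.reflex i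
  | of_succ l hlm ih =>
    have ih := ih (by omega)
    rcases hl.eq_or_lt with rfl | hl
    · have := H.vol_B_A_p_succ i (k := 0) (by omega)
      rwa [H.zero, zero_add] at this
    by_contra hc
    have ha := H.facetB i 0 (by omega) (p i l) (H.p_mem i (by omega))
      (H.p_ne_B (by omega) (Or.inl (by simp))) (H.p_ne (by omega) (by omega) (Or.inr (by omega)))
      (H.p_ne (by omega) (by omega) (Or.inr (by omega)))
    have hb := H.facetB i 0 (by omega) (p i (l + 1)) (H.p_mem i (by omega))
      (H.p_ne_B (by omega) (Or.inl (by simp))) (H.p_ne (by omega) (by omega) (Or.inr (by omega)))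
      (H.p_ne (by omega) (by omega) (Or.inr (by omega)))
    have hc' := H.facetB i l (by omega) (p i 0) (H.p_mem i (by omega))
      (H.p_ne_B (by omega) (Or.inl (by simp))) (H.p_ne (by omega) (by omega) (Or.inr (by omega)))
      (H.p_ne (by omega) (by omega) (Or.inr (by omega)))
    have ho := H.vol_B_A_p_succ i (k := 0) (by omega)
    rw [H.zero, zero_add] at *
    have key := vol_plucker e (B i) (A i) (A (i + 1)) (p i l) (p i 1) (p i (l + 1))
    have e1 : vol e (B i) (A i) (A (i + 1)) (p i l) = -vol e (B i) (A (i + 1)) (A i) (p i l) :=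
      vol_swap₂₃ _ _ _ _ _
    have e2 : vol e (B i) (A i) (A (i + 1)) (p i (l + 1))
      = -vol e (B i) (A (i + 1)) (A i) (p i (l + 1)) := vol_swap₂₃ _ _ _ _ _
    have e3 : vol e (B i) (A i) (p i l) (p i 1) = -vol e (B i) (A i) (p i 1) (p i l) :=
      vol_swap₃₄ _ _ _ _ _
    have e4 : vol e (B i) (A i) (p i l) (p i (l + 1)) = vol e (B i) (p i l) (p i (l + 1)) (A i) :=
      (vol_rotate_last _ _ _ _ _).symm
    have e5 : vol e (B i) (A i) (A (i + 1)) (p i 1) = -vol e (B i) (A (i + 1)) (A i) (p i 1) :=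
      vol_swap₂₃ _ _ _ _ _
    rw [e1, e2, e3, e4, e5] at key
    have q1 := mul_nonneg_of_nonpos_of_nonpos (neg_nonpos.2 (not_lt.1 hc)) hb.le
    have q2 := mul_pos_of_neg_of_neg ho hc'
    have q3 := mul_pos_of_neg_of_neg ih ha
    nlinarith

/-- Chain vertices are sorted by angle around the diagonal, within a half-turn. -/
theorem vol_B_A_p_p (H : CupolaSigns e m A B p v) (i : Fin 3) {k l : ℕ} (hkl : k < l)
    (hl : l ≤ m + 1) : vol e (B i) (A (i + 1)) (p i k) (p i l) < 0 := by
  rcases Nat.eq_zero_or_pos k with rfl | hk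
  · rw [H.zero]; exact H.vol_B_A_A_p i hkl hl
  induction l, hkl using Nat.le_induction with
  | base => exact H.vol_B_A_p_succ i (by omega)
  | succ l hkl ih =>
    have ih := ih (by omega)
    -- `A i` is the reference direction: all later chain vertices are within a half-turn of it,
    -- which makes the angular order transitive.
    have key := vol_plucker e (B i) (A (i + 1)) (A i) (p i k) (p i l) (p i (l + 1))
    have h1 := mul_pos_of_neg_of_neg (H.vol_B_A_A_p i (l := k) hk (by omega))
      (H.vol_B_A_p_succ i (k := l) (by omega))
    have h2 := mul_pos_of_neg_of_neg (H.vol_B_A_A_p i (l := l + 1) (by omega) (by omega)) ih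
    have h3 := H.vol_B_A_A_p i (l := l) (by omega) (by omega)
    by_contra hc
    have := mul_nonpos_of_nonpos_of_nonneg h3.le (not_lt.1 hc)
    linarith

/-- The quadrangle of index `i` lies on one side of the plane through `v`, `A (i + 1)` and
`B (i + 1)`. -/
theorem vol_v_A_B_p_pos (H : CupolaSigns e m A B p v) (i : Fin 3) {k : ℕ} (hk : k ≤ m) :
    0 < vol e v (A (i + 1)) (B (i + 1)) (p i k) := by
  have hpk := H.p_mem i (k := k) (by omega)
  -- `P` completes `A (i + 1)` and `B (i + 1)` to a facet of the next quadrangle, whose plane starts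
  -- the rotation around this edge.
  set P := p (i + 1) 1 with hP
  have neP : ∀ k ≤ m, p i k ≠ P := fun k hk =>
    H.p_ne (by omega) (by omega) (Or.inl (by simp))
  have fP : ∀ x ∈ chainVertices m p, x ≠ B (i + 1) → x ≠ A (i + 1) → x ≠ P →
      0 < vol e (A (i + 1)) (B (i + 1)) P x := fun x hx h1 h2 h3 => by
    have := H.facetB (i + 1) 0 (by omega) x hx h1 (by rwa [H.zero]) h3
    rw [H.zero, vol_swap₁₂, zero_add] at this
    linarith
  have hPv : 0 ≤ vol e (A (i + 1)) (B (i + 1)) P v := by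
    have := H.v_region.2.2 (i + 1) 0 (by omega)
    rw [H.zero, vol_swap₁₂, zero_add] at this
    linarith
  have hBP : B i ≠ P := by
    intro h
    have h' := H.inj _ _ _ _ le_rfl (by omega) (H.B_eq i ▸ h)
    simp at h'
  have hPb := fP (B i) (H.B_mem i) (H.B_ne_B (by simp)) (H.A_ne_B _ _).symm hBP
  have hPq := fP (p i k) hpk (H.p_ne_B (by omega) (Or.inr (by omega)))
    (H.p_ne_A (by omega) (Or.inl (by simp))) (neP k hk)
  have hvb := H.vol_v_A_B_B i
  have hbq : 0 < vol e (A (i + 1)) (B (i + 1)) (B i) (p i k) := by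
    have := H.vol_B_A_p_p i (show k < m + 1 by omega) le_rfl
    rw [H.last] at this
    have e1 : vol e (A (i + 1)) (B (i + 1)) (B i) (p i k)
      = -vol e (B i) (A (i + 1)) (p i k) (B (i + 1)) := by
      simp only [vol, det3, PiLp.sub_apply]; ring
    linarith
  have key := vol_plucker e (A (i + 1)) (B (i + 1)) P (B i) v (p i k)
  have e2 : vol e (A (i + 1)) (B (i + 1)) (B i) v = -vol e v (A (i + 1)) (B (i + 1)) (B i) := by
    simp only [vol, det3, PiLp.sub_apply]; ring
  rw [e2] at key
  rw [← vol_rotate]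
  have h1 := mul_nonneg hPv hbq.le
  have h2 := mul_pos hPq hvb
  by_contra hc
  have := mul_nonpos_of_nonneg_of_nonpos hPb.le (not_lt.1 hc)
  linarith

theorem vol_v_A_B_A_neg (H : CupolaSigns e m A B p v) (i : Fin 3) :
    vol e v (A i) (B i) (A (i + 1)) < 0 := by
  have := H.vol_v_A_A_B_self i
  rw [vol_swap₃₄]
  linarith

/-- The quadrangle of index `i` lies on one side of the plane through `v`, `A i` and `B i`. -/
theorem vol_v_A_B_p_neg (H : CupolaSigns e m A B p v) (i : Fin 3) {k : ℕ} (hk0 : k ≠ 0)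
    (hk : k ≤ m + 1) : vol e v (A i) (B i) (p i k) < 0 := by
  have hpk := H.p_mem i hk
  set P := p (i + 2) m with hP
  have fP : ∀ x ∈ chainVertices m p, x ≠ B i → x ≠ A i → x ≠ P →
      vol e (A i) (B i) P x < 0 := fun x hx h1 h2 h3 => by
    have := H.facetA (i + 2) m le_rfl x hx (by rwa [fin3_add_two_add_one]) h3
      (by rwa [← H.B_eq])
    rw [← H.B_eq, fin3_add_two_add_one, vol_swap₂₃] at this
    linarith
  have hPv : vol e (A i) (B i) P v ≤ 0 := by
    have := H.v_region.2.1 (i + 2) m le_rfl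
    rw [← H.B_eq, fin3_add_two_add_one, vol_swap₂₃] at this
    linarith
  have hAP : A (i + 1) ≠ P := (H.p_ne_A (by omega) (Or.inl (by simp))).symm
  have hPa := fP (A (i + 1)) (H.A_mem _) (H.A_ne_B _ _) (H.A_ne_A (by simp)) hAP
  have hPq := fP (p i k) hpk (H.p_ne_B (by omega) (Or.inl (by simp)))
    (H.p_ne_A (by omega) (Or.inr hk0)) (H.p_ne hk (by omega) (Or.inl (by simp)))
  have hva := H.vol_v_A_B_A_neg i
  have haq : vol e (A i) (B i) (A (i + 1)) (p i k) < 0 := by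
    have := H.vol_B_A_A_p i (l := k) (by omega) hk
    have e1 : vol e (A i) (B i) (A (i + 1)) (p i k) = vol e (B i) (A (i + 1)) (A i) (p i k) := by
      simp only [vol, det3, PiLp.sub_apply]; ring
    linarith
  have key := vol_plucker e (A i) (B i) P (A (i + 1)) v (p i k)
  have e2 : vol e (A i) (B i) (A (i + 1)) v = -vol e v (A i) (B i) (A (i + 1)) := by
    simp only [vol, det3, PiLp.sub_apply]; ring
  rw [e2] at key
  rw [← vol_rotate]
  have h1 := mul_nonneg_of_nonpos_of_nonpos hPv haq.le
  have h2 := mul_pos_of_neg_of_neg hPq hva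
  by_contra hc
  have := mul_nonpos_of_nonpos_of_nonneg hPa.le (not_lt.1 hc)
  linarith

/-- The quadrangle of index `i` lies on one side of the plane through `v`, `B (i + 1)` and
`B i`. -/
theorem vol_v_B_B_p_pos (H : CupolaSigns e m A B p v) (i : Fin 3) {k : ℕ} (hk : k ≤ m) :
    0 < vol e v (B (i + 1)) (B i) (p i k) := by
  have hpk := H.p_mem i (k := k) (by omega)
  have hA := H.top i (A (i + 1)) (H.A_mem _) (H.A_ne_B _ _) (H.A_ne_B _ _) (H.A_ne_B _ _)
  have hq := H.top i (p i k) hpk (H.p_ne_B (by omega) (Or.inr (by omega)))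
    (H.p_ne_B (by omega) (Or.inr (by omega))) (H.p_ne_B (by omega) (Or.inr (by omega)))
  have hv := H.v_region.1 i
  have hvA := H.v_cone i
  have hAq : vol e (B (i + 1)) (B i) (A (i + 1)) (p i k) > 0 := by
    have := H.vol_B_A_p_p i (show k < m + 1 by omega) le_rfl
    rw [H.last] at this
    have e1 : vol e (B (i + 1)) (B i) (A (i + 1)) (p i k)
      = -vol e (B i) (A (i + 1)) (p i k) (B (i + 1)) := by
      simp only [vol, det3, PiLp.sub_apply]; ring
    linarith
  have key := vol_plucker e (B (i + 1)) (B i) (B (i + 2)) (A (i + 1)) v (p i k)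
  have e2 : vol e (B (i + 1)) (B i) (A (i + 1)) v = -vol e (B i) (B (i + 1)) (A (i + 1)) v :=
    vol_swap₁₂ _ _ _ _ _
  rw [e2] at key
  rw [← vol_rotate]
  have h1 := mul_nonneg hv hAq.le
  have h2 := mul_pos hq hvA
  by_contra hc
  have := mul_nonpos_of_nonneg_of_nonpos hA.le (not_lt.1 hc)
  linarith

theorem vol_v_B_B_A (H : CupolaSigns e m A B p v) (i : Fin 3) :
    0 < vol e v (B (i + 1)) (B i) (A (i + 1)) := by
  have := H.vol_v_A_B_B i
  rwa [← vol_rotate_last] at this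

/-- Suppose `v` were in the skylight plane. Then all three `A j` would be strictly on one side of
the plane through `v`, `B (i + 1)`, `B i`. But `B i` is a positive conic combination of the `A j` as
seen from `v`, and it lies on that plane. -/
theorem vol_v_B_B_B (H : CupolaSigns e m A B p v) (i : Fin 3) :
    0 < vol e v (B i) (B (i + 1)) (B (i + 2)) := by
  have h0 : 0 ≤ vol e v (B i) (B (i + 1)) (B (i + 2)) := by
    have := H.v_region.1 i
    have e1 : vol e v (B i) (B (i + 1)) (B (i + 2)) = vol e (B (i + 1)) (B i) (B (i + 2)) v := by
      simp only [vol, det3, PiLp.sub_apply]; ring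
    linarith
  refine lt_of_le_of_ne h0 fun h => ?_
  have h1 := H.vol_v_B_B_A i
  have h2 := H.vol_v_B_B_A (i + 1)
  have h3 := H.vol_v_B_B_p_pos (i + 1) (k := 0) (by omega)
  have h4 := H.vol_v_B_B_p_pos i (k := 0) (by omega)
  rw [fin3_add_one_add_one] at h2 h3
  rw [H.zero] at h3 h4
  have key := vol_plucker e v (B (i + 1)) (B i) (A (i + 1)) (B (i + 2)) (A (i + 2))
  have e1 : vol e v (B (i + 1)) (B i) (B (i + 2)) = 0 := by
    rw [vol_swap₂₃, ← h, neg_zero]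
  have e2 : vol e v (B (i + 1)) (B (i + 2)) (A (i + 2))
    = -vol e v (B (i + 2)) (B (i + 1)) (A (i + 2)) := vol_swap₂₃ _ _ _ _ _
  have e3 : vol e v (B (i + 1)) (A (i + 1)) (B (i + 2))
      = vol e v (B (i + 2)) (B (i + 1)) (A (i + 1)) := vol_rotate_last _ _ _ _ _
  rw [e1, e2, e3] at key
  have h5 : 0 < vol e v (B (i + 1)) (B i) (A (i + 2)) := by
    by_contra hc
    have := mul_nonpos_of_nonpos_of_nonneg (not_lt.1 hc) h3.le
    have := mul_pos h1 h2
    linarith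
  have key2 := vol_cramer e v (A i) (A (i + 1)) (A (i + 2)) (B (i + 1)) (B i) (B i)
  rw [vol_self₃₄, mul_zero] at key2
  have g1 := H.vol_v_A_A_B i i
  have g2 := H.vol_v_A_A_B i (i + 1)
  have g3 := H.vol_v_A_A_B i (i + 2)
  rw [fin3_add_one_add_one] at g2
  rw [fin3_add_two_add_one] at g3
  have e4 : vol e v (A i) (B i) (A (i + 2)) = vol e v (A (i + 2)) (A i) (B i) :=
    vol_rotate_last _ _ _ _ _
  have e5 : vol e v (B i) (A (i + 1)) (A (i + 2)) = vol e v (A (i + 1)) (A (i + 2)) (B i) :=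
    (vol_rotate_last _ _ _ _ _).symm
  rw [e4, e5] at key2
  have := mul_pos g2 h4
  have := mul_pos g3 h1
  have := mul_pos g1 h5
  linarith

end CupolaSigns

/-! ### Covering what `v` sees through the bottom facet -/

/-- The signs of `b` say which skylight edges separate the point from the skylight, and those of `s`
say on which side of the three spokes it lies. A single negative `b i` gives its own sector. For two
neighbouring ones the outer spokes are settled by the third index, and the sign at the spoke between
them decides. -/
theorem exists_sector {b s : Fin 3 → ℝ} (h : ∃ i, b i < 0) (hn : ¬∀ i, b i < 0)
    (h1 : ∀ i, b i < 0 → 0 < s i → b (i + 2) < 0)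
    (h2 : ∀ i, b i < 0 → s (i + 1) < 0 → b (i + 1) < 0) :
    ∃ i, b i < 0 ∧ s i ≤ 0 ∧ 0 ≤ s (i + 1) := by
  by_contra! hc
  simp only [Fin.forall_fin_succ, Fin.exists_fin_succ, Fin.succ_zero_eq_one, Fin.succ_one_eq_two,
    IsEmpty.forall_iff, and_true, IsEmpty.exists_iff, or_false] at h hn h1 h2 hc
  simp only [show (0 : Fin 3) + 1 = 1 from rfl, show (1 : Fin 3) + 1 = 2 from rfl,
    show (2 : Fin 3) + 1 = 0 from rfl, show (0 : Fin 3) + 2 = 2 from rfl,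
    show (1 : Fin 3) + 2 = 0 from rfl, show (2 : Fin 3) + 2 = 1 from rfl] at *
  grind

theorem exists_sign_change {f : ℕ → ℝ} {n : ℕ} (h0 : f 0 ≤ 0) (hn : 0 ≤ f (n + 1)) :
    ∃ k ≤ n, f k ≤ 0 ∧ 0 ≤ f (k + 1) := by
  induction n with
  | zero => exact ⟨0, le_rfl, h0, hn⟩
  | succ n ih =>
    by_cases h : 0 ≤ f (n + 1)
    · obtain ⟨k, hk, h⟩ := ih h
      exact ⟨k, by omega, h⟩
    · exact ⟨n + 1, le_rfl, (not_le.1 h).le, hn⟩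

/-- The simplex spanned by `v` and the top facet. -/
noncomputable def topTet (B : Fin 3 → E3) (v : E3) : Finset E3 := {v, B 0, B 1, B 2}

/-- The simplex spanned by `v` and the Schönhardt facet `(A i, A (i + 1), B i)`. -/
noncomputable def lowTet (A B : Fin 3 → E3) (v : E3) (i : Fin 3) : Finset E3 :=
  {v, A i, A (i + 1), B i}

/-- The simplex spanned by `v` and the Schönhardt facet `(A (i + 1), B (i + 1), B i)`. -/
noncomputable def highTet (A B : Fin 3 → E3) (v : E3) (i : Fin 3) : Finset E3 :=
  {v, A (i + 1), B (i + 1), B i}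

/-- The simplex spanned by a diagonal of the Schönhardt polytope and an edge of a chain. -/
noncomputable def chainTet (A B : Fin 3 → E3) (p : Fin 3 → ℕ → E3) (i : Fin 3) (k : ℕ) :
    Finset E3 :=
  {B i, A (i + 1), p i k, p i (k + 1)}

namespace CupolaSigns

variable {e : ℝ} {m : ℕ} {A B : Fin 3 → E3} {p : Fin 3 → ℕ → E3} {v : E3}

/-- The point lies between the extreme planes through the diagonal, hence between two consecutive
planes of that pencil; the two facet inequalities provide the remaining walls of the tetrahedron. -/
theorem mem_chainTet (H : CupolaSigns e m A B p v) {x : E3} (hx : x ∈ cupolaRegion e m A B p)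
    (i : Fin 3) (h0 : vol e (B i) (A (i + 1)) (A i) x ≤ 0)
    (h1 : 0 ≤ vol e (B i) (A (i + 1)) (B (i + 1)) x) :
    ∃ k ≤ m, x ∈ convexHull ℝ (chainTet A B p i k : Set E3) := by
  obtain ⟨k, hk, h2, h3⟩ := exists_sign_change (f := fun k => vol e (B i) (A (i + 1)) (p i k) x)
    (n := m) (by simpa [H.zero] using h0) (by simpa [H.last] using h1)
  refine ⟨k, hk, ?_⟩
  have hD := H.vol_B_A_p_succ i hk
  have hA := hx.2.1 i k hk
  have hB := hx.2.2 i k hk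
  -- The ends of the diagonal are exchanged to make the volume positive.
  have : x ∈ convexHull ℝ ({A (i + 1), B i, p i k, p i (k + 1)} : Set E3) := by
    refine mem_convexHull_four (e := e) ?_ ?_ ?_ ?_ ?_
    · rw [vol_swap₁₂]; linarith
    · have e1 : vol e x (B i) (p i k) (p i (k + 1)) = -vol e (B i) (p i k) (p i (k + 1)) x := by
        simp only [vol, det3, PiLp.sub_apply]; ring
      linarith
    · rwa [vol_rotate_last] at hA
    · rw [vol_swap₁₂, vol_swap₃₄]; simpa using h3
    · rw [vol_swap₁₂]; simpa using h2
  simpa [chainTet, Set.insert_comm] using this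

/-- The part of the region of a cupola seen from `v` through the bottom facet is covered. -/
theorem mem_inner (H : CupolaSigns e m A B p v) {x : E3} (hx : x ∈ cupolaRegion e m A B p)
    (hxA : ∀ i, 0 ≤ vol e v (A i) (A (i + 1)) x) :
    x ∈ convexHull ℝ (topTet B v : Set E3) ∨
      (∃ i, x ∈ convexHull ℝ (lowTet A B v i : Set E3)) ∨
      (∃ i, x ∈ convexHull ℝ (highTet A B v i : Set E3)) ∨
      ∃ i, ∃ k ≤ m, x ∈ convexHull ℝ (chainTet A B p i k : Set E3) := by
  by_cases hb : ∃ i, vol e v (B i) (B (i + 1)) x < 0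
  · right
    -- Not all three `b i` are negative: otherwise `x` would be a negative conic combination of the
    -- skylight vertices as seen from `v`, whereas these are strictly inside a half-space whose
    -- closure contains `x`. The other two hypotheses are Plücker relations around the lines from
    -- `v` to the skylight vertices.
    obtain ⟨i, hi, hs1, hs2⟩ := exists_sector (b := fun i => vol e v (B i) (B (i + 1)) x)
      (s := fun i => vol e v (A i) (B i) x) hb (by
        intro hall
        have key := vol_cramer e v (B 0) (B 1) (B 2) (A 1) (A 2) x
        have h0 := hall 0
        have h1 := hall 1
        have h2 := hall 2
        have hT := H.vol_v_B_B_B 0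
        have g0 := H.vol_v_A_A_B 0 1
        have g1 := H.vol_v_A_A_B 1 1
        have g2 := H.vol_v_A_A_B 2 1
        have hx := hxA 1
        simp only [show (0 : Fin 3) + 1 = 1 from rfl, show (1 : Fin 3) + 1 = 2 from rfl,
          show (2 : Fin 3) + 1 = 0 from rfl, show (0 : Fin 3) + 2 = 2 from rfl] at *
        rw [vol_rotate_last] at h2
        rw [← vol_rotate_last] at h1
        have := mul_pos_of_neg_of_neg h2 (neg_lt_zero.2 g1)
        have := mul_pos_of_neg_of_neg h0 (neg_lt_zero.2 g2)
        have := mul_pos_of_neg_of_neg h1 (neg_lt_zero.2 g0)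
        have := mul_nonneg hT.le hx
        have e2 : vol e v (B 0) x (B 2) = vol e v (B 2) (B 0) x := by
          simp only [vol, det3, PiLp.sub_apply]; ring
        simp only [vol_rotate_last] at *
        nlinarith) (by
        intro i hb hs
        have f1 := H.vol_v_B_B_p_pos i (k := 0) (by omega)
        have f2 := H.vol_v_A_B_B (i + 2)
        have f4 := H.vol_v_B_B_B i
        have key := vol_plucker e v (B i) (A i) (B (i + 1)) (B (i + 2)) x
        rw [H.zero, ← vol_rotate_last] at f1
        rw [fin3_add_two_add_one] at f2 ⊢
        rw [vol_swap₂₃ e v (A i) (B i) (B (i + 2)), vol_swap₂₃ e v (A i) (B i) x,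
          vol_swap₂₃ e v (B (i + 2)) (B i) x] at key
        have := mul_pos_of_neg_of_neg (neg_lt_zero.2 f2) hb
        have := mul_pos hs f4
        by_contra hc
        have := mul_nonneg f1.le (not_lt.1 hc)
        linarith) (by
        intro i hb hs
        have f1 := H.vol_v_A_B_B i
        have f2 := H.vol_v_A_B_p_neg (i + 1) (k := m + 1) (by omega) le_rfl
        have f4 := H.vol_v_B_B_B i
        have key := vol_plucker e v (B (i + 1)) (A (i + 1)) (B (i + 2)) (B i) x
        rw [H.last, fin3_add_one_add_one] at f2
        rw [fin3_add_one_add_one]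
        rw [vol_swap₂₃ e v (A (i + 1)) (B (i + 1)) (B (i + 2)),
          vol_swap₂₃ e v (B i) (B (i + 1)) x, vol_swap₂₃ e v (A (i + 1)) (B (i + 1)) (B i),
          vol_swap₂₃ e v (A (i + 1)) (B (i + 1)) x,
          vol_rotate_last e v (B i) (B (i + 1)) (B (i + 2))] at key
        have := mul_pos_of_neg_of_neg f2 hb
        have := mul_pos_of_neg_of_neg hs (neg_lt_zero.2 f4)
        by_contra hc
        have := mul_nonneg f1.le (not_lt.1 hc)
        linarith)
    have hxi := hxA i
    -- From `v`, the point appears in the quadrangle of index `i`, and the diagonal selects a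
    -- triangle of it. If the point is in front of that triangle, it is in the low or high simplex.
    -- Otherwise the relation around the diagonal supplies the second inequality needed for a chain
    -- simplex.
    have hq0v := H.vol_v_A_A_B_self i
    have hBv := H.vol_v_A_B_B i
    have key := vol_plucker e (B i) (A (i + 1)) (A i) (B (i + 1)) v x
    have hq0B := H.reflex i
    have e1 : vol e (B i) (A (i + 1)) (A i) v = vol e v (A i) (A (i + 1)) (B i) :=
      vol_reverse _ _ _ _ _
    have e2 : vol e (B i) (A (i + 1)) (B (i + 1)) v = -vol e v (A (i + 1)) (B (i + 1)) (B i) := by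
      simp only [vol, det3, PiLp.sub_apply]; ring
    have e3 : vol e (B i) (A (i + 1)) v x = -vol e v (A (i + 1)) (B i) x := by
      simp only [vol, det3, PiLp.sub_apply]; ring
    rw [e1, e2, e3] at key
    rcases le_or_gt 0 (vol e v (A (i + 1)) (B i) x) with h | h
    · rcases le_or_gt 0 (vol e x (A i) (A (i + 1)) (B i)) with h' | h'
      · refine Or.inl ⟨i, ?_⟩
        have := mem_convexHull_four (H.vol_v_A_A_B_self i) h' (by rwa [← vol_rotate_last])
          (by rw [vol_swap₃₄]; linarith) hxi
        simpa [lowTet] using this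
      · refine Or.inr (Or.inr ⟨i, ?_⟩)
        rw [← vol_reverse] at h'
        refine H.mem_chainTet hx i h'.le ?_
        have := mul_nonneg_of_nonpos_of_nonpos hq0B.le (neg_nonpos.2 h)
        have := mul_pos_of_neg_of_neg h' (neg_lt_zero.2 hBv)
        by_contra hc
        have := mul_pos hq0v (neg_pos.2 (not_le.1 hc))
        linarith
    · rcases le_or_gt 0 (vol e x (A (i + 1)) (B (i + 1)) (B i)) with h' | h'
      · refine Or.inr (Or.inl ⟨i, ?_⟩)
        have := mem_convexHull_four (H.vol_v_A_B_B i) h'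
          (by rw [← vol_rotate_last, vol_swap₂₃]; linarith)
          (by rw [vol_swap₃₄]; linarith) hs2
        simpa [highTet] using this
      · refine Or.inr (Or.inr ⟨i, ?_⟩)
        have e4 : vol e (B i) (A (i + 1)) (B (i + 1)) x
            = -vol e x (A (i + 1)) (B (i + 1)) (B i) := by
          simp only [vol, det3, PiLp.sub_apply]; ring
        refine H.mem_chainTet hx i ?_ (by linarith)
        have := mul_pos hq0v (neg_pos.2 h')
        have := mul_pos_of_neg_of_neg hq0B h
        by_contra hc
        have := mul_pos (not_le.1 hc) hBv
        rw [e4] at key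
        linarith
  · left
    push Not at hb
    have h0 := hb 0
    have h1 := hb 1
    have h2 := hb 2
    have hT := H.vol_v_B_B_B 0
    have ht := hx.1 0
    simp only [show (0 : Fin 3) + 1 = 1 from rfl, show (1 : Fin 3) + 1 = 2 from rfl,
      show (2 : Fin 3) + 1 = 0 from rfl, show (0 : Fin 3) + 2 = 2 from rfl] at *
    have := mem_convexHull_four (x := x) hT
      (by
        have e1 : vol e x (B 0) (B 1) (B 2) = vol e (B 1) (B 0) (B 2) x := by
          simp only [vol, det3, PiLp.sub_apply]; ring
        rwa [e1])
      (by rwa [← vol_rotate_last]) (by rwa [vol_rotate_last]) h0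
    simpa [topTet] using this

end CupolaSigns

/-! ### Inner tetrahedra meet face to face -/

theorem affineIndependent_coe_three {e : ℝ} {a b c d : E3} (h : vol e a b c d ≠ 0) :
    AffineIndependent ℝ ((↑) : (({a, b, c} : Finset E3)) → E3) :=
  (affineIndependent_coe_of_vol_ne_zero h).mono (s := (({a, b, c} : Finset E3) : Set E3))
    (t := (({a, b, c, d} : Finset E3) : Set E3)) (by intro x; simp; tauto)

/-- Two simplices, given by their vertices, meet in their common face. -/
def MeetInFace (s t : Finset E3) : Prop :=
  convexHull ℝ (s : Set E3) ∩ convexHull ℝ (t : Set E3) = convexHull ℝ ((s : Set E3) ∩ t)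

theorem MeetInFace.symm {s t : Finset E3} (h : MeetInFace s t) : MeetInFace t s := by
  unfold MeetInFace at *
  rw [inter_comm, h, inter_comm (s : Set E3)]

theorem MeetInFace.refl (s : Finset E3) : MeetInFace s s := by
  simp [MeetInFace]

/-- The vertices of the quadrangle of index `i`, as seen from `v`. -/
def quadVertices (m : ℕ) (A B : Fin 3 → E3) (p : Fin 3 → ℕ → E3) (v : E3) (i : Fin 3) : Set E3 :=
  {x | x = v ∨ x = A (i + 1) ∨ x = B i ∨ ∃ k ≤ m + 1, x = p i k}

namespace CupolaSigns

variable {e : ℝ} {m : ℕ} {A B : Fin 3 → E3} {p : Fin 3 → ℕ → E3} {v : E3}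

theorem quad_right (H : CupolaSigns e m A B p v) {i : Fin 3} {x : E3}
    (hx : x ∈ quadVertices m A B p v i) :
    0 ≤ vol e v (A (i + 1)) (B (i + 1)) x ∧
      (vol e v (A (i + 1)) (B (i + 1)) x = 0 → x ∈ ({v, A (i + 1), B (i + 1)} : Finset E3)) := by
  rcases hx with rfl | rfl | rfl | ⟨k, hk, rfl⟩
  · simp [vol_self₁₄]
  · simp [vol_self₂₄]
  · have := H.vol_v_A_B_B i
    exact ⟨this.le, fun h => absurd h this.ne'⟩
  · rcases hk.eq_or_lt with rfl | hk
    · simp [H.last, vol_self₃₄]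
    · have := H.vol_v_A_B_p_pos i (k := k) (by omega)
      exact ⟨this.le, fun h => absurd h this.ne'⟩

theorem quad_left (H : CupolaSigns e m A B p v) {i : Fin 3} {x : E3}
    (hx : x ∈ quadVertices m A B p v i) :
    vol e v (A i) (B i) x ≤ 0 ∧
      (vol e v (A i) (B i) x = 0 → x ∈ ({v, A i, B i} : Finset E3)) := by
  rcases hx with rfl | rfl | rfl | ⟨k, hk, rfl⟩
  · simp [vol_self₁₄]
  · have := H.vol_v_A_B_A_neg i
    exact ⟨this.le, fun h => absurd h this.ne⟩
  · simp [vol_self₃₄]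
  · rcases Nat.eq_zero_or_pos k with rfl | hk0
    · simp [H.zero, vol_self₂₄]
    · have := H.vol_v_A_B_p_neg i hk0.ne' hk
      exact ⟨this.le, fun h => absurd h this.ne⟩

theorem quad_top (H : CupolaSigns e m A B p v) {i : Fin 3} {x : E3}
    (hx : x ∈ quadVertices m A B p v i) :
    0 ≤ vol e v (B (i + 1)) (B i) x ∧
      (vol e v (B (i + 1)) (B i) x = 0 → x ∈ ({v, B (i + 1), B i} : Finset E3)) := by
  rcases hx with rfl | rfl | rfl | ⟨k, hk, rfl⟩
  · simp [vol_self₁₄]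
  · have := H.vol_v_B_B_A i
    exact ⟨this.le, fun h => absurd h this.ne'⟩
  · simp [vol_self₃₄]
  · rcases hk.eq_or_lt with rfl | hk
    · simp [H.last, vol_self₂₄]
    · have := H.vol_v_B_B_p_pos i (k := k) (by omega)
      exact ⟨this.le, fun h => absurd h this.ne'⟩

theorem meet_quad_succ (H : CupolaSigns e m A B p v) (i : Fin 3) {s t : Finset E3}
    (hs : (s : Set E3) ⊆ quadVertices m A B p v i)
    (ht : (t : Set E3) ⊆ quadVertices m A B p v (i + 1)) : MeetInFace s t :=
  convexHull_inter_of_separated (volMap e v (A (i + 1)) (B (i + 1)))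
    (affineIndependent_coe_three (H.vol_v_A_B_B i).ne')
    (fun _ hx => H.quad_right (hs hx)) (fun _ hx => H.quad_left (ht hx))

/-- Simplices of different quadrangles meet in faces. -/
theorem meet_quad (H : CupolaSigns e m A B p v) {i j : Fin 3} (hij : i ≠ j) {s t : Finset E3}
    (hs : (s : Set E3) ⊆ quadVertices m A B p v i)
    (ht : (t : Set E3) ⊆ quadVertices m A B p v j) : MeetInFace s t := by
  have : j = i + 1 ∨ i = j + 1 := by revert hij; fin_cases i <;> fin_cases j <;> simp
  rcases this with rfl | rfl
  · exact H.meet_quad_succ i hs ht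
  · exact (H.meet_quad_succ j ht hs).symm

theorem meet_quad_top (H : CupolaSigns e m A B p v) (i : Fin 3) {s : Finset E3}
    (hs : (s : Set E3) ⊆ quadVertices m A B p v i) : MeetInFace s (topTet B v) := by
  refine convexHull_inter_of_separated (volMap e v (B (i + 1)) (B i))
    (affineIndependent_coe_three (H.vol_v_B_B_A i).ne') (fun _ hx => H.quad_top (hs hx)) ?_
  have h1 : vol e v (B (i + 1)) (B i) (B (i + 2)) < 0 := by
    have := H.vol_v_B_B_B i
    rw [vol_swap₂₃]; linarith
  have h2 : ∀ x ∈ topTet B v, x = v ∨ x = B i ∨ x = B (i + 1) ∨ x = B (i + 2) := by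
    intro x hx
    fin_cases i <;> simp [topTet] at hx ⊢ <;> tauto
  intro x hx
  rcases h2 x hx with rfl | rfl | rfl | rfl
  · simp [vol_self₁₄]
  · simp [vol_self₃₄]
  · simp [vol_self₂₄]
  · exact ⟨h1.le, fun h => absurd h h1.ne⟩

theorem lowTet_subset (H : CupolaSigns e m A B p v) (i : Fin 3) :
    (lowTet A B v i : Set E3) ⊆ quadVertices m A B p v i := by
  intro x hx
  simp only [lowTet, Finset.coe_insert, Finset.coe_singleton, mem_insert_iff,
    mem_singleton_iff] at hx
  rcases hx with rfl | rfl | rfl | rfl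
  exacts [Or.inl rfl, Or.inr (Or.inr (Or.inr ⟨0, by omega, (H.zero i).symm⟩)),
    Or.inr (Or.inl rfl), Or.inr (Or.inr (Or.inl rfl))]

theorem highTet_subset (H : CupolaSigns e m A B p v) (i : Fin 3) :
    (highTet A B v i : Set E3) ⊆ quadVertices m A B p v i := by
  intro x hx
  simp only [highTet, Finset.coe_insert, Finset.coe_singleton, mem_insert_iff,
    mem_singleton_iff] at hx
  rcases hx with rfl | rfl | rfl | rfl
  exacts [Or.inl rfl, Or.inr (Or.inl rfl),
    Or.inr (Or.inr (Or.inr ⟨m + 1, le_rfl, (H.last i).symm⟩)), Or.inr (Or.inr (Or.inl rfl))]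

theorem chainTet_subset (_ : CupolaSigns e m A B p v) (i : Fin 3) {k : ℕ} (hk : k ≤ m) :
    (chainTet A B p i k : Set E3) ⊆ quadVertices m A B p v i := by
  intro x hx
  simp only [chainTet, Finset.coe_insert, Finset.coe_singleton, mem_insert_iff,
    mem_singleton_iff] at hx
  rcases hx with rfl | rfl | rfl | rfl
  exacts [Or.inr (Or.inr (Or.inl rfl)), Or.inr (Or.inl rfl),
    Or.inr (Or.inr (Or.inr ⟨k, by omega, rfl⟩)), Or.inr (Or.inr (Or.inr ⟨k + 1, by omega, rfl⟩))]

/-- The plane through `v` and the diagonal separates. -/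
theorem meet_low_high (H : CupolaSigns e m A B p v) (i : Fin 3) :
    MeetInFace (lowTet A B v i) (highTet A B v i) := by
  have h1 := H.vol_v_A_A_B_self i
  have h2 := H.vol_v_A_B_B i
  rw [← vol_rotate_last] at h1
  rw [← vol_rotate_last, ← vol_rotate_last, vol_swap₂₃] at h2
  refine convexHull_inter_of_separated (volMap e v (A (i + 1)) (B i))
    (affineIndependent_coe_three h1.ne') ?_ ?_
  · intro x hx
    simp only [lowTet, Finset.mem_insert, Finset.mem_singleton] at hx
    rcases hx with rfl | rfl | rfl | rfl
    · simp [vol_self₁₄]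
    · exact ⟨h1.le, fun h => absurd h h1.ne'⟩
    · simp [vol_self₂₄]
    · simp [vol_self₃₄]
  · intro x hx
    simp only [highTet, Finset.mem_insert, Finset.mem_singleton] at hx
    rcases hx with rfl | rfl | rfl | rfl
    · simp [vol_self₁₄]
    · simp [vol_self₂₄]
    · simp only [volMap_apply]
      exact ⟨by linarith, fun h => absurd h (by linarith)⟩
    · simp [vol_self₃₄]

/-- The plane of the Schönhardt facet under the low simplex separates: `v` is on one side and the
whole chain on the other. -/
theorem meet_low_chain (H : CupolaSigns e m A B p v) (i : Fin 3) {k : ℕ} (hk : k ≤ m) :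
    MeetInFace (lowTet A B v i) (chainTet A B p i k) := by
  have h1 := H.vol_v_A_A_B_self i
  rw [← vol_reverse] at h1
  refine convexHull_inter_of_separated (volMap e (B i) (A (i + 1)) (A i))
    (affineIndependent_coe_three h1.ne') ?_ ?_
  · intro x hx
    simp only [lowTet, Finset.mem_insert, Finset.mem_singleton] at hx
    rcases hx with rfl | rfl | rfl | rfl
    · exact ⟨h1.le, fun h => absurd h h1.ne'⟩
    · simp [vol_self₃₄]
    · simp [vol_self₂₄]
    · simp [vol_self₁₄]
  · have hp : ∀ k ≤ m + 1, vol e (B i) (A (i + 1)) (A i) (p i k) ≤ 0 ∧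
        (vol e (B i) (A (i + 1)) (A i) (p i k) = 0 → p i k ∈ ({B i, A (i + 1), A i} : Finset E3)) := by
      intro k hk
      rcases Nat.eq_zero_or_pos k with rfl | hk0
      · simp [H.zero, vol_self₃₄]
      · have := H.vol_B_A_A_p i hk0 hk
        exact ⟨this.le, fun h => absurd h this.ne⟩
    intro x hx
    simp only [chainTet, Finset.mem_insert, Finset.mem_singleton] at hx
    rcases hx with rfl | rfl | rfl | rfl
    · simp [vol_self₁₄]
    · simp [vol_self₂₄]
    · exact hp k (by omega)
    · exact hp (k + 1) (by omega)

theorem vol_B_A_p_B_aux (H : CupolaSigns e m A B p v) (i : Fin 3) {l : ℕ} (hl : l ≤ m + 1) :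
    ∀ k ≤ m + 1, (k ≤ l → 0 ≤ vol e (B i) (A (i + 1)) (p i l) (p i k)) ∧
      (l ≤ k → vol e (B i) (A (i + 1)) (p i l) (p i k) ≤ 0) ∧
      (vol e (B i) (A (i + 1)) (p i l) (p i k) = 0 →
        p i k ∈ ({B i, A (i + 1), p i l} : Finset E3)) := by
  intro k hk
  rcases lt_trichotomy k l with h | rfl | h
  · have := H.vol_B_A_p_p i h hl
    rw [vol_swap₃₄]
    exact ⟨fun _ => by linarith, fun _ => by omega, fun _ => by linarith⟩
  · simp [vol_self₃₄]
  · have := H.vol_B_A_p_p i h hk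
    exact ⟨fun _ => by omega, fun _ => by linarith, fun _ => by linarith⟩

theorem meet_chain_high (H : CupolaSigns e m A B p v) (i : Fin 3) {k : ℕ} (hk : k ≤ m) :
    MeetInFace (chainTet A B p i k) (highTet A B v i) := by
  have h1 := H.vol_v_A_B_B i
  have e1 : vol e (B i) (A (i + 1)) (B (i + 1)) v = -vol e v (A (i + 1)) (B (i + 1)) (B i) := by
    simp only [vol, det3, PiLp.sub_apply]; ring
  have h2 : vol e (B i) (A (i + 1)) (B (i + 1)) v < 0 := by linarith
  refine convexHull_inter_of_separated (volMap e (B i) (A (i + 1)) (B (i + 1)))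
    (affineIndependent_coe_three h2.ne) ?_ ?_
  · have hp := H.vol_B_A_p_B_aux i (l := m + 1) le_rfl
    rw [H.last] at hp
    intro x hx
    simp only [chainTet, Finset.mem_insert, Finset.mem_singleton] at hx
    rcases hx with rfl | rfl | rfl | rfl
    · simp [vol_self₁₄]
    · simp [vol_self₂₄]
    · exact ⟨(hp k (by omega)).1 (by omega), (hp k (by omega)).2.2⟩
    · exact ⟨(hp (k + 1) (by omega)).1 (by omega), (hp (k + 1) (by omega)).2.2⟩
  · intro x hx
    simp only [highTet, Finset.mem_insert, Finset.mem_singleton] at hx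
    rcases hx with rfl | rfl | rfl | rfl
    · exact ⟨h2.le, fun h => absurd h h2.ne⟩
    · simp [vol_self₂₄]
    · simp [vol_self₃₄]
    · simp [vol_self₁₄]

/-- The plane through the diagonal and `p i l` separates, since chain vertices are sorted by angle.
-/
theorem meet_chain_chain_of_lt (H : CupolaSigns e m A B p v) (i : Fin 3) {k l : ℕ} (hkl : k < l)
    (hl : l ≤ m) : MeetInFace (chainTet A B p i k) (chainTet A B p i l) := by
  have hp := H.vol_B_A_p_B_aux i (l := l) (by omega)
  refine convexHull_inter_of_separated (volMap e (B i) (A (i + 1)) (p i l))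
    (affineIndependent_coe_three (H.vol_B_A_p_succ i hl).ne) ?_ ?_
  · intro x hx
    simp only [chainTet, Finset.mem_insert, Finset.mem_singleton] at hx
    rcases hx with rfl | rfl | rfl | rfl
    · simp [vol_self₁₄]
    · simp [vol_self₂₄]
    · exact ⟨(hp k (by omega)).1 (by omega), (hp k (by omega)).2.2⟩
    · exact ⟨(hp (k + 1) (by omega)).1 (by omega), (hp (k + 1) (by omega)).2.2⟩
  · intro x hx
    simp only [chainTet, Finset.mem_insert, Finset.mem_singleton] at hx
    rcases hx with rfl | rfl | rfl | rfl
    · simp [vol_self₁₄]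
    · simp [vol_self₂₄]
    · exact ⟨(hp l (by omega)).2.1 (by omega), (hp l (by omega)).2.2⟩
    · exact ⟨(hp (l + 1) (by omega)).2.1 (by omega), (hp (l + 1) (by omega)).2.2⟩

theorem meet_chain_chain (H : CupolaSigns e m A B p v) (i : Fin 3) {k l : ℕ} (hk : k ≤ m)
    (hl : l ≤ m) : MeetInFace (chainTet A B p i k) (chainTet A B p i l) := by
  rcases lt_trichotomy k l with h | rfl | h
  · exact H.meet_chain_chain_of_lt i h hl
  · exact MeetInFace.refl _
  · exact (H.meet_chain_chain_of_lt i h hk).symm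

end CupolaSigns

/-- The simplices with apex `v` over the Schönhardt facets, and the simplices of the chains. -/
noncomputable def innerTets (m : ℕ) (A B : Fin 3 → E3) (p : Fin 3 → ℕ → E3) (v : E3) :
    Finset (Finset E3) :=
  {topTet B v} ∪ Finset.univ.image (lowTet A B v) ∪ Finset.univ.image (highTet A B v)
    ∪ (Finset.univ ×ˢ Finset.range (m + 1)).image fun x : Fin 3 × ℕ => chainTet A B p x.1 x.2

theorem mem_innerTets {m : ℕ} {A B : Fin 3 → E3} {p : Fin 3 → ℕ → E3} {v : E3} {t : Finset E3} :
    t ∈ innerTets m A B p v ↔ t = topTet B v ∨ (∃ i, t = lowTet A B v i) ∨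
      (∃ i, t = highTet A B v i) ∨ ∃ i, ∃ k ≤ m, t = chainTet A B p i k := by
  simp only [innerTets, Finset.mem_union, Finset.mem_singleton, Finset.mem_image,
    Finset.mem_univ, true_and, Finset.mem_product, Finset.mem_range, Prod.exists, or_assoc,
    Nat.lt_succ_iff, eq_comm (b := t)]

theorem card_innerTets_le {m : ℕ} {A B : Fin 3 → E3} {p : Fin 3 → ℕ → E3} {v : E3} :
    (innerTets m A B p v).card ≤ 3 * m + 10 := by
  refine (Finset.card_union_le _ _).trans ?_
  have h1 := Finset.card_union_le ({topTet B v} ∪ Finset.univ.image (lowTet A B v))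
    (Finset.univ.image (highTet A B v))
  have h2 := Finset.card_union_le {topTet B v} (Finset.univ.image (lowTet A B v))
  have h3 := Finset.card_image_le (s := Finset.univ) (f := lowTet A B v)
  have h4 := Finset.card_image_le (s := Finset.univ) (f := highTet A B v)
  have h5 := Finset.card_image_le (s := Finset.univ ×ˢ Finset.range (m + 1))
    (f := fun x : Fin 3 × ℕ => chainTet A B p x.1 x.2)
  simp only [Finset.card_product, Finset.card_univ, Fintype.card_fin, Finset.card_range,
    Finset.card_singleton] at *
  omega

namespace CupolaSigns

variable {e : ℝ} {m : ℕ} {A B : Fin 3 → E3} {p : Fin 3 → ℕ → E3} {v : E3}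

theorem exists_vol_of_mem_innerTets (H : CupolaSigns e m A B p v) {t : Finset E3}
    (ht : t ∈ innerTets m A B p v) : ∃ a b c d, t = {a, b, c, d} ∧ vol e a b c d ≠ 0 := by
  rcases mem_innerTets.1 ht with rfl | ⟨i, rfl⟩ | ⟨i, rfl⟩ | ⟨i, k, hk, rfl⟩
  exacts [⟨_, _, _, _, rfl, (H.vol_v_B_B_B 0).ne'⟩, ⟨_, _, _, _, rfl, (H.vol_v_A_A_B_self i).ne'⟩,
    ⟨_, _, _, _, rfl, (H.vol_v_A_B_B i).ne'⟩, ⟨_, _, _, _, rfl, (H.vol_B_A_p_succ i hk).ne⟩]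

theorem meet_inner (H : CupolaSigns e m A B p v) {s t : Finset E3}
    (hs : s ∈ innerTets m A B p v) (ht : t ∈ innerTets m A B p v) : MeetInFace s t := by
  have key : ∀ {u}, u ∈ innerTets m A B p v → u = topTet B v ∨
      ∃ i, (u : Set E3) ⊆ quadVertices m A B p v i ∧
        (u = lowTet A B v i ∨ u = highTet A B v i ∨ ∃ k ≤ m, u = chainTet A B p i k) := by
    intro u hu
    rcases mem_innerTets.1 hu with rfl | ⟨i, rfl⟩ | ⟨i, rfl⟩ | ⟨i, k, hk, rfl⟩
    exacts [Or.inl rfl, Or.inr ⟨i, H.lowTet_subset i, Or.inl rfl⟩,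
      Or.inr ⟨i, H.highTet_subset i, Or.inr (Or.inl rfl)⟩,
      Or.inr ⟨i, H.chainTet_subset i hk, Or.inr (Or.inr ⟨k, hk, rfl⟩)⟩]
  rcases key hs with rfl | ⟨i, hsi, hs'⟩
  · rcases key ht with rfl | ⟨j, htj, -⟩
    · exact MeetInFace.refl _
    · exact (H.meet_quad_top j htj).symm
  rcases key ht with rfl | ⟨j, htj, ht'⟩
  · exact H.meet_quad_top i hsi
  by_cases hij : i = j
  · subst hij
    rcases hs' with rfl | rfl | ⟨k, hk, rfl⟩ <;> rcases ht' with rfl | rfl | ⟨l, hl, rfl⟩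
    exacts [MeetInFace.refl _, H.meet_low_high i, H.meet_low_chain i hl, (H.meet_low_high i).symm,
      MeetInFace.refl _, (H.meet_chain_high i hl).symm, (H.meet_low_chain i hk).symm,
      H.meet_chain_high i hk, H.meet_chain_chain i hk hl]
  · exact H.meet_quad hij hsi htj

end CupolaSigns

/-! ### Optimal triangles -/

theorem exists_relation_of_det3_eq_zero {a b c : E3} (h : det3 a b c = 0) :
    ∃ α β γ : ℝ, (α ≠ 0 ∨ β ≠ 0 ∨ γ ≠ 0) ∧ α • a + β • b + γ • c = 0 := by
  have hM : Matrix.det !![a 0, b 0, c 0; a 1, b 1, c 1; a 2, b 2, c 2] = 0 := by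
    rw [Matrix.det_fin_three, ← h]
    simp [det3]; ring
  obtain ⟨w, hw, hw0⟩ := Matrix.exists_mulVec_eq_zero_iff.2 hM
  refine ⟨w 0, w 1, w 2, ?_, ?_⟩
  · by_contra! hc
    apply hw
    ext i; fin_cases i <;> simp [hc.1, hc.2.1, hc.2.2]
  · have h0 := congrFun hw0 0
    have h1 := congrFun hw0 1
    have h2 := congrFun hw0 2
    simp [Matrix.mulVec, dotProduct, Fin.sum_univ_three] at h0 h1 h2
    ext i; fin_cases i <;> simp <;> linarith

/-- Conic Carathéodory theorem: a conic combination can be chosen without linear relations between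
the vectors. -/
theorem exists_conic_independent {U : Finset E3} {w : E3 → ℝ} {x : E3} (hw : ∀ u ∈ U, 0 ≤ w u)
    (hx : ∑ u ∈ U, w u • u = x) :
    ∃ t ⊆ U, ∃ w' : E3 → ℝ, (∀ u ∈ t, 0 < w' u) ∧ ∑ u ∈ t, w' u • u = x ∧
      ∀ g : E3 → ℝ, ∑ u ∈ t, g u • u = 0 → ∀ u ∈ t, g u = 0 := by
  induction hn : U.card using Nat.strong_induction_on generalizing U w with
  | _ n ih =>
    have reduce : ∀ w' : E3 → ℝ, (∀ u ∈ U, 0 ≤ w' u) → ∑ u ∈ U, w' u • u = x →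
        (∃ u ∈ U, w' u = 0) → ∃ t ⊆ U, ∃ w' : E3 → ℝ, (∀ u ∈ t, 0 < w' u) ∧
          ∑ u ∈ t, w' u • u = x ∧ ∀ g : E3 → ℝ, ∑ u ∈ t, g u • u = 0 → ∀ u ∈ t, g u = 0 := by
      rintro w' hw' hx' ⟨u, hu, hu0⟩
      obtain ⟨t, ht, h⟩ := ih (U.erase u).card (hn ▸ Finset.card_erase_lt_of_mem hu)
        (U := U.erase u) (w := w') (fun y hy => hw' y (Finset.mem_of_mem_erase hy))
        (by rw [← hx', ← Finset.add_sum_erase _ _ hu, hu0, zero_smul, zero_add]) rfl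
      exact ⟨t, ht.trans (Finset.erase_subset _ _), h⟩
    by_cases h0 : ∃ u ∈ U, w u = 0
    · exact reduce w hw hx h0
    push Not at h0
    have hpos : ∀ u ∈ U, 0 < w u := fun u hu => lt_of_le_of_ne (hw u hu) (h0 u hu).symm
    by_cases hg : ∀ g : E3 → ℝ, ∑ u ∈ U, g u • u = 0 → ∀ u ∈ U, g u = 0
    · exact ⟨U, subset_rfl, w, hpos, hx, hg⟩
    push Not at hg
    have : ∃ g : E3 → ℝ, ∑ u ∈ U, g u • u = 0 ∧ ∃ u ∈ U, 0 < g u := by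
      obtain ⟨g, hg, u, hu, hgu⟩ := hg
      rcases lt_or_gt_of_ne hgu with h | h
      · exact ⟨fun u => -g u, by simp [hg], u, hu, by simpa using h⟩
      · exact ⟨g, hg, u, hu, h⟩
    obtain ⟨g, hg, u, hu, hgu⟩ := this
    -- Moving along the relation `g` until a first coefficient vanishes: the largest ratio
    -- identifies it and keeps the others nonnegative.
    obtain ⟨z, hz, hmax⟩ := U.exists_max_image (fun u => g u / w u) ⟨u, hu⟩
    have hgz : 0 < g z := by
      have := (div_pos hgu (hpos u hu)).trans_le (hmax u hu)
      exact (div_pos_iff_of_pos_right (hpos z hz)).1 this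
    refine reduce (fun u => w u - w z / g z * g u) ?_ ?_ ⟨z, hz, ?_⟩
    · intro y hy
      have := hmax y hy
      rw [div_le_div_iff₀ (hpos y hy) (hpos z hz)] at this
      rw [sub_nonneg, div_mul_eq_mul_div, div_le_iff₀ hgz]
      linarith
    · simp only [sub_smul, mul_smul, Finset.sum_sub_distrib, ← Finset.smul_sum, hg, hx]
      simp
    · field_simp
      simp

/-- Carathéodory leaves at most three independent vectors, and genericity forbids fewer than three.
Exchanging two of them corrects the orientation. -/
theorem exists_triangle_of_conic {e : ℝ} (he : e ≠ 0) {v x : E3} {W : Finset E3} {w : E3 → ℝ}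
    (hw : ∀ y ∈ W, 0 ≤ w y) (hx : x - v = ∑ y ∈ W, w y • (y - v)) (hxv : x ≠ v)
    (hgen : ∀ a ∈ W, ∀ b ∈ W, x - v ∉ Submodule.span ℝ {a - v, b - v}) :
    ∃ a ∈ W, ∃ b ∈ W, ∃ c ∈ W, 0 < vol e v a b c ∧ 0 < vol e v x b c ∧ 0 < vol e v a x c ∧
      0 < vol e v a b x := by
  have hinj : Set.InjOn (fun y => y - v) (W : Set E3) := fun a _ b _ h => by simpa using h
  obtain ⟨t, htU, g, hg, hgx, hind⟩ := exists_conic_independent (U := W.image fun y => y - v)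
    (w := fun u => w (u + v)) (x := x - v) (by simpa using hw)
    (by rw [Finset.sum_image hinj, hx]; simp)
  have hmem : ∀ u ∈ t, u + v ∈ W := fun u hu => by
    obtain ⟨y, hy, rfl⟩ := Finset.mem_image.1 (htU hu)
    simpa using hy
  have hcard : t.card ≤ 3 := by
    by_contra hc
    obtain ⟨f, hf, u, hu, hfu⟩ := Module.exists_nontrivial_relation_of_finrank_lt_card (R := ℝ)
      (t := t) (by simpa using hc)
    exact hfu (hind f hf u hu)
  have hspan : ∀ a b : E3, a ∈ t → b ∈ t → t ⊆ {a, b} → False := by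
    intro a b ha hb h
    have := hgen (a + v) (hmem a ha) (b + v) (hmem b hb)
    apply this
    rw [← hgx]
    refine Submodule.sum_mem _ fun u hu => Submodule.smul_mem _ _ (Submodule.subset_span ?_)
    have := h hu
    simpa using this
  interval_cases hc : t.card
  · rw [Finset.card_eq_zero] at hc
    subst hc
    exact absurd (sub_eq_zero.1 (by simpa using hgx.symm)) hxv
  · obtain ⟨a, rfl⟩ := Finset.card_eq_one.1 hc
    exact (hspan a a (by simp) (by simp) (by simp)).elim
  · obtain ⟨a, b, -, rfl⟩ := Finset.card_eq_two.1 hc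
    exact (hspan a b (by simp) (by simp) (by simp)).elim
  · obtain ⟨a, b, c, hab, hac, hbc, rfl⟩ := Finset.card_eq_three.1 hc
    have hdet : det3 a b c ≠ 0 := by
      intro h
      obtain ⟨α, β, γ, hne, hrel⟩ := exists_relation_of_det3_eq_zero h
      have := hind (fun u => if u = a then α else if u = b then β else γ) (by
        rw [Finset.sum_insert (by simp [hab, hac]), Finset.sum_insert (by simp [hbc]),
          Finset.sum_singleton]
        simp [hab.symm, hac.symm, hbc.symm, ← hrel, add_assoc])
      have h1 := this a (by simp)
      have h2 := this b (by simp)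
      have h3 := this c (by simp)
      simp [hab.symm, hac.symm, hbc.symm] at h1 h2 h3
      tauto
    rw [Finset.sum_insert (by simp [hab, hac]), Finset.sum_insert (by simp [hbc]),
          Finset.sum_singleton] at hgx
    have ha := hg a (by simp)
    have hb := hg b (by simp)
    have hc' := hg c (by simp)
    have ma := hmem a (by simp)
    have mb := hmem b (by simp)
    have mc := hmem c (by simp)
    have v0 : vol e v (a + v) (b + v) (c + v) = e * det3 a b c := by simp [vol]
    have v1 : vol e v x (b + v) (c + v) = g a * (e * det3 a b c) := by
      simp only [vol, ← hgx, add_sub_cancel_right]; simp [det3]; ring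
    have v2 : vol e v (a + v) x (c + v) = g b * (e * det3 a b c) := by
      simp only [vol, ← hgx, add_sub_cancel_right]; simp [det3]; ring
    have v3 : vol e v (a + v) (b + v) x = g c * (e * det3 a b c) := by
      simp only [vol, ← hgx, add_sub_cancel_right]; simp [det3]; ring
    rcases lt_or_gt_of_ne (mul_ne_zero he hdet) with h | h
    · refine ⟨b + v, mb, a + v, ma, c + v, mc, ?_⟩
      have s1 : vol e v x (a + v) (c + v) = -vol e v (a + v) x (c + v) := vol_swap₂₃ _ _ _ _ _
      have s2 : vol e v (b + v) x (c + v) = -vol e v x (b + v) (c + v) := vol_swap₂₃ _ _ _ _ _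
      rw [vol_swap₂₃, s1, s2, vol_swap₂₃ e v (a + v) (b + v) x, v0, v1, v2, v3]
      have := mul_neg_of_pos_of_neg ha h
      have := mul_neg_of_pos_of_neg hb h
      have := mul_neg_of_pos_of_neg hc' h
      refine ⟨?_, ?_, ?_, ?_⟩ <;> linarith
    · refine ⟨a + v, ma, b + v, mb, c + v, mc, ?_⟩
      rw [v0, v1, v2, v3]
      exact ⟨h, mul_pos ha h, mul_pos hb h, mul_pos hc' h⟩

/-- The height of `w` above the plane that lifts the triangle `(a, b, c)` to the heights `h`,
as seen from `v`. -/
noncomputable def lift (e : ℝ) (v : E3) (h : E3 → ℝ) (a b c w : E3) : ℝ :=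
  h w * vol e v a b c - (h a * vol e v w b c + h b * vol e v a w c + h c * vol e v a b w)

theorem lift_rotate (e : ℝ) (v : E3) (h : E3 → ℝ) (a b c w : E3) :
    lift e v h b c a w = lift e v h a b c w := by
  simp only [lift, vol, det3, PiLp.sub_apply]; ring

/-- The triangles spanned by `W` whose cone with apex `v` contains `x` in its interior. -/
noncomputable def trianglesAround (e : ℝ) (v x : E3) (W : Finset E3) : Finset (E3 × E3 × E3) :=
  (W ×ˢ W ×ˢ W).filter fun T => 0 < vol e v T.1 T.2.1 T.2.2 ∧ 0 < vol e v x T.2.1 T.2.2 ∧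
    0 < vol e v T.1 x T.2.2 ∧ 0 < vol e v T.1 T.2.1 x

theorem mem_trianglesAround {e : ℝ} {v x : E3} {W : Finset E3} {a b c : E3} :
    (a, b, c) ∈ trianglesAround e v x W ↔ (a ∈ W ∧ b ∈ W ∧ c ∈ W) ∧ 0 < vol e v a b c ∧
      0 < vol e v x b c ∧ 0 < vol e v a x c ∧ 0 < vol e v a b x := by
  simp [trianglesAround]

theorem mem_trianglesAround_rotate {e : ℝ} {v x : E3} {W : Finset E3} {a b c : E3}
    (h : (a, b, c) ∈ trianglesAround e v x W) : (b, c, a) ∈ trianglesAround e v x W := by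
  rw [mem_trianglesAround] at h ⊢
  refine ⟨⟨h.1.2.1, h.1.2.2, h.1.1⟩, ?_, ?_, ?_, ?_⟩
  · rw [vol_rotate_last]; exact h.2.1
  · rw [vol_rotate_last]; exact h.2.2.2.1
  · rw [vol_rotate_last]; exact h.2.2.2.2
  · rw [vol_rotate_last]; exact h.2.2.1

/-- The height at which the ray from `v` to `x` meets the lifted triangle. -/
noncomputable def triangleCost (e : ℝ) (v x : E3) (h : E3 → ℝ) (T : E3 × E3 × E3) : ℝ :=
  (h T.1 * vol e v x T.2.1 T.2.2 + h T.2.1 * vol e v T.1 x T.2.2 + h T.2.2 * vol e v T.1 T.2.1 x)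
    / vol e v T.1 T.2.1 T.2.2

theorem triangleCost_rotate {e : ℝ} {v x : E3} {h : E3 → ℝ} {a b c : E3} :
    triangleCost e v x h (b, c, a) = triangleCost e v x h (a, b, c) := by
  simp only [triangleCost]
  rw [vol_rotate_last e v a b c, vol_rotate_last e v a x c, vol_rotate_last e v a b x,
    vol_rotate_last e v x b c]
  ring

/-- One simplex pivot: `w` enters the basis and `a` leaves. The negative reduced cost `lift` makes
the cost drop, the ratio conditions keep the new coordinates of `x` nonnegative, and genericity
makes them positive, so the pivot is never degenerate. -/
theorem exists_cheaper_of_ratio {e : ℝ} {v x : E3} {W : Finset E3} {h : E3 → ℝ}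
    (hgen : ∀ a ∈ W, ∀ b ∈ W, x - v ∉ Submodule.span ℝ {a - v, b - v}) {a b c w : E3}
    (hT : (a, b, c) ∈ trianglesAround e v x W) (hw : w ∈ W) (hlift : lift e v h a b c w < 0)
    (ha : 0 < vol e v w b c)
    (hb : vol e v x b c * vol e v a w c ≤ vol e v a x c * vol e v w b c)
    (hc : vol e v x b c * vol e v a b w ≤ vol e v a b x * vol e v w b c) :
    ∃ T ∈ trianglesAround e v x W, triangleCost e v x h T < triangleCost e v x h (a, b, c) := by
  rw [mem_trianglesAround] at hT
  obtain ⟨⟨haW, hbW, hcW⟩, hD, hxa, hxb, hxc⟩ := hT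
  have i1 : vol e v a b c * vol e v w x c
      = vol e v a x c * vol e v w b c - vol e v x b c * vol e v a w c := by
    simp only [vol, det3, PiLp.sub_apply]; ring
  have i2 : vol e v a b c * vol e v w b x
      = vol e v a b x * vol e v w b c - vol e v x b c * vol e v a b w := by
    simp only [vol, det3, PiLp.sub_apply]; ring
  have n1 : 0 ≤ vol e v w x c := by
    by_contra hn
    have := mul_neg_of_pos_of_neg hD (not_le.1 hn)
    linarith
  have n2 : 0 ≤ vol e v w b x := by
    by_contra hn
    have := mul_neg_of_pos_of_neg hD (not_le.1 hn)
    linarith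
  have key := congrArg (fun y => (vol e v w b c)⁻¹ • y) (vol_smul_sub_eq e v w b c x)
  simp only [smul_smul, smul_add, inv_mul_cancel₀ ha.ne', one_smul] at key
  have p1 : 0 < vol e v w x c := by
    refine lt_of_le_of_ne n1 fun h0 => hgen w hw c hcW ?_
    rw [key, ← h0, Submodule.mem_span_pair, mul_zero, zero_smul, add_zero]
    exact ⟨_, _, rfl⟩
  have p2 : 0 < vol e v w b x := by
    refine lt_of_le_of_ne n2 fun h0 => hgen w hw b hbW ?_
    rw [key, ← h0, Submodule.mem_span_pair, mul_zero, zero_smul, add_zero]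
    exact ⟨_, _, rfl⟩
  refine ⟨(w, b, c), mem_trianglesAround.2 ⟨⟨hw, hbW, hcW⟩, ha, hxa, p1, p2⟩, ?_⟩
  simp only [triangleCost]
  rw [div_lt_div_iff₀ ha hD]
  have := mul_neg_of_pos_of_neg hxa hlift
  unfold lift at this
  have e1 : (h w * vol e v x b c + h b * vol e v w x c + h c * vol e v w b x) * vol e v a b c
      = h w * vol e v x b c * vol e v a b c
        + h b * (vol e v a x c * vol e v w b c - vol e v x b c * vol e v a w c)
        + h c * (vol e v a b x * vol e v w b c - vol e v x b c * vol e v a b w) := by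
    rw [← i1, ← i2]; ring
  rw [e1]
  linarith

/-- A vertex violating dual feasibility can always enter the basis. Positivity of the heights rules
out an unbounded direction, and the largest ratio of coordinates decides which vertex leaves; the
rotations reduce all choices to the first vertex. -/
theorem exists_cheaper {e : ℝ} {v x : E3} {W : Finset E3} {h : E3 → ℝ} (hpos : ∀ w ∈ W, 0 < h w)
    (hgen : ∀ a ∈ W, ∀ b ∈ W, x - v ∉ Submodule.span ℝ {a - v, b - v}) {a b c w : E3}
    (hT : (a, b, c) ∈ trianglesAround e v x W) (hw : w ∈ W) (hlift : lift e v h a b c w < 0) :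
    ∃ T ∈ trianglesAround e v x W, triangleCost e v x h T < triangleCost e v x h (a, b, c) := by
  have hT' := mem_trianglesAround.1 hT
  obtain ⟨⟨haW, hbW, hcW⟩, hD, hxa, hxb, hxc⟩ := hT'
  -- If all coordinates of `w` were nonpositive, the lifted plane would have nonpositive height at
  -- `w`, below the positive height of `w`.
  have hex : 0 < vol e v w b c ∨ 0 < vol e v a w c ∨ 0 < vol e v a b w := by
    by_contra! hn
    have q1 := mul_nonpos_of_nonneg_of_nonpos (hpos a haW).le hn.1
    have q2 := mul_nonpos_of_nonneg_of_nonpos (hpos b hbW).le hn.2.1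
    have q3 := mul_nonpos_of_nonneg_of_nonpos (hpos c hcW).le hn.2.2
    have q4 := mul_pos (hpos w hw) hD
    unfold lift at hlift
    linarith
  have hmax : ∀ Xa Xb Xc Ma Mb Mc : ℝ, 0 < Xa → 0 < Xb → 0 < Xc → (0 < Ma ∨ 0 < Mb ∨ 0 < Mc) →
      (0 < Ma ∧ Xa * Mb ≤ Xb * Ma ∧ Xa * Mc ≤ Xc * Ma) ∨
      (0 < Mb ∧ Xb * Mc ≤ Xc * Mb ∧ Xb * Ma ≤ Xa * Mb) ∨
      (0 < Mc ∧ Xc * Ma ≤ Xa * Mc ∧ Xc * Mb ≤ Xb * Mc) := by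
    intro Xa Xb Xc Ma Mb Mc ha hb hc hM
    have hM' : 0 < Ma / Xa ∨ 0 < Mb / Xb ∨ 0 < Mc / Xc := by
      rcases hM with h | h | h
      exacts [Or.inl (by positivity), Or.inr (Or.inl (by positivity)),
        Or.inr (Or.inr (by positivity))]
    have aux : ∀ {X M Y N : ℝ}, 0 < X → 0 < Y → M / X ≤ N / Y → Y * M ≤ X * N := by
      intro X M Y N hX hY h
      rw [div_le_div_iff₀ hX hY] at h
      linarith
    have pos : ∀ {X M : ℝ}, 0 < X → 0 < M / X → 0 < M := fun hX h =>
      (div_pos_iff_of_pos_right hX).1 h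
    rcases le_total (Ma / Xa) (Mb / Xb) with h1 | h1
    · rcases le_total (Mb / Xb) (Mc / Xc) with h2 | h2
      · refine Or.inr (Or.inr ⟨pos hc ?_, aux ha hc (h1.trans h2), aux hb hc h2⟩)
        rcases hM' with h | h | h <;> linarith
      · refine Or.inr (Or.inl ⟨pos hb ?_, aux hc hb h2, aux ha hb h1⟩)
        rcases hM' with h | h | h <;> linarith
    · rcases le_total (Ma / Xa) (Mc / Xc) with h2 | h2
      · refine Or.inr (Or.inr ⟨pos hc ?_, aux ha hc h2, aux hb hc (h1.trans h2)⟩)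
        rcases hM' with h | h | h <;> linarith
      · refine Or.inl ⟨pos ha ?_, aux hb ha h1, aux hc ha h2⟩
        rcases hM' with h | h | h <;> linarith
  rcases hmax _ _ _ _ _ _ hxa hxb hxc hex with ⟨g1, g2, g3⟩ | ⟨g1, g2, g3⟩ | ⟨g1, g2, g3⟩
  · exact exists_cheaper_of_ratio hgen hT hw hlift g1 g2 g3
  · rw [← triangleCost_rotate]
    refine exists_cheaper_of_ratio hgen (mem_trianglesAround_rotate hT) hw
      (by rwa [lift_rotate]) ?_ ?_ ?_ <;>
    rw [vol_rotate_last e v a w c]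
    · exact g1
    · rw [vol_rotate_last e v a x c, vol_rotate_last e v a b w, vol_rotate_last e v a b x]
      exact g2
    · rw [vol_rotate_last e v a x c, vol_rotate_last e v w b c, vol_rotate_last e v x b c]
      exact g3
  · rw [← triangleCost_rotate, ← triangleCost_rotate]
    refine exists_cheaper_of_ratio hgen (mem_trianglesAround_rotate (mem_trianglesAround_rotate hT))
      hw (by rwa [lift_rotate, lift_rotate]) ?_ ?_ ?_ <;>
    rw [← vol_rotate_last e v w a b]
    · exact g1
    · rw [← vol_rotate_last e v x a b, ← vol_rotate_last e v c w b, ← vol_rotate_last e v c x b]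
      exact g2
    · rw [← vol_rotate_last e v x a b, ← vol_rotate_last e v c a w, ← vol_rotate_last e v c a x]
      exact g3

/-- A generic point of the cone with apex `v` spanned by `W` is in the cone over a triangle that is
optimal for the heights `h`. -/
theorem exists_optimal_triangle {e : ℝ} (he : e ≠ 0) {v x : E3} {W : Finset E3} {h w : E3 → ℝ}
    (hpos : ∀ w ∈ W, 0 < h w) (hw : ∀ y ∈ W, 0 ≤ w y)
    (hx : x - v = ∑ y ∈ W, w y • (y - v)) (hxv : x ≠ v)
    (hgen : ∀ a ∈ W, ∀ b ∈ W, x - v ∉ Submodule.span ℝ {a - v, b - v}) :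
    ∃ a b c, (a, b, c) ∈ trianglesAround e v x W ∧ ∀ y ∈ W, 0 ≤ lift e v h a b c y := by
  obtain ⟨a, ha, b, hb, c, hc, hT⟩ := exists_triangle_of_conic he hw hx hxv hgen
  obtain ⟨⟨a, b, c⟩, hT, hmin⟩ := (trianglesAround e v x W).exists_min_image
    (triangleCost e v x h) ⟨(a, b, c), mem_trianglesAround.2 ⟨⟨ha, hb, hc⟩, hT⟩⟩
  refine ⟨a, b, c, hT, fun y hy => ?_⟩
  by_contra hn
  obtain ⟨T, hT', hlt⟩ := exists_cheaper hpos hgen hT hy (not_le.1 hn)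
  exact absurd (hmin T hT') (not_le.2 hlt)

/-! ### Facets of polytopes -/

/-- Proper affine subspaces are null sets, and a nonempty open set has positive measure. -/
theorem exists_mem_open_forall_notMem {ι : Type*} (I : Finset ι) (s : ι → AffineSubspace ℝ E3)
    (hs : ∀ i ∈ I, s i ≠ ⊤) {U : Set E3} (hU : IsOpen U) (hne : U.Nonempty) :
    ∃ x ∈ U, ∀ i ∈ I, x ∉ s i := by
  by_contra! hc
  have h1 : U ⊆ ⋃ i ∈ I, (s i : Set E3) := fun x hx => by
    obtain ⟨i, hi, h⟩ := hc x hx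
    exact mem_biUnion (x := i) hi h
  have h2 : MeasureTheory.volume (⋃ i ∈ I, (s i : Set E3)) = 0 := by
    refine (MeasureTheory.measure_biUnion_null_iff I.countable_toSet).2 ?_
    exact fun i hi => MeasureTheory.Measure.addHaar_affineSubspace _ _ (hs i hi)
  exact (hU.measure_pos MeasureTheory.volume hne).ne' (MeasureTheory.measure_mono_null h1 h2)

theorem exists_generic (v : E3) (W : Finset E3) {U : Set E3} (hU : IsOpen U) (hne : U.Nonempty) :
    ∃ x ∈ U, x ≠ v ∧ ∀ a ∈ W, ∀ b ∈ W, x - v ∉ Submodule.span ℝ {a - v, b - v} := by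
  obtain ⟨x, hx, h⟩ := exists_mem_open_forall_notMem ((insert v W) ×ˢ (insert v W))
    (fun ab => AffineSubspace.mk' v (Submodule.span ℝ {ab.1 - v, ab.2 - v})) (by
      intro ab _ htop
      have h1 : Submodule.span ℝ {ab.1 - v, ab.2 - v} = ⊤ := by
        rw [← AffineSubspace.direction_mk' v (Submodule.span ℝ {ab.1 - v, ab.2 - v}), htop,
          AffineSubspace.direction_top]
      have h2 := finrank_span_finset_le_card (R := ℝ) ({ab.1 - v, ab.2 - v} : Finset E3)
      have h3 : ({ab.1 - v, ab.2 - v} : Finset E3).card ≤ 2 := Finset.card_le_two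
      rw [Set.finrank, Finset.coe_pair, h1, finrank_top] at h2
      simp at h2
      omega) hU hne
  refine ⟨x, hx, ?_, fun a ha b hb hab => h (a, b) (by simp [ha, hb]) ?_⟩
  · rintro rfl
    exact h (x, x) (by simp) (AffineSubspace.self_mem_mk' _ _)
  · simpa [AffineSubspace.mem_mk'] using hab

/-- An affine function that vanishes at three points is proportional to the oriented volume over
them. This identifies an abstract facet functional with a determinant, up to sign. -/
theorem vol_mul_affine_eq {f : E3 →ᵃ[ℝ] ℝ} {e : ℝ} {a b c : E3} (ha : f a = 0) (hb : f b = 0)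
    (hc : f c = 0) (o x : E3) : vol e a b c o * f x = vol e a b c x * f o := by
  have key := congrArg f.linear (vol_smul_sub_eq e a b c o x)
  have hlin : ∀ y, f.linear (y - a) = f y := fun y => by
    rw [← vsub_eq_sub, f.linearMap_vsub, ha, vsub_eq_sub, sub_zero]
  simp only [map_add, map_smul, hlin, hb, hc, smul_eq_mul] at key
  linarith

theorem finrank_vectorSpan_zeros {P : Set E3} {f : E3 →ᵃ[ℝ] ℝ} {a b c o : E3}
    (ha : a ∈ P ∧ f a = 0) (hb : b ∈ P ∧ f b = 0) (hc : c ∈ P ∧ f c = 0) {e : ℝ}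
    (hvol : vol e o a b c ≠ 0) (hfo : f o ≠ 0) :
    Module.finrank ℝ (vectorSpan ℝ {x | x ∈ P ∧ f x = 0}) = 2 := by
  apply le_antisymm
  · have hle : vectorSpan ℝ {x | x ∈ P ∧ f x = 0} ≤ LinearMap.ker f.linear := by
      rw [vectorSpan_def, Submodule.span_le]
      rintro _ ⟨x, hx, y, hy, rfl⟩
      rw [SetLike.mem_coe, LinearMap.mem_ker, f.linearMap_vsub, hx.2, hy.2, vsub_self]
    refine (Submodule.finrank_mono hle).trans ?_
    have h1 := LinearMap.finrank_range_add_finrank_ker f.linear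
    have h2 : Module.finrank ℝ (LinearMap.range f.linear) = 1 := by
      have : f.linear ≠ 0 := by
        intro h
        have : f.linear (o -ᵥ a) = 0 := by rw [h]; rfl
        rw [f.linearMap_vsub, ha.2] at this
        simp at this
        exact hfo this
      have := LinearMap.range_eq_top.2 (LinearMap.surjective this)
      rw [this]; simp
    simp at h1
    omega
  · have hI : AffineIndependent ℝ ![a, b, c] := by
      have := affineIndependent_of_vol_ne_zero hvol
      exact this.comp_embedding (Fin.succEmb 3)
    have := hI.finrank_vectorSpan (n := 2) (by simp)
    rw [← this]
    refine Submodule.finrank_mono (vectorSpan_mono ℝ ?_)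
    rintro x ⟨i, rfl⟩
    fin_cases i <;> assumption

theorem isFacet_zeros {P : Set E3} {f : E3 →ᵃ[ℝ] ℝ} (hf : ∀ x ∈ P, 0 ≤ f x) {a b c o : E3}
    (ha : a ∈ P ∧ f a = 0) (hb : b ∈ P ∧ f b = 0) (hc : c ∈ P ∧ f c = 0) {e : ℝ}
    (hvol : vol e o a b c ≠ 0) (hfo : f o ≠ 0) : IsFacet P {x | x ∈ P ∧ f x = 0} := by
  refine ⟨fun _ => ⟨-(LinearMap.toContinuousLinearMap f.linear), ?_⟩,
    finrank_vectorSpan_zeros ha hb hc hvol hfo⟩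
  have hlin : ∀ y, f.linear y = f y - f 0 := fun y => by
    have := f.linearMap_vsub y 0
    simpa using this
  ext x
  simp only [mem_ofPred_eq, neg_apply, LinearMap.coe_toContinuousLinearMap',
    hlin]
  constructor
  · rintro ⟨hx, h0⟩
    exact ⟨hx, fun y hy => by linarith [hf y hy]⟩
  · rintro ⟨hx, h⟩
    exact ⟨hx, le_antisymm (by linarith [h a ha.1, ha.2]) (hf x hx)⟩

theorem isCompact_convexHull_finset (S : Finset E3) : IsCompact (convexHull ℝ (S : Set E3)) :=
  S.finite_toSet.isCompact_convexHull ℝ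

/-- A point outside a polytope violates the inequality of some facet. -/
theorem exists_isFacet_lt {S : Finset E3} (hint : (interior (convexHull ℝ (S : Set E3))).Nonempty)
    {y : E3} (hy : y ∉ convexHull ℝ (S : Set E3)) :
    ∃ f : E3 →ᵃ[ℝ] ℝ, (∀ x ∈ convexHull ℝ (S : Set E3), 0 ≤ f x) ∧ f y < 0 ∧
      IsFacet (convexHull ℝ (S : Set E3)) {x | x ∈ convexHull ℝ (S : Set E3) ∧ f x = 0} := by
  set P := convexHull ℝ (S : Set E3) with hP
  obtain ⟨o, ho⟩ := hint
  have hclosed : IsClosed P := (isCompact_convexHull_finset S).isClosed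
  -- The point is pushed slightly towards `o` to leave room for a generic replacement `z` outside
  -- `P`. The homothety with centre `y` and factor `t⁻¹` sends `z` into the interior, so that a
  -- facet functional negative at `z` is also negative at `y`.
  obtain ⟨t, ht0, ht1, ht⟩ : ∃ t : ℝ, 0 < t ∧ t < 1 ∧ y + t • (o - y) ∈ Pᶜ := by
    have hcont : Continuous fun t : ℝ => y + t • (o - y) := by fun_prop
    have hopen : IsOpen ((fun t : ℝ => y + t • (o - y)) ⁻¹' Pᶜ) := hclosed.isOpen_compl.preimage hcont
    have h0 : (0 : ℝ) ∈ (fun t : ℝ => y + t • (o - y)) ⁻¹' Pᶜ := by simpa using hy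
    obtain ⟨ε, hε, hball⟩ := Metric.isOpen_iff.1 hopen 0 h0
    refine ⟨min (ε / 2) (1 / 2), by positivity, ?_, hball ?_⟩
    · exact (min_le_right _ _).trans_lt (by norm_num)
    · rw [Metric.mem_ball, dist_zero_right, Real.norm_eq_abs, abs_of_pos (by positivity)]
      exact (min_le_left _ _).trans_lt (by linarith)
  obtain ⟨z, ⟨hzP, hz⟩, hzo, hgen⟩ := exists_generic o S
    (U := Pᶜ ∩ (fun z => y + t⁻¹ • (z - y)) ⁻¹' interior P)
    (hclosed.isOpen_compl.inter (isOpen_interior.preimage (by fun_prop)))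
    ⟨y + t • (o - y), ht, by simpa [smul_smul, inv_mul_cancel₀ ht0.ne'] using ho⟩
  obtain ⟨ε, hε, hεP⟩ : ∃ ε : ℝ, 0 < ε ∧ o + ε • (z - o) ∈ P := by
    have hcont : Continuous fun t : ℝ => o + t • (z - o) := by fun_prop
    have hopen := isOpen_interior (s := P) |>.preimage hcont
    have h0 : (0 : ℝ) ∈ (fun t : ℝ => o + t • (z - o)) ⁻¹' interior P := by simpa using ho
    obtain ⟨ε, hε, hball⟩ := Metric.isOpen_iff.1 hopen 0 h0
    refine ⟨ε / 2, by positivity, interior_subset (hball ?_)⟩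
    rw [Metric.mem_ball, dist_zero_right, Real.norm_eq_abs, abs_of_pos (by positivity)]
    linarith
  obtain ⟨w, hw0, hw1, hwz⟩ := Finset.mem_convexHull'.1 hεP
  -- With constant heights, optimality says that all of `P` is on the side of `o` of the plane
  -- through the triangle. The facet sought is the one crossed by the ray from `o` through `z`.
  obtain ⟨a, b, c, hT, hopt⟩ := exists_optimal_triangle (e := 1) one_ne_zero (v := o) (x := z)
    (W := S) (h := fun _ => 1) (w := fun s => ε⁻¹ * w s) (fun _ _ => one_pos)
    (fun s hs => mul_nonneg (inv_nonneg.2 hε.le) (hw0 s hs)) (by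
      have : ∑ s ∈ S, (ε⁻¹ * w s) • (s - o) = ε⁻¹ • (∑ s ∈ S, w s • s - (∑ s ∈ S, w s) • o) := by
        simp only [mul_smul, ← Finset.smul_sum, smul_sub, Finset.sum_sub_distrib, Finset.sum_smul]
      rw [this, hwz, hw1, one_smul, add_sub_cancel_left, smul_smul, inv_mul_cancel₀ hε.ne',
        one_smul]) hzo hgen
  rw [mem_trianglesAround] at hT
  obtain ⟨⟨haS, hbS, hcS⟩, hD, h1, h2, h3⟩ := hT
  have hvolf : ∀ x, volMap (-1) a b c x = vol 1 x a b c := fun x => by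
    simp only [volMap_apply, vol, det3, PiLp.sub_apply]; ring
  have hfP : ∀ x ∈ P, 0 ≤ volMap (-1) a b c x := fun x hx =>
    nonneg_of_mem_convexHull (fun s hs => by
      rw [hvolf]
      have := hopt s hs
      unfold lift at this
      have := vol_sum 1 o a b c s
      linarith) hx
  have hsub := subset_convexHull ℝ (S : Set E3)
  have hoP := interior_subset ho
  have hfz : volMap (-1) a b c z < 0 := by
    by_contra hn
    rw [hvolf] at hn
    refine hzP (convexHull_min ?_ (convex_convexHull ℝ _)
      (mem_convexHull_four hD (not_lt.1 hn) h1.le h2.le h3.le))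
    intro x hx
    simp only [mem_insert_iff, mem_singleton_iff] at hx
    rcases hx with rfl | rfl | rfl | rfl
    exacts [hoP, hsub haS, hsub hbS, hsub hcS]
  refine ⟨volMap (-1) a b c, hfP, ?_, isFacet_zeros hfP (a := a) (b := b) (c := c) (o := o) (e := 1)
    ⟨hsub haS, by simp [vol_self₁₄]⟩ ⟨hsub hbS, by simp [vol_self₂₄]⟩
    ⟨hsub hcS, by simp [vol_self₃₄]⟩ hD.ne' (by rw [hvolf]; exact hD.ne')⟩
  have hz' := hfP _ (interior_subset hz)
  have : z = AffineMap.lineMap y (y + t⁻¹ • (z - y)) t := by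
    simp [AffineMap.lineMap_apply, smul_smul, mul_inv_cancel₀ ht0.ne']
  rw [this, AffineMap.apply_lineMap, AffineMap.lineMap_apply_ring'] at hfz
  by_contra hn
  push Not at hn
  nlinarith

theorem exists_affine_of_isExposed {P G : Set E3} (h : IsExposed ℝ P G) (hne : G.Nonempty) :
    ∃ f : E3 →ᵃ[ℝ] ℝ, (∀ x ∈ P, 0 ≤ f x) ∧ G = {x | x ∈ P ∧ f x = 0} := by
  obtain ⟨l, hl⟩ := h hne
  obtain ⟨x₀, hx₀⟩ := hne
  rw [hl] at hx₀
  refine ⟨AffineMap.const ℝ E3 (l x₀) - (l : E3 →ₗ[ℝ] ℝ).toAffineMap, fun x hx => ?_, ?_⟩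
  · simpa using hx₀.2 x hx
  · rw [hl]
    ext x
    simp only [mem_ofPred_eq, AffineMap.coe_sub, AffineMap.coe_const, Pi.sub_apply,
      Function.const_apply, LinearMap.coe_toAffineMap, ContinuousLinearMap.coe_coe]
    constructor
    · rintro ⟨hx, h⟩
      exact ⟨hx, by linarith [h x₀ hx₀.1, hx₀.2 x hx]⟩
    · rintro ⟨hx, h⟩
      exact ⟨hx, fun y hy => by linarith [hx₀.2 y hy]⟩

/-- Prolong the segment from `y` to `x` slightly beyond `x`, staying in `P`: a nonpositive value at
`x` would become negative there. -/
theorem pos_of_mem_interior {P : Set E3} {f : E3 →ᵃ[ℝ] ℝ} (hf : ∀ x ∈ P, 0 ≤ f x) {y : E3}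
    (hy : 0 < f y) {x : E3} (hx : x ∈ interior P) : 0 < f x := by
  have hcont : Continuous fun t : ℝ => x + t • (x - y) := by fun_prop
  have hopen := isOpen_interior (s := P) |>.preimage hcont
  have h0 : (0 : ℝ) ∈ (fun t : ℝ => x + t • (x - y)) ⁻¹' interior P := by simpa using hx
  obtain ⟨ε, hε, hball⟩ := Metric.isOpen_iff.1 hopen 0 h0
  have hmem : x + (ε / 2) • (x - y) ∈ P := by
    refine interior_subset (hball ?_)
    rw [Metric.mem_ball, dist_zero_right, Real.norm_eq_abs, abs_of_pos (by positivity)]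
    linarith
  have h1 := hf _ hmem
  have h2 : f (x + (ε / 2) • (x - y)) = f x + ε / 2 * (f x - f y) := by
    rw [add_comm, ← vadd_eq_add, f.map_vadd, map_smul, ← vsub_eq_sub x y, f.linearMap_vsub]
    simp; ring
  rw [h2] at h1
  by_contra hn
  push Not at hn
  have : ε / 2 * (f x - f y) < 0 := mul_neg_of_pos_of_neg (by positivity) (by linarith)
  linarith

theorem mul_nonneg_of_wSameSide {s : Set E3} {f : E3 →ᵃ[ℝ] ℝ} (hf : ∀ x ∈ s, f x = 0) {x y : E3}
    (h : (affineSpan ℝ s).WSameSide x y) : 0 ≤ f x * f y := by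
  have hf' : ∀ x ∈ affineSpan ℝ s, f x = 0 := by
    intro x hx
    have : affineSpan ℝ s ≤ (AffineSubspace.mk' (0 : ℝ) ⊥).comap f :=
      affineSpan_le.2 fun x hx => by simp [AffineSubspace.mem_mk', hf x hx]
    simpa [AffineSubspace.mem_mk'] using this hx
  obtain ⟨p, hp, q, hq, hpq⟩ := h
  have := hpq.map f.linear
  rw [f.linearMap_vsub, f.linearMap_vsub, hf' p hp, hf' q hq] at this
  simp only [vsub_eq_sub, sub_zero] at this
  rcases this with h | h | ⟨r, s, hr, hs, h⟩
  · simp [h]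
  · simp [h]
  · simp only [smul_eq_mul] at h
    by_contra hn
    push Not at hn
    have h1 : r * f x * (r * f x) = r * s * (f x * f y) := by rw [h]; nth_rewrite 1 [← h]; ring
    have h2 := mul_neg_of_pos_of_neg (mul_pos hr hs) hn
    nlinarith [mul_self_nonneg (r * f x)]

theorem mul_nonpos_of_wOppSide {s : Set E3} {f : E3 →ᵃ[ℝ] ℝ} (hf : ∀ x ∈ s, f x = 0) {x y : E3}
    (h : (affineSpan ℝ s).WOppSide x y) : f x * f y ≤ 0 := by
  have hf' : ∀ x ∈ affineSpan ℝ s, f x = 0 := by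
    intro x hx
    have : affineSpan ℝ s ≤ (AffineSubspace.mk' (0 : ℝ) ⊥).comap f :=
      affineSpan_le.2 fun x hx => by simp [AffineSubspace.mem_mk', hf x hx]
    simpa [AffineSubspace.mem_mk'] using this hx
  obtain ⟨p, hp, q, hq, hpq⟩ := h
  have := hpq.map f.linear
  rw [f.linearMap_vsub, f.linearMap_vsub, hf' p hp, hf' q hq] at this
  simp only [vsub_eq_sub, sub_zero, zero_sub] at this
  rcases this with h | h | ⟨r, s, hr, hs, h⟩
  · simp [h]
  · simp [neg_eq_zero.1 h]
  · simp only [smul_eq_mul] at h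
    by_contra hn
    push Not at hn
    have h1 : r * f x * (r * f x) = -(r * s * (f x * f y)) := by
      nth_rewrite 1 [h]; ring
    have h2 := mul_pos (mul_pos hr hs) hn
    nlinarith [mul_self_nonneg (r * f x)]

theorem affine_cramer (f : E3 →ᵃ[ℝ] ℝ) (e : ℝ) (a b c d x : E3) :
    vol e a b c d * f x = vol e x b c d * f a + vol e a x c d * f b + vol e a b x d * f c
      + vol e a b c x * f d := by
  have key := congrArg f.linear (vol_smul_sub_eq e a b c d x)
  have hlin : ∀ y, f.linear (y - a) = f y - f a := fun y => by
    rw [← vsub_eq_sub, f.linearMap_vsub, vsub_eq_sub]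
  simp only [map_add, map_smul, hlin, smul_eq_mul] at key
  have := vol_sum e a b c d x
  linear_combination key - f a * this

theorem vol_eq_zero_of_mem_convexHull {e : ℝ} {a b c x : E3}
    (hx : x ∈ convexHull ℝ ({a, b, c} : Set E3)) : vol e a b c x = 0 := by
  have hz : ∀ y ∈ ({a, b, c} : Set E3), vol e a b c y = 0 := by
    intro y hy
    simp only [mem_insert_iff, mem_singleton_iff] at hy
    rcases hy with rfl | rfl | rfl
    exacts [vol_self₁₄ _ _ _ _, vol_self₂₄ _ _ _ _, vol_self₃₄ _ _ _ _]
  have h1 := nonneg_of_mem_convexHull (f := volMap e a b c) (fun y hy => (hz y hy).ge) hx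
  have h2 := nonneg_of_mem_convexHull (f := -volMap e a b c)
    (fun y hy => by simp [hz y hy]) hx
  simp at h1 h2
  linarith

theorem cone_nonneg_of_mem_convexHull {e : ℝ} {v a b c x : E3} (h : 0 < vol e v a b c)
    (hx : x ∈ convexHull ℝ ({a, b, c} : Set E3)) : 0 ≤ vol e v a b x := by
  refine nonneg_of_mem_convexHull (f := volMap e v a b) (fun y hy => ?_) hx
  simp only [mem_insert_iff, mem_singleton_iff] at hy
  rcases hy with rfl | rfl | rfl
  · simp [vol_self₂₄]
  · simp [vol_self₃₄]
  · exact h.le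

theorem map_add_smul_sub (f : E3 →ᵃ[ℝ] ℝ) (v c : E3) (t : ℝ) :
    f (v + t • (c - v)) = f v + t * (f c - f v) := by
  rw [add_comm, ← vadd_eq_add, f.map_vadd, map_smul, ← vsub_eq_sub c v, f.linearMap_vsub]
  simp; ring

/-- The points beyond a triangular facet lie in the cone over that facet, seen from any point of
the polytope. -/
theorem cone_of_mem_polytopeBeyond {S : Finset E3} {F : Set E3} {e : ℝ} {f₀ f₁ f₂ v : E3}
    (hint : (interior (convexHull ℝ (S : Set E3))).Nonempty)
    (hF : IsFacet (convexHull ℝ (S : Set E3)) F) (hFf : F = convexHull ℝ {f₀, f₁, f₂})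
    (hv : v ∈ convexHull ℝ (S : Set E3)) (hvol : 0 < vol e v f₀ f₁ f₂) {c : E3}
    (hc : c ∈ polytopeBeyond (convexHull ℝ (S : Set E3)) F) :
    0 ≤ vol e v f₀ f₁ c ∧ 0 ≤ vol e v f₁ f₂ c ∧ 0 ≤ vol e v f₂ f₀ c ∧ 0 ≤ vol e f₀ f₁ f₂ c := by
  set P := convexHull ℝ (S : Set E3)
  have hne : F.Nonempty := by rw [hFf]; exact (Set.insert_nonempty _ _).convexHull
  obtain ⟨φ, hφ, hφF⟩ := exists_affine_of_isExposed hF.1 hne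
  have hf : ∀ y ∈ F, φ y = 0 := fun y hy => by rw [hφF] at hy; exact hy.2
  have m0 : f₀ ∈ F := by rw [hFf]; exact subset_convexHull _ _ (by simp)
  have m1 : f₁ ∈ F := by rw [hFf]; exact subset_convexHull _ _ (by simp)
  have m2 : f₂ ∈ F := by rw [hFf]; exact subset_convexHull _ _ (by simp)
  have hvol' : vol e f₀ f₁ f₂ v = -vol e v f₀ f₁ f₂ := by
    simp only [vol, det3, PiLp.sub_apply]; ring
  have hφv : 0 < φ v := by
    refine lt_of_le_of_ne (hφ v hv) fun h => ?_
    have : v ∈ F := by rw [hφF]; exact ⟨hv, h.symm⟩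
    rw [hFf] at this
    have := vol_eq_zero_of_mem_convexHull (e := e) this
    linarith
  have hφvol := vol_mul_affine_eq (e := e) (hf _ m0) (hf _ m1) (hf _ m2) v
  have hclosed : IsClosed {c | 0 ≤ vol e v f₀ f₁ c ∧ 0 ≤ vol e v f₁ f₂ c ∧ 0 ≤ vol e v f₂ f₀ c ∧
      0 ≤ vol e f₀ f₁ f₂ c} := by
    have hcl : ∀ a b c, IsClosed {x | 0 ≤ vol e a b c x} := fun a b c =>
      isClosed_Ici.preimage (volMap e a b c).continuous_of_finiteDimensional
    exact (hcl _ _ _).inter ((hcl _ _ _).inter ((hcl _ _ _).inter (hcl _ _ _)))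
  refine closure_minimal ?_ hclosed hc
  clear hc c
  intro c hc
  obtain ⟨o, ho⟩ := hint
  have hφo : 0 < φ o := pos_of_mem_interior hφ hφv ho
  have hφc : φ c ≤ 0 := by
    have := mul_nonpos_of_wOppSide hf ((hc F hF o ho).1 subset_rfl).wOppSide
    by_contra hn
    have := mul_pos hφo (not_le.1 hn)
    linarith
  -- The parameter at which the segment from `v` to `c` crosses the plane of `F`.
  set t := φ v / (φ v - φ c) with ht
  have ht0 : 0 < t := div_pos hφv (by linarith)
  have ht1 : t ≤ 1 := (div_le_one (by linarith)).2 (by linarith)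
  set y := v + t • (c - v) with hy
  have hline : ∀ f : E3 →ᵃ[ℝ] ℝ, f y = f v + t * (f c - f v) := fun f => map_add_smul_sub f v c t
  have hφy : φ y = 0 := by
    rw [hline, ht]; field_simp [show φ v - φ c ≠ 0 by linarith]; ring
  have hyP : y ∈ P := by
    by_contra hyP
    obtain ⟨g, hg, hgy, hG⟩ := exists_isFacet_lt ⟨o, ho⟩ hyP
    have hgo : 0 < g o := by
      refine pos_of_mem_interior hg (y := v + (-1 : ℝ) • (y - v)) ?_ ho
      rw [map_add_smul_sub]
      linarith [hg v hv]
    have hgc : g c < 0 := by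
      by_contra hn
      rw [hline] at hgy
      have := mul_nonneg ht0.le (not_lt.1 hn)
      nlinarith [hg v hv, mul_nonneg (sub_nonneg.2 ht1) (hg v hv)]
    -- The violated facet must be violated at `c` as well. If it contains `F`, it has the same
    -- plane, on which the crossing point lies; if not, `c` satisfies its inequality.
    by_cases hFG : F ⊆ {x | x ∈ P ∧ g x = 0}
    · have h1 := vol_mul_affine_eq (e := e) (hFG m0).2 (hFG m1).2 (hFG m2).2 v y
      have h2 := hφvol y
      rw [hφy, mul_zero] at h2
      have h3 := (mul_eq_zero.1 h2.symm).resolve_right hφv.ne'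
      rw [h3, zero_mul] at h1
      have := (mul_eq_zero.1 h1).resolve_right hgy.ne
      linarith
    · have := mul_nonneg_of_wSameSide (f := g) (fun x hx => hx.2) ((hc _ hG o ho).2 hFG).wSameSide
      have := mul_neg_of_pos_of_neg hgo hgc
      linarith
  have hyF : y ∈ convexHull ℝ ({f₀, f₁, f₂} : Set E3) := by
    rw [← hFf, hφF]; exact ⟨hyP, hφy⟩
  have hscale : ∀ a b, 0 ≤ vol e v a b y → 0 ≤ vol e v a b c := by
    intro a b h
    have := hline (volMap e v a b)
    simp only [volMap_apply, vol_self₁₄, zero_add, sub_zero] at this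
    rw [this] at h
    exact nonneg_of_mul_nonneg_right h ht0
  refine ⟨hscale _ _ (cone_nonneg_of_mem_convexHull hvol hyF),
    hscale _ _ (cone_nonneg_of_mem_convexHull (c := f₀) (by rwa [vol_rotate_last]) ?_),
    hscale _ _ (cone_nonneg_of_mem_convexHull (c := f₁) (by rwa [← vol_rotate_last]) ?_), ?_⟩
  · convert hyF using 2
    ext x; simp; tauto
  · convert hyF using 2
    ext x; simp; tauto
  · have := hφvol c
    rw [hvol'] at this
    by_contra hn
    have := mul_neg_of_neg_of_pos (not_le.1 hn) hφv
    have := mul_nonneg_of_nonpos_of_nonpos (neg_nonpos.2 hvol.le) hφc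
    linarith

/-- The side conditions given by a triangular facet. -/
theorem facet_vol {C : Set E3} (hint : (interior C).Nonempty) {a b c : E3}
    (hG : IsFacet C (convexHull ℝ {a, b, c})) {e : ℝ} {x₀ : E3} (hx₀ : x₀ ∈ C)
    (h₀ : 0 < vol e a b c x₀) :
    (∀ x ∈ C, 0 ≤ vol e a b c x) ∧
    (∀ x ∈ C.extremePoints ℝ, x ≠ a → x ≠ b → x ≠ c → 0 < vol e a b c x) ∧
    (∀ F' : Set E3, ¬F' ⊆ convexHull ℝ {a, b, c} → ∀ x ∈ polytopeBeyond C F', 0 ≤ vol e a b c x) ∧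
    ∀ x ∈ polytopeBeyond C (convexHull ℝ {a, b, c}), vol e a b c x ≤ 0 := by
  obtain ⟨f, hf, hfG⟩ := exists_affine_of_isExposed hG.1 (Set.insert_nonempty _ _).convexHull
  have hz : ∀ y ∈ convexHull ℝ ({a, b, c} : Set E3), f y = 0 := fun y hy => by
    rw [hfG] at hy; exact hy.2
  have key := vol_mul_affine_eq (e := e) (hz a (subset_convexHull _ _ (by simp)))
    (hz b (subset_convexHull _ _ (by simp))) (hz c (subset_convexHull _ _ (by simp))) x₀
  have hfx₀ : 0 < f x₀ := by
    refine lt_of_le_of_ne (hf x₀ hx₀) fun h => ?_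
    have : x₀ ∈ convexHull ℝ ({a, b, c} : Set E3) := by rw [hfG]; exact ⟨hx₀, h.symm⟩
    exact h₀.ne' (vol_eq_zero_of_mem_convexHull this)
  have hnonneg : ∀ x, 0 ≤ f x → 0 ≤ vol e a b c x := fun x hx => by
    have := key x
    by_contra hn
    have := mul_neg_of_neg_of_pos (not_le.1 hn) hfx₀
    have := mul_nonneg h₀.le hx
    linarith
  have hnonpos : ∀ x, f x ≤ 0 → vol e a b c x ≤ 0 := fun x hx => by
    have := key x
    by_contra hn
    have := mul_pos (not_le.1 hn) hfx₀
    have := mul_nonpos_of_nonneg_of_nonpos h₀.le hx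
    linarith
  have hcl : IsClosed {x | 0 ≤ vol e a b c x} :=
    isClosed_Ici.preimage (volMap e a b c).continuous_of_finiteDimensional
  have hcl' : IsClosed {x | vol e a b c x ≤ 0} :=
    isClosed_Iic.preimage (volMap e a b c).continuous_of_finiteDimensional
  obtain ⟨o, ho⟩ := hint
  have hfo := pos_of_mem_interior hf hfx₀ ho
  refine ⟨fun x hx => hnonneg x (hf x hx), fun x hx ha hb hc => ?_, fun F' hF' => ?_, ?_⟩
  · refine lt_of_le_of_ne (hnonneg x (hf x hx.1)) fun h => ?_
    have h1 := key x
    rw [← h, zero_mul] at h1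
    have h2 := (mul_eq_zero.1 h1).resolve_left h₀.ne'
    have h3 : x ∈ convexHull ℝ ({a, b, c} : Set E3) := by rw [hfG]; exact ⟨hx.1, h2⟩
    have h4 : convexHull ℝ ({a, b, c} : Set E3) ⊆ C := by
      intro y hy; rw [hfG] at hy; exact hy.1
    have h5 := inter_extremePoints_subset_extremePoints_of_subset h4 ⟨h3, hx⟩
    have h6 := extremePoints_convexHull_subset h5
    simp [ha, hb, hc] at h6
  · refine fun x hx => closure_minimal (fun x hx => ?_) hcl hx
    have := mul_nonneg_of_wSameSide hz ((hx _ hG o ho).2 hF').wSameSide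
    exact hnonneg x (nonneg_of_mul_nonneg_right this hfo)
  · refine fun x hx => closure_minimal (fun x hx => ?_) hcl' hx
    have := mul_nonpos_of_wOppSide hz ((hx _ hG o ho).1 subset_rfl).wOppSide
    refine hnonpos x ?_
    by_contra hn
    have := mul_pos hfo (not_le.1 hn)
    linarith

/-- The three planes through the bottom edges cut the bottom plane in the sides of the triangle, so
their inequalities become the signs of the barycentric coordinates. This is how crossing the bottom
plane inside the region means crossing the bottom facet. -/
theorem mem_convexHull_bottom {e : ℝ} {A r : Fin 3 → E3} {o y : E3}
    (hD : 0 < vol e (A 0) (A 1) (A 2) o)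
    (hg : ∀ i, 0 < vol e (A (i + 1)) (A i) (r i) (A (i + 2)))
    (hy : ∀ i, 0 ≤ vol e (A (i + 1)) (A i) (r i) y) (h0 : vol e (A 0) (A 1) (A 2) y = 0) :
    y ∈ convexHull ℝ (range A) := by
  have key := fun i => affine_cramer (volMap e (A (i + 1)) (A i) (r i)) e (A 0) (A 1) (A 2) o y
  have k0 := key 0
  have k1 := key 1
  have k2 := key 2
  have g0 := hg 0
  have g1 := hg 1
  have g2 := hg 2
  simp only [volMap_apply, h0, zero_mul, add_zero, show (0 : Fin 3) + 1 = 1 from rfl,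
    show (1 : Fin 3) + 1 = 2 from rfl, show (2 : Fin 3) + 1 = 0 from rfl,
    show (0 : Fin 3) + 2 = 2 from rfl, show (1 : Fin 3) + 2 = 0 from rfl,
    show (2 : Fin 3) + 2 = 1 from rfl, vol_self₁₄, vol_self₂₄, mul_zero, zero_add] at k0 k1 k2 g0 g1 g2
  have n0 := nonneg_of_mul_nonneg_left (k0 ▸ mul_nonneg hD.le (hy 0)) g0
  have n1 := nonneg_of_mul_nonneg_left (k1 ▸ mul_nonneg hD.le (hy 1)) g1
  have n2 := nonneg_of_mul_nonneg_left (k2 ▸ mul_nonneg hD.le (hy 2)) g2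
  have hs := vol_sum e (A 0) (A 1) (A 2) o y
  have hx := vol_smul_eq e (A 0) (A 1) (A 2) o y
  rw [h0, add_zero] at hs
  rw [h0, zero_smul, add_zero] at hx
  set D := vol e (A 0) (A 1) (A 2) o with hDdef
  set α := vol e y (A 1) (A 2) o
  set β := vol e (A 0) y (A 2) o
  set γ := vol e (A 0) (A 1) y o
  have hyx : y = (α / D) • A 0 + (β / D) • A 1 + (γ / D) • A 2 := by
    have := congrArg (fun y => D⁻¹ • y) hx
    simp only [smul_smul, smul_add, inv_mul_cancel₀ hD.ne', one_smul] at this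
    simpa only [div_eq_inv_mul] using this
  have := (convex_convexHull ℝ (range A)).sum_mem (t := (Finset.univ : Finset (Fin 3)))
    (w := ![α / D, β / D, γ / D]) (z := A)
    (by intro i _; fin_cases i <;> simp <;> positivity)
    (by simp [Fin.sum_univ_three]; rw [← add_div, ← add_div, hs, div_self hD.ne'])
    (fun i _ => subset_convexHull ℝ _ (mem_range_self i))
  rw [hyx]
  simpa [Fin.sum_univ_three] using this

/-! ### From the definition of a cupola to signs -/

theorem orientation4_eq (a b c d : E3) :
    orientation4 a b c d = SignType.sign (-vol 1 a b c d) := by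
  unfold orientation4
  congr 1
  simp [Matrix.det_succ_row_zero, Fin.sum_univ_succ, Fin.succAbove, vol, det3]
  ring

theorem exists_vol_sign {ε : SignType} (hε : ε ≠ 0) :
    ∃ e : ℝ, e ≠ 0 ∧ (∀ a b c d, orientation4 a b c d = ε → 0 < vol e a b c d) ∧
      ∀ a b c d, orientation4 a b c d = -ε → vol e a b c d < 0 := by
  have hvol : ∀ a b c d, vol (-1) a b c d = -vol 1 a b c d := fun a b c d => by simp [vol]
  rcases ε with _ | _ | _
  · exact absurd rfl hε
  · refine ⟨1, one_ne_zero, fun a b c d h => ?_, fun a b c d h => ?_⟩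
    · rw [orientation4_eq] at h
      simpa using sign_eq_neg_one_iff.1 h
    · rw [orientation4_eq] at h
      simpa using sign_eq_one_iff.1 h
  · refine ⟨-1, by norm_num, fun a b c d h => ?_, fun a b c d h => ?_⟩
    · rw [orientation4_eq] at h
      rw [hvol]
      exact sign_eq_one_iff.1 h
    · rw [orientation4_eq] at h
      rw [hvol]
      exact sign_eq_neg_one_iff.1 h

theorem range_fin3 (A : Fin 3 → E3) (i : Fin 3) : range A = {A i, A (i + 1), A (i + 2)} := by
  ext x
  simp only [mem_range, Fin.exists_fin_succ, mem_insert_iff, mem_singleton_iff]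
  fin_cases i <;> simp [eq_comm] <;> tauto

theorem vol_cyclic {e : ℝ} {A : Fin 3 → E3} (i : Fin 3) (x : E3) :
    vol e (A i) (A (i + 1)) (A (i + 2)) x = vol e (A 0) (A 1) (A 2) x := by
  fin_cases i
  · rfl
  · exact vol_rotate _ _ _ _ _
  · exact (vol_rotate _ _ _ _ _).symm

/-- The chains of a cupola, indexed by natural numbers. -/
def chainMap {m : ℕ} (q : Fin 3 → Fin (m + 2) → E3) (i : Fin 3) (k : ℕ) : E3 :=
  q i ⟨min k (m + 1), by omega⟩

/-- The Schönhardt angles fix a global sign `e` and orient the two end facets. Each chain facet then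
needs one point of `C` known to be on its positive side; after that `facet_vol` delivers all signs
at the vertices and at the points beyond the bottom. -/
theorem IsCupola.exists_signs {m : ℕ} {A B : Fin 3 → E3} {q : Fin 3 → Fin (m + 2) → E3}
    {C : Set E3} (hC : IsCupola m A B q C) :
    ∃ (e : ℝ) (p : Fin 3 → ℕ → E3), e ≠ 0 ∧ C.extremePoints ℝ = chainVertices m p ∧
      C ⊆ cupolaRegion e m A B p ∧
      polytopeBeyond C (convexHull ℝ (range A)) ⊆ cupolaRegion e m A B p ∧
      (∀ x ∈ polytopeBeyond C (convexHull ℝ (range A)), vol e (A 0) (A 1) (A 2) x ≤ 0) ∧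
      (∀ x ∈ C, 0 ≤ vol e (A 0) (A 1) (A 2) x) ∧
      (∀ x ∈ cupolaRegion e m A B p, vol e (A 0) (A 1) (A 2) x = 0 →
        x ∈ convexHull ℝ (range A)) ∧
      ∀ v ∈ polytopeBeyond C (convexHull ℝ (range A)), v ∉ C → v ∈ interior (visibilityCone A B) →
        CupolaSigns e m A B p v := by
  obtain ⟨ε, hε, hang⟩ := hC.schonhardt.angles
  obtain ⟨e, he, hpos, hneg⟩ := exists_vol_sign hε
  set p := chainMap q with hp
  have p_zero : ∀ i, p i 0 = A i := fun i => by
    rw [← hC.q_zero i]; simp [hp, chainMap]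
  have p_last : ∀ i, p i (m + 1) = B (i + 1) := fun i => by
    rw [← hC.q_last i]; simp [hp, chainMap, Fin.last]
  have p_inj : ∀ i j k l, k ≤ m + 1 → l ≤ m + 1 → p i k = p j l → i = j ∧ k = l := by
    intro i j k l hk hl h
    have := @hC.injective (i, ⟨min k (m + 1), by omega⟩) (j, ⟨min l (m + 1), by omega⟩) h
    simp only [Prod.mk.injEq, Fin.mk.injEq] at this
    exact ⟨this.1, by omega⟩
  have hvert : C.extremePoints ℝ = chainVertices m p := by
    rw [hC.vertices]
    ext x
    simp only [mem_iUnion, mem_range, chainVertices, mem_ofPred_eq]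
    constructor
    · rintro ⟨i, k, rfl⟩
      exact ⟨i, k, by omega, by simp [hp, chainMap, Nat.min_eq_left (show (k : ℕ) ≤ m + 1 by omega)]⟩
    · rintro ⟨i, k, hk, rfl⟩
      exact ⟨i, _, rfl⟩
  have hint := hC.isPolytope.2
  have p_mem : ∀ i k, k ≤ m + 1 → p i k ∈ C.extremePoints ℝ := fun i k hk => by
    rw [hvert]; exact ⟨i, k, hk, rfl⟩
  have A_mem : ∀ i, A i ∈ C.extremePoints ℝ := fun i => p_zero i ▸ p_mem i 0 (by omega)
  have B_eq : ∀ i, B i = p (i + 2) (m + 1) := fun i => by rw [p_last, fin3_add_two_add_one]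
  have B_mem : ∀ i, B i ∈ C.extremePoints ℝ := fun i => B_eq i ▸ p_mem _ _ le_rfl
  have p_ne : ∀ {i j k l}, k ≤ m + 1 → l ≤ m + 1 → (i ≠ j ∨ k ≠ l) → p i k ≠ p j l :=
    fun hk hl h h' => by have := p_inj _ _ _ _ hk hl h'; tauto
  have p_ne_A : ∀ {i j k}, k ≤ m + 1 → (i ≠ j ∨ k ≠ 0) → p i k ≠ A j := fun hk h => by
    rw [← p_zero]; exact p_ne hk (by omega) h
  have p_ne_B : ∀ {i j k}, k ≤ m + 1 → (i ≠ j + 2 ∨ k ≠ m + 1) → p i k ≠ B j := fun hk h => by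
    rw [B_eq]; exact p_ne hk (by omega) h
  have A_ne_A : ∀ {i j}, i ≠ j → A i ≠ A j := fun h => by
    rw [← p_zero]; exact p_ne_A (by omega) (Or.inl h)
  have A_ne_B : ∀ i j, A i ≠ B j := fun i j => by
    rw [← p_zero]; exact p_ne_B (by omega) (Or.inr (by omega))
  have p_cast : ∀ i k (hk : k ≤ m), p i k = q i (Fin.castSucc ⟨k, by omega⟩) := fun i k hk => by
    simp only [hp, chainMap]; congr 1; ext; simp; omega
  have p_succ : ∀ i k (hk : k ≤ m), p i (k + 1) = q i (Fin.succ ⟨k, by omega⟩) := fun i k hk => by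
    simp only [hp, chainMap]; congr 1; ext; simp; omega
  have facet_mem : ∀ G, G ∈ ({convexHull ℝ (range A), convexHull ℝ (range B)}
      ∪ {G | ∃ (i : Fin 3) (k : Fin (m + 1)),
          G = convexHull ℝ {B i, q i k.castSucc, q i k.succ}}
      ∪ {G | ∃ (i : Fin 3) (k : Fin (m + 1)),
          G = convexHull ℝ {A (i + 1), q i k.castSucc, q i k.succ}} : Set (Set E3)) →
      IsFacet C G := fun G hG => by rw [← hC.facets] at hG; exact hG
  have GA : IsFacet C (convexHull ℝ {A 0, A 1, A 2}) := by
    have := facet_mem (convexHull ℝ (range A)) (by simp)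
    rwa [range_fin3 A 0] at this
  have GB : ∀ i, IsFacet C (convexHull ℝ {B (i + 1), B i, B (i + 2)}) := fun i => by
    have := facet_mem (convexHull ℝ (range B)) (by simp)
    rwa [range_fin3 B i, Set.insert_comm] at this
  have GpA : ∀ i, ∀ k ≤ m, IsFacet C (convexHull ℝ {A (i + 1), p i k, p i (k + 1)}) :=
    fun i k hk => by
      rw [p_cast i k hk, p_succ i k hk]
      exact facet_mem _ (Or.inr ⟨i, _, rfl⟩)
  have GpB : ∀ i, ∀ k ≤ m, IsFacet C (convexHull ℝ {B i, p i k, p i (k + 1)}) :=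
    fun i k hk => by
      rw [p_cast i k hk, p_succ i k hk]
      exact facet_mem _ (Or.inl (Or.inr ⟨i, _, rfl⟩))
  have fA := facet_vol hint GA (e := e) (B_mem 0).1 (hpos _ _ _ _ (hang 0).1)
  have fB := fun i => facet_vol hint (GB i) (e := e) (A_mem (i + 1)).1 (hpos _ _ _ _ (hang i).2.1)
  have A_pos : ∀ i, ∀ x ∈ C.extremePoints ℝ, x ≠ A i → x ≠ A (i + 1) → x ≠ A (i + 2) →
      0 < vol e (A i) (A (i + 1)) (A (i + 2)) x := by
    intro i x hx h1 h2 h3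
    rw [vol_cyclic]
    have h : ∀ j, x ≠ A j := by
      intro j hj
      have : A j ∈ range A := mem_range_self j
      rw [range_fin3 A i] at this
      rcases this with h | h | h
      · exact h1 (hj.trans h)
      · exact h2 (hj.trans h)
      · exact h3 (hj.trans h)
    exact fA.2.1 x hx (h _) (h _) (h _)
  have g0 : ∀ i, 0 < vol e (A (i + 1)) (A i) (p i 1) (A (i + 2)) := fun i => by
    have := A_pos i (p i 1) (p_mem i 1 (by omega)) (p_ne_A (by omega) (Or.inr (by omega)))
      (p_ne_A (by omega) (Or.inr (by omega))) (p_ne_A (by omega) (Or.inr (by omega)))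
    rw [vol_swap₁₂, vol_swap₃₄]
    simpa using this
  have flip : ∀ i k, vol e (B i) (p i k) (p i (k + 1)) (A (i + 1))
      = -vol e (A (i + 1)) (p i k) (p i (k + 1)) (B i) := fun i k => by
    simp only [vol, det3, PiLp.sub_apply]; ring
  have volneg : ∀ a b c d, vol (-e) a b c d = -vol e a b c d := fun a b c d => by
    simp [vol]
  -- The orientation travels along the chain across shared edges: from a facet at `A (i + 1)` to the
  -- facet at `B i` over the same chain edge, from there to the next facet at `B i`, and back. It
  -- starts at the neighbour of the bottom facet.
  have hpA : ∀ i, ∀ k ≤ m, ∃ x₀ ∈ C, 0 < vol e (A (i + 1)) (p i k) (p i (k + 1)) x₀ := by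
    intro i k hk
    induction k with
    | zero => exact ⟨A (i + 2), (A_mem _).1, by rw [p_zero]; exact g0 i⟩
    | succ k ih =>
      obtain ⟨x₀, hx₀, h₀⟩ := ih (by omega)
      have h1 := (facet_vol hint (GpA i k (by omega)) hx₀ h₀).2.1 (B i) (B_mem i) (A_ne_B _ _).symm
        (p_ne_B (by omega) (Or.inl (by simp))).symm (p_ne_B (by omega) (Or.inl (by simp))).symm
      have h2 := (facet_vol hint (GpB i k (by omega)) (e := -e) (A_mem (i + 1)).1
        (by rw [volneg, flip]; linarith)).2.1 (p i (k + 2)) (p_mem _ _ (by omega))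
        (p_ne_B (by omega) (Or.inl (by simp))) (p_ne (by omega) (by omega) (Or.inr (by omega)))
        (p_ne (by omega) (by omega) (Or.inr (by omega)))
      rw [volneg, ← vol_rotate_last, ← volneg] at h2
      have h3 := (facet_vol hint (GpB i (k + 1) hk) (e := -e) (p_mem i k (by omega)).1
        (by rwa [vol_rotate_last, vol_rotate_last] at h2 ⊢)).2.1 (A (i + 1)) (A_mem _)
        (A_ne_B _ _) (p_ne_A (by omega) (Or.inr (by omega))).symm
        (p_ne_A (by omega) (Or.inr (by omega))).symm
      rw [volneg, flip] at h3
      exact ⟨B i, (B_mem i).1, by linarith⟩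
  have fpA := fun i k hk => facet_vol hint (GpA i k hk) (hpA i k hk).choose_spec.1
    (hpA i k hk).choose_spec.2
  -- Facets at `B i` list the chain edge in the opposite sense to the boundary orientation, hence
  -- the factor `-e`.
  have fpB := fun i k (hk : k ≤ m) => facet_vol hint (GpB i k hk) (e := -e) (A_mem (i + 1)).1 (by
    have := (fpA i k hk).2.1 (B i) (B_mem i) (A_ne_B _ _).symm
      (p_ne_B (by omega) (Or.inl (by simp))).symm (p_ne_B (by omega) (Or.inl (by simp))).symm
    rw [volneg, flip]; linarith)
  have notsub : ∀ {a b c : E3} {e' : ℝ} (i : Fin 3), 0 < vol e' a b c (A i) →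
      ¬convexHull ℝ (range A) ⊆ convexHull ℝ {a, b, c} := fun i h hsub =>
    h.ne' (vol_eq_zero_of_mem_convexHull (hsub (subset_convexHull _ _ (mem_range_self i))))
  have hregion : ∀ x ∈ polytopeBeyond C (convexHull ℝ (range A)), x ∈ cupolaRegion e m A B p := by
    intro x hx
    refine ⟨fun i => ?_, fun i k hk => ?_, fun i k hk => ?_⟩
    · exact (fB i).2.2.1 _ (notsub (i + 1) (hpos _ _ _ _ (hang i).2.1)) x hx
    · exact (fpA i k hk).2.2.1 _ (notsub (i + 2) ((fpA i k hk).2.1 _ (A_mem _) (A_ne_A (by simp))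
        (p_ne_A (by omega) (Or.inl (by simp))).symm (p_ne_A (by omega) (Or.inl (by simp))).symm))
        x hx
    · have := (fpB i k hk).2.2.1 _ (notsub (i + 1) ((fpB i k hk).2.1 _ (A_mem _) (A_ne_B _ _)
        (p_ne_A (by omega) (Or.inl (by simp))).symm (p_ne_A (by omega) (Or.inl (by simp))).symm))
        x hx
      rw [volneg] at this
      linarith
  have hbot : ∀ x ∈ polytopeBeyond C (convexHull ℝ (range A)), vol e (A 0) (A 1) (A 2) x ≤ 0 := by
    intro x hx
    rw [range_fin3 A 0] at hx
    exact fA.2.2.2 x hx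
  have hplane : ∀ x ∈ cupolaRegion e m A B p, vol e (A 0) (A 1) (A 2) x = 0 →
        x ∈ convexHull ℝ (range A) := by
    intro x hx h0
    refine mem_convexHull_bottom (r := fun i => p i 1) (hpos _ _ _ _ (hang 0).1) g0 (fun i => ?_) h0
    have := hx.2.1 i 0 (by omega)
    rwa [p_zero] at this
  refine ⟨e, p, he, hvert, fun x hx => ⟨fun i => (fB i).1 x hx, fun i k hk => (fpA i k hk).1 x hx,
    fun i k hk => ?_⟩, hregion, hbot, fA.1, hplane, fun v hv hvC hvV => ?_⟩
  · have := (fpB i k hk).1 x hx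
    rw [volneg] at this
    linarith
  refine ⟨p_zero, p_last, p_inj, ?_, ?_, ?_, ?_, fun i => hneg _ _ _ _ (hang i).2.2.2, ?_,
    hregion v hv, ?_⟩
  · rw [← hvert]; exact A_pos
  · rw [← hvert]
    exact fun i x hx h1 h2 h3 => (fB i).2.1 x hx h2 h1 h3
  · rw [← hvert]
    exact fun i k hk x hx => (fpA i k hk).2.1 x hx
  · rw [← hvert]
    intro i k hk x hx h1 h2 h3
    have := (fpB i k hk).2.1 x hx h1 h2 h3
    rw [volneg] at this
    linarith
  · intro i
    rw [vol_cyclic]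
    -- If `v` were in the bottom plane, it would be in the bottom facet and therefore in `C`.
    refine lt_of_le_of_ne (hbot v hv) fun h => hvC ?_
    refine convexHull_min ?_ ?_ (hplane v (hregion v hv) h)
    · rintro _ ⟨i, rfl⟩
      exact (A_mem i).1
    · obtain ⟨S, hS⟩ := hC.isPolytope.1
      rw [hS]; exact convex_convexHull _ _
  · intro i
    have hB : 0 < vol e (B i) (B (i + 1)) (A (i + 1)) (B (i + 2)) := by
      have := hpos _ _ _ _ (hang i).2.1
      rw [vol_swap₁₂, vol_swap₃₄]
      simpa using this
    refine pos_of_mem_interior (P := visibilityCone A B)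
      (f := volMap e (B i) (B (i + 1)) (A (i + 1))) (fun x hx => ?_) hB hvV
    have := mul_nonneg_of_wSameSide (f := volMap e (B i) (B (i + 1)) (A (i + 1))) (fun y hy => ?_)
      (hx i)
    · exact nonneg_of_mul_nonneg_left this hB
    · simp only [mem_insert_iff, mem_singleton_iff] at hy
      rcases hy with rfl | rfl | rfl
      exacts [vol_self₁₄ _ _ _ _, vol_self₂₄ _ _ _ _, vol_self₃₄ _ _ _ _]

/-! ### Far triangles -/

/-- Positive heights on `W`, close to `1`, such that no four points of `W` are lifted to a common
plane. -/
structure GenericHeights (e : ℝ) (v : E3) (W : Finset E3) (h : E3 → ℝ) : Prop where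
  pos : ∀ w ∈ W, 0 < h w
  ne : ∀ a ∈ W, ∀ b ∈ W, ∀ c ∈ W, ∀ w ∈ W, 0 < vol e v a b c → w ≠ a → w ≠ b → w ≠ c →
    lift e v h a b c w ≠ 0
  of_nonneg : ∀ a ∈ W, ∀ b ∈ W, ∀ c ∈ W, ∀ w ∈ W, 0 ≤ lift e v h a b c w →
    0 ≤ lift e v (fun _ => 1) a b c w
  of_pos : ∀ a ∈ W, ∀ b ∈ W, ∀ c ∈ W, ∀ w ∈ W, 0 < lift e v (fun _ => 1) a b c w →
    0 ≤ lift e v h a b c w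

-- Take the heights `1 + δ ^ idx w` with distinct positive exponents on `W`. Each lifting condition
-- is then a polynomial in `δ` whose value at `0` is the condition for constant heights. It is
-- nonzero where required, so all sufficiently small positive `δ` avoid its roots and preserve
-- strict signs.
open Filter Topology Polynomial in
theorem exists_genericHeights (e : ℝ) (v : E3) (W : Finset E3) : ∃ h, GenericHeights e v W h := by
  obtain ⟨idx, hidx0, hidx⟩ : ∃ idx : E3 → ℕ, (∀ w, idx w ≠ 0) ∧
      ∀ a ∈ W, ∀ b ∈ W, idx a = idx b → a = b := by
    refine ⟨fun w => if h : w ∈ W then (W.equivFin ⟨w, h⟩ : ℕ) + 1 else 1, fun w => ?_, ?_⟩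
    · by_cases h : w ∈ W <;> simp [h]
    · intro a ha b hb hab
      simp only [ha, hb, dif_pos, Nat.add_right_cancel_iff] at hab
      simpa using W.equivFin.injective (Fin.ext hab)
  set P : E3 → E3 → E3 → E3 → ℝ[X] := fun a b c w =>
    C (lift e v (fun _ => 1) a b c w) + C (vol e v a b c) * X ^ idx w
      - C (vol e v w b c) * X ^ idx a - C (vol e v a w c) * X ^ idx b
      - C (vol e v a b w) * X ^ idx c with hP
  have heval : ∀ a b c w δ, (P a b c w).eval δ = lift e v (fun w => 1 + δ ^ idx w) a b c w := by
    intro a b c w δ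
    simp only [hP, lift, eval_sub, eval_add, eval_mul, eval_pow, eval_C, eval_X]
    ring
  have heval0 : ∀ a b c w, (P a b c w).eval 0 = lift e v (fun _ => 1) a b c w := by
    intro a b c w
    rw [heval]
    simp [hidx0]
  have hev : ∀ a ∈ W, ∀ b ∈ W, ∀ c ∈ W, ∀ w ∈ W, ∀ᶠ δ in 𝓝[>] (0 : ℝ),
      (0 < vol e v a b c → w ≠ a → w ≠ b → w ≠ c → (P a b c w).eval δ ≠ 0) ∧
      (0 ≤ (P a b c w).eval δ → 0 ≤ (P a b c w).eval 0) ∧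
      (0 < (P a b c w).eval 0 → 0 ≤ (P a b c w).eval δ) := by
    intro a ha b hb c hc w hw
    have htend : Tendsto (fun δ => (P a b c w).eval δ) (𝓝[>] 0) (𝓝 ((P a b c w).eval 0)) :=
      ((P a b c w).continuous.tendsto 0).mono_left nhdsWithin_le_nhds
    refine Filter.Eventually.and ?_ (Filter.Eventually.and ?_ ?_)
    · by_cases h : 0 < vol e v a b c ∧ w ≠ a ∧ w ≠ b ∧ w ≠ c
      · have hne : P a b c w ≠ 0 := by
          intro h0
          -- Only the term of `w` contributes to this power of `X`, and its coefficient is the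
          -- volume of the triangle seen from `v`.
          have hcoeff := congrArg (fun p => p.coeff (idx w)) h0
          have n1 : idx w ≠ idx a := fun h' => h.2.1 (hidx w hw a ha h')
          have n2 : idx w ≠ idx b := fun h' => h.2.2.1 (hidx w hw b hb h')
          have n3 : idx w ≠ idx c := fun h' => h.2.2.2 (hidx w hw c hc h')
          simp [hP, coeff_C, coeff_X_pow, hidx0, n1, n2, n3] at hcoeff
          exact h.1.ne' hcoeff
        have hfin := Polynomial.finite_setOfPred_isRoot hne
        have hcl : ({x | (P a b c w).IsRoot x} \ {0})ᶜ ∈ 𝓝 (0 : ℝ) :=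
          (hfin.subset sdiff_subset).isClosed.isOpen_compl.mem_nhds (by simp)
        filter_upwards [nhdsWithin_le_nhds hcl, self_mem_nhdsWithin] with δ h1 h2 _ _ _ _ h3
        exact h1 ⟨h3, (mem_Ioi.1 h2).ne'⟩
      · exact Filter.Eventually.of_forall fun δ h1 h2 h3 h4 => absurd ⟨h1, h2, h3, h4⟩ h
    · by_cases h : 0 ≤ (P a b c w).eval 0
      · exact Filter.Eventually.of_forall fun δ _ => h
      · filter_upwards [htend.eventually_lt_const (not_le.1 h)] with δ h1 h2
        exact absurd h2 (not_le.2 h1)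
    · by_cases h : 0 < (P a b c w).eval 0
      · filter_upwards [htend.eventually_const_lt h] with δ h1 _ using h1.le
      · exact Filter.Eventually.of_forall fun δ h' => absurd h' h
  have hall : ∀ᶠ δ in 𝓝[>] (0 : ℝ), ∀ a ∈ W, ∀ b ∈ W, ∀ c ∈ W, ∀ w ∈ W,
      (0 < vol e v a b c → w ≠ a → w ≠ b → w ≠ c → (P a b c w).eval δ ≠ 0) ∧
      (0 ≤ (P a b c w).eval δ → 0 ≤ (P a b c w).eval 0) ∧
      (0 < (P a b c w).eval 0 → 0 ≤ (P a b c w).eval δ) := by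
    simp only [Filter.eventually_all_finset]
    exact hev
  obtain ⟨δ, hδ, hδ0⟩ := (hall.and self_mem_nhdsWithin).exists
  have hδ0 : 0 < δ := hδ0
  refine ⟨fun w => 1 + δ ^ idx w, fun w _ => by positivity, ?_, ?_, ?_⟩
  · intro a ha b hb c hc w hw
    rw [← heval]
    exact (hδ a ha b hb c hc w hw).1
  · intro a ha b hb c hc w hw
    rw [← heval, ← heval0]
    exact (hδ a ha b hb c hc w hw).2.1
  · intro a ha b hb c hc w hw
    rw [← heval, ← heval0]
    exact (hδ a ha b hb c hc w hw).2.2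

theorem lift_one (e : ℝ) (v a b c w : E3) : lift e v (fun _ => 1) a b c w = vol e w a b c := by
  have := vol_sum e v a b c w
  simp only [lift]
  linarith

/-- `T` is a triangle of points of `W` that is optimal for the heights `h`, as seen from `v`. -/
def IsFar (e : ℝ) (v : E3) (h : E3 → ℝ) (W T : Finset E3) : Prop :=
  ∃ a b c, T = {a, b, c} ∧ a ∈ W ∧ b ∈ W ∧ c ∈ W ∧ 0 < vol e v a b c ∧
    ∀ w ∈ W, 0 ≤ lift e v h a b c w

/-- This functional is the dual solution of the linear program: it interpolates the heights on `T`
and stays below them on `W`. Genericity confines equality to `T`. -/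
theorem IsFar.exists_functional {e : ℝ} {v : E3} {h : E3 → ℝ} {W T : Finset E3}
    (hh : GenericHeights e v W h) (hT : IsFar e v h W T) :
    ∃ l : E3 →ᵃ[ℝ] ℝ, l v = 0 ∧ (∀ t ∈ T, l t = h t) ∧ (∀ w ∈ W, l w ≤ h w) ∧
      ∀ w ∈ W, l w = h w → w ∈ T := by
  obtain ⟨a, b, c, rfl, ha, hb, hc, hD, hl⟩ := hT
  have hval : ∀ x, ((vol e v a b c)⁻¹ • (h a • volMap e v b c + h b • volMap e v c a
      + h c • volMap e v a b)) x = h x - lift e v h a b c x / vol e v a b c := by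
    intro x
    have e1 : vol e v b c x = vol e v x b c := vol_rotate_last _ _ _ _ _
    have e2 : vol e v c a x = vol e v a x c := vol_rotate_last _ _ _ _ _ |>.symm
    simp only [lift, AffineMap.coe_smul, AffineMap.coe_add, Pi.smul_apply, Pi.add_apply,
      volMap_apply, smul_eq_mul, e1, e2]
    field_simp
    ring
  refine ⟨_, ?_, fun t ht => (hval t).trans ?_, fun w hw => (hval w).trans_le ?_, fun w hw h0 => ?_⟩
  · simp [vol_self₁₄]
  · simp only [Finset.mem_insert, Finset.mem_singleton] at ht
    have : lift e v h a b c t = 0 := by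
      rcases ht with rfl | rfl | rfl
      · simp [lift, vol_self₂₃, vol_self₂₄]
      · simp [lift, vol_self₂₃, vol_self₃₄]
      · simp [lift, vol_self₂₄, vol_self₃₄]
    rw [this]; simp
  · have := div_nonneg (hl w hw) hD.le
    linarith
  · rw [hval] at h0
    have : lift e v h a b c w / vol e v a b c = 0 := by linarith
    have := (div_eq_zero_iff.1 this).resolve_right hD.ne'
    by_contra hn
    simp only [Finset.mem_insert, Finset.mem_singleton, not_or] at hn
    exact hh.ne a ha b hb c hc w hw hD hn.1 hn.2.1 hn.2.2 this

/-- The missing weight, one minus the sum, is put on the apex. -/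
theorem mem_convexHull_insert {v x : E3} {T : Finset E3} :
    x ∈ convexHull ℝ (insert v T : Set E3) ↔ ∃ w : E3 → ℝ, (∀ y ∈ T, 0 ≤ w y) ∧
      ∑ y ∈ T, w y ≤ 1 ∧ x - v = ∑ y ∈ T, w y • (y - v) := by
  constructor
  · intro hx
    rw [← Finset.coe_insert] at hx
    obtain ⟨w, hw0, hw1, rfl⟩ := Finset.mem_convexHull'.1 hx
    refine ⟨w, fun y hy => hw0 y (Finset.mem_insert_of_mem hy), ?_, ?_⟩
    · rw [← hw1]
      exact Finset.sum_le_sum_of_subset_of_nonneg (Finset.subset_insert _ _) fun y hy _ => hw0 y hy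
    · have h1 : ∑ y ∈ insert v T, w y • y - v = ∑ y ∈ insert v T, w y • (y - v) := by
        simp only [smul_sub, Finset.sum_sub_distrib, ← Finset.sum_smul, hw1, one_smul]
      rw [h1]
      exact Finset.sum_insert_of_eq_zero_if_notMem fun _ => by simp
  · rintro ⟨w, hw0, hw1, hx⟩
    have hv : v ∈ convexHull ℝ (insert v T : Set E3) := subset_convexHull _ _ (by simp)
    rcases (Finset.sum_nonneg hw0).eq_or_lt with h0 | h0
    · have hz := (Finset.sum_eq_zero_iff_of_nonneg hw0).1 h0.symm
      have : x - v = 0 := by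
        rw [hx]; exact Finset.sum_eq_zero fun y hy => by rw [hz y hy, zero_smul]
      rw [sub_eq_zero.1 this]; exact hv
    · have hc := T.centerMass_mem_convexHull hw0 h0 (z := id)
        (s := (insert v T : Set E3)) fun y hy => by simp [hy]
      have key := (convex_convexHull ℝ (insert v T : Set E3)) hv hc
        (sub_nonneg.2 hw1) h0.le (by ring)
      convert key
      have h1 : x = v + ∑ y ∈ T, w y • (y - v) := by rw [← hx]; abel
      rw [h1, Finset.centerMass, smul_smul, mul_inv_cancel₀ h0.ne', one_smul]
      simp only [smul_sub, Finset.sum_sub_distrib, ← Finset.sum_smul, sub_smul, one_smul, id]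
      abel

theorem affine_conic {l : E3 →ᵃ[ℝ] ℝ} {v x : E3} (hl : l v = 0) {T : Finset E3} {w : E3 → ℝ}
    (hx : x - v = ∑ y ∈ T, w y • (y - v)) : l x = ∑ y ∈ T, w y * l y := by
  have hlin : ∀ y, l.linear (y - v) = l y := fun y => by
    rw [← vsub_eq_sub, l.linearMap_vsub, hl, vsub_eq_sub, sub_zero]
  have := congrArg l.linear hx
  simpa only [map_sum, map_smul, hlin, smul_eq_mul] using this

/-- Two simplices with a common apex meet in a face if they are separated by a convex lifting. -/
theorem meetInFace_of_lifting {v : E3} {s t : Finset E3} {l l' : E3 →ᵃ[ℝ] ℝ} (hl : l v = 0)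
    (hl' : l' v = 0) (hs : ∀ x ∈ s, l' x ≤ l x) (ht : ∀ x ∈ t, l x ≤ l' x)
    (hmem : ∀ x ∈ t, l x = l' x → x ∈ s) : MeetInFace (insert v s) (insert v t) := by
  refine Subset.antisymm ?_ (subset_inter (convexHull_mono inter_subset_left)
    (convexHull_mono inter_subset_right))
  rintro x ⟨hxs, hxt⟩
  rw [Finset.coe_insert] at hxs hxt
  obtain ⟨w, hw0, hw1, hwx⟩ := mem_convexHull_insert.1 hxs
  obtain ⟨u, hu0, hu1, hux⟩ := mem_convexHull_insert.1 hxt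
  have h1 : 0 ≤ l x - l' x := by
    rw [affine_conic hl hwx, affine_conic hl' hwx, ← Finset.sum_sub_distrib]
    refine Finset.sum_nonneg fun y hy => ?_
    rw [← mul_sub]
    exact mul_nonneg (hw0 y hy) (sub_nonneg.2 (hs y hy))
  rw [affine_conic hl hux, affine_conic hl' hux, ← Finset.sum_sub_distrib] at h1
  have h2 : ∀ y ∈ t, u y * l y - u y * l' y ≤ 0 := fun y hy => by
    rw [← mul_sub]
    exact mul_nonpos_of_nonneg_of_nonpos (hu0 y hy) (sub_nonpos.2 (ht y hy))
  have h3 := (Finset.sum_eq_zero_iff_of_nonpos h2).1 (le_antisymm (Finset.sum_nonpos h2) h1)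
  have h4 : ∀ y ∈ t, y ∉ s → u y = 0 := fun y hy hys => by
    have := h3 y hy
    rw [← mul_sub] at this
    exact (mul_eq_zero.1 this).resolve_right fun h => hys (hmem y hy (sub_eq_zero.1 h))
  have : x ∈ convexHull ℝ (insert v ((s ∩ t : Finset E3) : Set E3)) := by
    refine mem_convexHull_insert.2 ⟨u, fun y hy => hu0 y (Finset.mem_inter.1 hy).2, ?_, ?_⟩
    · refine le_trans ?_ hu1
      exact Finset.sum_le_sum_of_subset_of_nonneg Finset.inter_subset_right fun y hy _ => hu0 y hy
    · rw [hux]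
      symm
      refine Finset.sum_subset Finset.inter_subset_right fun y hy hy' => ?_
      rw [h4 y hy fun h => hy' (Finset.mem_inter.2 ⟨h, hy⟩), zero_smul]
  refine convexHull_mono ?_ this
  intro y hy
  simp at hy ⊢
  tauto

/-- Each dual functional dominates the other one on its own triangle, and equality is possible only
at common vertices. -/
theorem IsFar.meetInFace {e : ℝ} {v : E3} {h : E3 → ℝ} {W T T' : Finset E3}
    (hh : GenericHeights e v W h) (hT : IsFar e v h W T) (hT' : IsFar e v h W T') :
    MeetInFace (insert v T) (insert v T') := by
  obtain ⟨l, hl, hlT, hlW, hlm⟩ := hT.exists_functional hh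
  obtain ⟨l', hl', hlT', hlW', hlm'⟩ := hT'.exists_functional hh
  have sub : ∀ {T}, IsFar e v h W T → T ⊆ W := by
    rintro T ⟨a, b, c, rfl, ha, hb, hc, -⟩
    simp [Finset.insert_subset_iff, ha, hb, hc]
  refine meetInFace_of_lifting hl hl' (fun x hx => ?_) (fun x hx => ?_) (fun x hx h => ?_)
  · rw [hlT x hx]; exact hlW' x (sub hT hx)
  · rw [hlT' x hx]; exact hlW x (sub hT' hx)
  · rw [hlT' x hx] at h; exact hlm x (sub hT' hx) h

theorem IsFar.exists_vol {e : ℝ} {v : E3} {h : E3 → ℝ} {W T : Finset E3} (hT : IsFar e v h W T) :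
    ∃ a b c d, insert v T = {a, b, c, d} ∧ vol e a b c d ≠ 0 := by
  obtain ⟨a, b, c, rfl, -, -, -, hD, -⟩ := hT
  exact ⟨v, a, b, c, rfl, hD.ne'⟩

theorem IsFar.subset {e : ℝ} {v : E3} {h : E3 → ℝ} {W T : Finset E3} (hT : IsFar e v h W T) :
    T ⊆ W := by
  obtain ⟨a, b, c, rfl, ha, hb, hc, -⟩ := hT
  simp [Finset.insert_subset_iff, ha, hb, hc]

theorem IsFar.vol_ne_zero {e : ℝ} {v : E3} {h : E3 → ℝ} {W : Finset E3} {a b c : E3}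
    (hT : IsFar e v h W {a, b, c}) (hab : a ≠ b) (hac : a ≠ c) (hbc : b ≠ c) :
    vol e v a b c ≠ 0 := by
  obtain ⟨x, y, z, hxyz, -, -, -, hD, -⟩ := hT
  have hx : x ∈ ({a, b, c} : Finset E3) := by rw [hxyz]; simp
  have hy : y ∈ ({a, b, c} : Finset E3) := by rw [hxyz]; simp
  have hz : z ∈ ({a, b, c} : Finset E3) := by rw [hxyz]; simp
  simp only [Finset.mem_insert, Finset.mem_singleton] at hx hy hz
  intro h0
  have s1 : vol e v a c b = 0 := by rw [vol_swap₃₄, h0, neg_zero]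
  have s2 : vol e v b a c = 0 := by rw [vol_swap₂₃, h0, neg_zero]
  have s3 : vol e v b c a = 0 := by rw [vol_rotate_last, h0]
  have s4 : vol e v c a b = 0 := by rw [← vol_rotate_last, h0]
  have s5 : vol e v c b a = 0 := by rw [vol_swap₂₃, s3, neg_zero]
  rcases hx with rfl | rfl | rfl <;> rcases hy with rfl | rfl | rfl <;>
    rcases hz with rfl | rfl | rfl <;>
    simp_all [vol_self₂₃, vol_self₂₄, vol_self₃₄]

/-- There is at most one far triangle on each side of an edge. -/
theorem IsFar.eq_of_edge {e : ℝ} {v : E3} {h : E3 → ℝ} {W : Finset E3} {a b c d : E3}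
    (hh : GenericHeights e v W h) (hT : IsFar e v h W {a, b, c}) (hT' : IsFar e v h W {a, b, d})
    (hda : d ≠ a) (hdb : d ≠ b) (hpos : 0 < vol e v a b c * vol e v a b d) : d = c := by
  obtain ⟨l, hl, hlT, hlW, hlm⟩ := hT.exists_functional hh
  obtain ⟨l', hl', hlT', hlW', hlm'⟩ := hT'.exists_functional hh
  -- The difference vanishes at `v`, `a`, `b`, so it has equal signs at `c` and `d` when these are
  -- on the same side. But it is nonpositive at `c` and nonnegative at `d`; hence it vanishes at
  -- both, and `d` belongs to the first triangle.
  have key := vol_mul_affine_eq (f := l' - l) (e := e) (a := v) (b := a) (c := b)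
    (by simp [hl, hl']) (by simp [hlT a, hlT' a]) (by simp [hlT b, hlT' b]) c d
  have hc := hlT c (by simp)
  have hd := hlT' d (by simp)
  have hcW := hlW' c (hT.subset (by simp))
  have hdW := hlW d (hT'.subset (by simp))
  simp only [AffineMap.coe_sub, Pi.sub_apply, hc, hd] at key
  have h0 : l d = h d := by
    by_contra hne
    have hlt : 0 < h d - l d := sub_pos.2 (lt_of_le_of_ne hdW hne)
    have h1 := mul_pos hpos hlt
    have h2 : vol e v a b c * vol e v a b d * (h d - l d)
        = vol e v a b d * vol e v a b d * (l' c - h c) := by linear_combination vol e v a b d * key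
    have h3 := mul_nonneg (mul_self_nonneg (vol e v a b d)) (sub_nonneg.2 hcW)
    linarith
  have := hlm d (hT'.subset (by simp)) h0
  simp only [Finset.mem_insert, Finset.mem_singleton, hda, hdb, false_or] at this
  exact this

/-- Far triangles cover generic points. -/
theorem exists_isFar_mem {e : ℝ} (he : e ≠ 0) {v x : E3} {h : E3 → ℝ} {W : Finset E3}
    (hh : GenericHeights e v W h) (hx : x ∈ convexHull ℝ (insert v W : Set E3)) (hxv : x ≠ v)
    (hgen : ∀ a ∈ W, ∀ b ∈ W, x - v ∉ Submodule.span ℝ {a - v, b - v}) :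
    ∃ a b c, IsFar e v h W {a, b, c} ∧ x ∈ convexHull ℝ ({v, a, b, c} : Set E3) := by
  obtain ⟨w, hw0, hw1, hwx⟩ := mem_convexHull_insert.1 hx
  obtain ⟨a, b, c, hT, hopt⟩ := exists_optimal_triangle he hh.pos hw0 hwx hxv hgen
  rw [mem_trianglesAround] at hT
  obtain ⟨⟨ha, hb, hc⟩, hD, h1, h2, h3⟩ := hT
  refine ⟨a, b, c, ⟨a, b, c, rfl, ha, hb, hc, hD, hopt⟩,
    mem_convexHull_four hD ?_ h1.le h2.le h3.le⟩
  -- The last wall is the far plane itself. Since the heights are close to `1`, optimality for them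
  -- still puts all of `W`, hence `x`, on the side of `v`.
  have hneg : ∀ y, vol (-e) a b c y = vol e y a b c := fun y => by
    simp only [vol, det3, PiLp.sub_apply]; ring
  rw [← hneg]
  refine nonneg_of_mem_convexHull (f := volMap (-e) a b c) (fun y hy => ?_) hx
  rw [volMap_apply, hneg]
  rcases hy with rfl | hy
  · exact hD.le
  · rw [← lift_one e v]
    exact hh.of_nonneg a ha b hb c hc y hy (hopt y hy)

/-! ### The union of a cupola with the visible part of a polytope -/

theorem mem_extremePoints_of_zeros {Q : Set E3} {g : E3 →ᵃ[ℝ] ℝ} (hg : ∀ y ∈ Q, 0 ≤ g y) {x : E3}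
    (hx : x ∈ Q) (hgx : g x = 0) (huniq : ∀ y ∈ Q, g y = 0 → y = x) :
    x ∈ Q.extremePoints ℝ := by
  rw [mem_extremePoints]
  refine ⟨hx, fun x₁ h₁ x₂ h₂ hseg => ?_⟩
  obtain ⟨a, b, ha, hb, hab, rfl⟩ := hseg
  have h3 : g (a • x₁ + b • x₂) = a * g x₁ + b * g x₂ := by
    have := Convex.combo_affine_apply (f := g) (x := x₁) (y := x₂) hab
    simpa using this
  have n1 := hg _ h₁
  have n2 := hg _ h₂
  have m1 := mul_nonneg ha.le n1
  have m2 := mul_nonneg hb.le n2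
  refine ⟨huniq _ h₁ ?_, huniq _ h₂ ?_⟩
  · exact (mul_eq_zero.1 (by linarith : a * g x₁ = 0)).resolve_left ha.ne'
  · exact (mul_eq_zero.1 (by linarith : b * g x₂ = 0)).resolve_left hb.ne'

/-- Two planes meet in the line through `c` and `d`, and `g` vanishes on that line only at `c`. -/
theorem eq_of_three_zeros {e : ℝ} {a b c d y : E3} (hD : vol e a b c d ≠ 0)
    (h1 : vol e a c d y = 0) (h2 : vol e b c d y = 0) {g : E3 →ᵃ[ℝ] ℝ} (hc : g c = 0)
    (hd : g d ≠ 0) (hy : g y = 0) : y = c := by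
  have e1 : vol e y b c d = 0 := by
    rw [show vol e y b c d = -vol e b c d y by simp only [vol, det3, PiLp.sub_apply]; ring, h2,
      neg_zero]
  have e2 : vol e a y c d = 0 := by rw [← vol_rotate_last, h1]
  have key := affine_cramer g e a b c d y
  rw [e1, e2, hc, hy] at key
  simp only [mul_zero, zero_mul, zero_add, add_zero] at key
  have e3 : vol e a b c y = 0 := (mul_eq_zero.1 key.symm).resolve_right hd
  have hs := vol_sum e a b c d y
  have h := vol_smul_eq e a b c d y
  rw [e1, e2, e3] at h hs
  simp only [zero_add, add_zero, zero_smul] at h hs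
  rw [hs] at h
  exact (smul_right_injective _ hD) h

theorem exists_zero_between {g : E3 →ᵃ[ℝ] ℝ} {a b : E3} (ha : g a < 0) (hb : 0 ≤ g b) :
    ∃ t : ℝ, 0 < t ∧ t ≤ 1 ∧ g (a + t • (b - a)) = 0 := by
  have h : 0 < g b - g a := by linarith
  refine ⟨-g a / (g b - g a), div_pos (by linarith) h, (div_le_one h).2 (by linarith), ?_⟩
  rw [map_add_smul_sub]
  field_simp
  ring

theorem cupolaRegion_of_mem_convexHull {e : ℝ} {m : ℕ} {A B : Fin 3 → E3} {p : Fin 3 → ℕ → E3}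
    {s : Set E3} (hs : s ⊆ cupolaRegion e m A B p) {x : E3} (hx : x ∈ convexHull ℝ s) :
    x ∈ cupolaRegion e m A B p := by
  refine ⟨fun i => ?_, fun i k hk => ?_, fun i k hk => ?_⟩
  · exact nonneg_of_mem_convexHull (f := volMap e _ _ _) (fun y hy => (hs hy).1 i) hx
  · exact nonneg_of_mem_convexHull (f := volMap e _ _ _) (fun y hy => (hs hy).2.1 i k hk) hx
  · have := nonneg_of_mem_convexHull (f := -volMap e (B i) (p i k) (p i (k + 1)))
      (fun y hy => by simpa using (hs hy).2.2 i k hk) hx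
    simpa using this

/-- The sign conditions satisfied by a cupola that is attached to a polytope over the facet with
vertices `f`, and a vertex `v` of that polytope in the interior of the visibility cone. -/
structure AttachedSigns (e : ℝ) (m : ℕ) (A B : Fin 3 → E3) (p : Fin 3 → ℕ → E3) (v : E3)
    (f : Fin 3 → E3) : Prop extends CupolaSigns e m A B p v where
  vertices_region : chainVertices m p ⊆ cupolaRegion e m A B p
  facet_region : ∀ j, f j ∈ cupolaRegion e m A B p
  facet_bottom : ∀ j, vol e (A 0) (A 1) (A 2) (f j) ≤ 0
  region_bottom : ∀ x ∈ cupolaRegion e m A B p, vol e (A 0) (A 1) (A 2) x = 0 →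
    x ∈ convexHull ℝ (range A)
  facet_pos : 0 < vol e v (f 0) (f 1) (f 2)
  cone : ∀ x ∈ chainVertices m p, 0 ≤ vol e v (f 0) (f 1) x ∧ 0 ≤ vol e v (f 1) (f 2) x ∧
    0 ≤ vol e v (f 2) (f 0) x ∧ 0 ≤ vol e (f 0) (f 1) (f 2) x

/-- The points whose convex hull is to be triangulated. -/
def attachedPoints (m : ℕ) (p : Fin 3 → ℕ → E3) (v : E3) (f : Fin 3 → E3) : Set E3 :=
  insert v (range f ∪ chainVertices m p)

theorem finite_attachedPoints (m : ℕ) (p : Fin 3 → ℕ → E3) (v : E3) (f : Fin 3 → E3) :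
    (attachedPoints m p v f).Finite := by
  refine Set.Finite.insert _ ((finite_range f).union ?_)
  refine (finite_range fun x : Fin 3 × Fin (m + 2) => p x.1 x.2).subset ?_
  rintro x ⟨i, k, hk, rfl⟩
  exact ⟨(i, ⟨k, by omega⟩), rfl⟩

/-- The vertices of the bottom facet. -/
noncomputable def bottomVertices (A : Fin 3 → E3) : Finset E3 := {A 0, A 1, A 2}

/-- The vertices visible from `v` that lie on the bottom side of the cupola. -/
noncomputable def outerVertices (m : ℕ) (A : Fin 3 → E3) (p : Fin 3 → ℕ → E3) (v : E3)
    (f : Fin 3 → E3) : Finset E3 :=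
  bottomVertices A ∪ (Finset.univ.image f).filter
    fun x => x ∈ (convexHull ℝ (attachedPoints m p v f)).extremePoints ℝ

theorem mem_bottomVertices {A : Fin 3 → E3} {x : E3} : x ∈ bottomVertices A ↔ ∃ i, x = A i := by
  simp [bottomVertices, Fin.exists_fin_succ]

theorem coe_bottomVertices (A : Fin 3 → E3) : (bottomVertices A : Set E3) = range A := by
  ext x; simp [mem_bottomVertices, eq_comm]

/-! ### Extreme points of the hull and compatibility of far and inner tetrahedra -/

namespace AttachedSigns

variable {e : ℝ} {m : ℕ} {A B : Fin 3 → E3} {p : Fin 3 → ℕ → E3} {v : E3} {f : Fin 3 → E3}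

theorem points_subset_region (H : AttachedSigns e m A B p v f) :
    attachedPoints m p v f ⊆ cupolaRegion e m A B p := by
  rintro x (rfl | ⟨j, rfl⟩ | hx)
  exacts [H.v_region, H.facet_region j, H.vertices_region hx]

theorem mem_region (H : AttachedSigns e m A B p v f) {x : E3}
    (hx : x ∈ convexHull ℝ (attachedPoints m p v f)) : x ∈ cupolaRegion e m A B p :=
  cupolaRegion_of_mem_convexHull H.points_subset_region hx

theorem vol_v_A_A_A (H : AttachedSigns e m A B p v f) (i : Fin 3) :
    0 < vol e v (A i) (A (i + 1)) (A (i + 2)) := by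
  have := H.v_bottom i
  have e1 : vol e v (A i) (A (i + 1)) (A (i + 2)) = -vol e (A i) (A (i + 1)) (A (i + 2)) v := by
    simp only [vol, det3, PiLp.sub_apply]; ring
  linarith

theorem vol_f_f_f_v (H : AttachedSigns e m A B p v f) : vol e (f 0) (f 1) (f 2) v < 0 := by
  have := H.facet_pos
  have e1 : vol e v (f 0) (f 1) (f 2) = -vol e (f 0) (f 1) (f 2) v := by
    simp only [vol, det3, PiLp.sub_apply]; ring
  linarith

theorem p_mem_hull (H : AttachedSigns e m A B p v f) {i : Fin 3} {k : ℕ} (hk : k ≤ m + 1) :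
    p i k ∈ convexHull ℝ (attachedPoints m p v f) :=
  subset_convexHull _ _ (Or.inr (Or.inr (H.p_mem i hk)))

/-- The sum of the two facet inequalities at a chain edge and of a third valid inequality `g`
exposes the single point `c`. -/
theorem p_extreme_of_functional (H : AttachedSigns e m A B p v f) {i : Fin 3} {k : ℕ} (hk : k ≤ m)
    {c d : E3} (hcd : c = p i k ∧ d = p i (k + 1) ∨ c = p i (k + 1) ∧ d = p i k)
    {g : E3 →ᵃ[ℝ] ℝ} (hg : ∀ x ∈ cupolaRegion e m A B p, 0 ≤ g x) (hc : g c = 0) (hd : g d ≠ 0) :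
    c ∈ (convexHull ℝ (attachedPoints m p v f)).extremePoints ℝ := by
  have hval : ∀ y, (volMap e (A (i + 1)) (p i k) (p i (k + 1))
      + -volMap e (B i) (p i k) (p i (k + 1)) + g) y = vol e (A (i + 1)) (p i k) (p i (k + 1)) y
        - vol e (B i) (p i k) (p i (k + 1)) y + g y := fun y => by simp; ring
  refine mem_extremePoints_of_zeros (g := volMap e (A (i + 1)) (p i k) (p i (k + 1))
      + -volMap e (B i) (p i k) (p i (k + 1)) + g) ?_ ?_ ?_ ?_
  · intro y hy
    have hr := H.mem_region hy
    have := hr.2.1 i k hk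
    have := hr.2.2 i k hk
    have := hg y hr
    rw [hval]; linarith
  · rcases hcd with ⟨rfl, -⟩ | ⟨rfl, -⟩
    exacts [H.p_mem_hull (by omega), H.p_mem_hull (by omega)]
  · rw [hval, hc]
    rcases hcd with ⟨rfl, -⟩ | ⟨rfl, -⟩ <;> simp [vol_self₂₄, vol_self₃₄]
  · intro y hy h0
    have hr := H.mem_region hy
    have h1 := hr.2.1 i k hk
    have h2 := hr.2.2 i k hk
    have h3 := hg y hr
    rw [hval] at h0
    have z1 : vol e (A (i + 1)) (p i k) (p i (k + 1)) y = 0 := by linarith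
    have z2 : vol e (B i) (p i k) (p i (k + 1)) y = 0 := by linarith
    have z3 : g y = 0 := by linarith
    have hD := (H.vol_B_A_p_succ i hk).ne
    rcases hcd with ⟨rfl, rfl⟩ | ⟨rfl, rfl⟩
    · exact eq_of_three_zeros hD z2 z1 hc hd z3
    · refine eq_of_three_zeros (e := e) (a := B i) (b := A (i + 1)) (d := p i k) ?_ ?_ ?_ hc hd z3
      · rw [vol_swap₃₄]; exact neg_ne_zero.2 hD
      · rw [vol_swap₂₃, z2, neg_zero]
      · rw [vol_swap₂₃, z1, neg_zero]

/-- The third facet is the preceding one at `B i` for an inner chain vertex, the first facet at `B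
(i + 1)` for the last vertex, and the last facet at `A i` of chain `i + 2` for the first. None of
these inequalities is lost by adding `v` and `F`. -/
theorem p_extreme (H : AttachedSigns e m A B p v f) (i : Fin 3) {k : ℕ} (hk : k ≤ m + 1) :
    p i k ∈ (convexHull ℝ (attachedPoints m p v f)).extremePoints ℝ := by
  rcases Nat.lt_or_ge m k with hm | hm
  · obtain rfl : k = m + 1 := by omega
    refine H.p_extreme_of_functional (k := m) le_rfl (Or.inr ⟨rfl, rfl⟩)
      (g := -volMap e (B (i + 1)) (p (i + 1) 0) (p (i + 1) (0 + 1)))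
      (fun x hx => by simpa using hx.2.2 (i + 1) 0 (by omega)) ?_ ?_
    · rw [H.last]; simp [vol_self₁₄]
    · have := H.facetB (i + 1) 0 (by omega) (p i m) (H.p_mem i (by omega))
        (H.p_ne_B (by omega) (Or.inr (by omega))) (H.p_ne (by omega) (by omega) (Or.inl (by simp)))
        (H.p_ne (by omega) (by omega) (Or.inl (by simp)))
      simpa using this.ne
  · rcases Nat.eq_zero_or_pos k with rfl | hk0
    · refine H.p_extreme_of_functional (k := 0) hm (Or.inl ⟨rfl, rfl⟩)
        (g := volMap e (A (i + 2 + 1)) (p (i + 2) m) (p (i + 2) (m + 1)))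
        (fun x hx => by simpa using hx.2.1 (i + 2) m le_rfl) ?_ ?_
      · rw [H.zero, fin3_add_two_add_one]; simp [vol_self₁₄]
      · have := H.facetA (i + 2) m le_rfl (p i 1) (H.p_mem i (by omega))
          (H.p_ne_A (by omega) (Or.inr (by omega)))
          (H.p_ne (by omega) (by omega) (Or.inl (by simp)))
          (H.p_ne (by omega) (by omega) (Or.inl (by simp)))
        simpa using this.ne'
    · obtain ⟨k, rfl⟩ : ∃ l, k = l + 1 := ⟨k - 1, by omega⟩
      refine H.p_extreme_of_functional (k := k + 1) hm (Or.inl ⟨rfl, rfl⟩)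
        (g := -volMap e (B i) (p i k) (p i (k + 1)))
        (fun x hx => by simpa using hx.2.2 i k (by omega)) ?_ ?_
      · simp [vol_self₃₄]
      · by_cases hB : p i (k + 1 + 1) = B i
        · exact absurd hB (H.p_ne_B (by omega) (Or.inl (by simp)))
        have := H.facetB i k (by omega) (p i (k + 1 + 1)) (H.p_mem i (by omega)) hB
          (H.p_ne (by omega) (by omega) (Or.inr (by omega)))
          (H.p_ne (by omega) (by omega) (Or.inr (by omega)))
        simpa using this.ne

theorem A_extreme (H : AttachedSigns e m A B p v f) (i : Fin 3) :
    A i ∈ (convexHull ℝ (attachedPoints m p v f)).extremePoints ℝ :=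
  H.zero i ▸ H.p_extreme i (by omega)

theorem B_extreme (H : AttachedSigns e m A B p v f) (i : Fin 3) :
    B i ∈ (convexHull ℝ (attachedPoints m p v f)).extremePoints ℝ :=
  H.B_eq i ▸ H.p_extreme _ le_rfl

theorem cone_of_mem (H : AttachedSigns e m A B p v f) {x : E3}
    (hx : x ∈ attachedPoints m p v f) : 0 ≤ vol e v (f 0) (f 1) x ∧ 0 ≤ vol e v (f 1) (f 2) x ∧
      0 ≤ vol e v (f 2) (f 0) x := by
  have h0 := H.facet_pos
  have h1 : vol e v (f 1) (f 2) (f 0) = vol e v (f 0) (f 1) (f 2) := vol_rotate_last _ _ _ _ _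
  have h2 : vol e v (f 2) (f 0) (f 1) = vol e v (f 0) (f 1) (f 2) := by
    rw [vol_rotate_last, vol_rotate_last]
  rcases hx with rfl | ⟨j, rfl⟩ | hx
  · simp [vol_self₁₄]
  · fin_cases j <;> simp [vol_self₂₄, vol_self₃₄, h1, h2, h0.le]
  · exact ⟨(H.cone x hx).1, (H.cone x hx).2.1, (H.cone x hx).2.2.1⟩

/-- The hull lies in the cone over `F` with apex `v`. This cone is pointed, and the sum of its three
inequalities exposes the apex. -/
theorem v_extreme (H : AttachedSigns e m A B p v f) :
    v ∈ (convexHull ℝ (attachedPoints m p v f)).extremePoints ℝ := by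
  have hcone : ∀ y ∈ convexHull ℝ (attachedPoints m p v f), 0 ≤ vol e v (f 0) (f 1) y ∧
      0 ≤ vol e v (f 1) (f 2) y ∧ 0 ≤ vol e v (f 2) (f 0) y := fun y hy =>
    ⟨nonneg_of_mem_convexHull (f := volMap e _ _ _) (fun z hz => (H.cone_of_mem hz).1) hy,
      nonneg_of_mem_convexHull (f := volMap e _ _ _) (fun z hz => (H.cone_of_mem hz).2.1) hy,
      nonneg_of_mem_convexHull (f := volMap e _ _ _) (fun z hz => (H.cone_of_mem hz).2.2) hy⟩
  refine mem_extremePoints_of_zeros (g := volMap e v (f 0) (f 1) + volMap e v (f 1) (f 2)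
    + volMap e v (f 2) (f 0)) (fun y hy => ?_) (subset_convexHull _ _ (Or.inl rfl))
    (by simp [vol_self₁₄]) (fun y hy h0 => ?_)
  · obtain ⟨h1, h2, h3⟩ := hcone y hy
    simpa using by linarith
  · obtain ⟨h1, h2, h3⟩ := hcone y hy
    simp only [AffineMap.coe_add, Pi.add_apply, volMap_apply] at h0
    have z1 : vol e v (f 0) (f 1) y = 0 := by linarith
    have z2 : vol e v y (f 1) (f 2) = 0 := by rw [← vol_rotate_last]; linarith
    have z3 : vol e v (f 0) y (f 2) = 0 := by rw [vol_rotate_last]; linarith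
    have := vol_smul_sub_eq e v (f 0) (f 1) (f 2) y
    rw [z1, z2, z3] at this
    simp only [zero_smul, add_zero, smul_eq_zero] at this
    exact sub_eq_zero.1 (this.resolve_left H.facet_pos.ne')

theorem outer_extreme (H : AttachedSigns e m A B p v f) {w : E3}
    (hw : w ∈ outerVertices m A p v f) :
    w ∈ (convexHull ℝ (attachedPoints m p v f)).extremePoints ℝ := by
  rcases Finset.mem_union.1 hw with hw | hw
  · obtain ⟨i, rfl⟩ := mem_bottomVertices.1 hw
    exact H.A_extreme i
  · exact (Finset.mem_filter.1 hw).2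

/-- A vertex of `F` in the bottom plane would be in the bottom facet; being extreme in the hull, it
would be one of the `A i`. -/
theorem outer_bottom (H : AttachedSigns e m A B p v f) {w : E3}
    (hw : w ∈ outerVertices m A p v f) (hwA : w ∉ bottomVertices A) :
    vol e (A 0) (A 1) (A 2) w < 0 := by
  have hex := H.outer_extreme hw
  rcases Finset.mem_union.1 hw with h | h
  · exact absurd h hwA
  obtain ⟨j, -, rfl⟩ := Finset.mem_image.1 (Finset.mem_filter.1 h).1
  refine lt_of_le_of_ne (H.facet_bottom j) fun h0 => hwA ?_
  have h1 := H.region_bottom _ (H.facet_region j) h0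
  have hsub : convexHull ℝ (range A) ⊆ convexHull ℝ (attachedPoints m p v f) :=
    convexHull_mono (by rintro _ ⟨i, rfl⟩; exact Or.inr (Or.inr (H.A_mem i)))
  have h2 := inter_extremePoints_subset_extremePoints_of_subset hsub ⟨h1, hex⟩
  have h3 := extremePoints_convexHull_subset h2
  rwa [← coe_bottomVertices] at h3

theorem A_mem_outer (A : Fin 3 → E3) (i : Fin 3) : A i ∈ outerVertices m A p v f :=
  Finset.mem_union_left _ (mem_bottomVertices.2 ⟨i, rfl⟩)

variable {h : E3 → ℝ}

/-- The remaining outer vertices are strictly on the side of `v` of the bottom plane, and the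
perturbation preserves this. -/
theorem isFar_bottomVertices (H : AttachedSigns e m A B p v f)
    (hh : GenericHeights e v (outerVertices m A p v f) h) :
    IsFar e v h (outerVertices m A p v f) (bottomVertices A) := by
  refine ⟨A 0, A 1, A 2, rfl, A_mem_outer A 0, A_mem_outer A 1, A_mem_outer A 2,
    H.vol_v_A_A_A 0, fun w hw => ?_⟩
  by_cases hwA : w ∈ bottomVertices A
  · obtain ⟨i, rfl⟩ := mem_bottomVertices.1 hwA
    refine le_of_eq ?_
    fin_cases i <;> simp [lift, vol_self₂₃, vol_self₂₄, vol_self₃₄]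
  · refine hh.of_pos _ (A_mem_outer A 0) _ (A_mem_outer A 1) _ (A_mem_outer A 2) w hw ?_
    rw [lift_one]
    have := H.outer_bottom hw hwA
    have e1 : vol e w (A 0) (A 1) (A 2) = -vol e (A 0) (A 1) (A 2) w := by
      simp only [vol, det3, PiLp.sub_apply]; ring
    linarith

/-- From `v`, each `B i` is a conic combination of the three `A j` with all coefficients positive,
so one strict inequality among the `A j` suffices. -/
theorem lt_B (H : AttachedSigns e m A B p v f) {l l' : E3 →ᵃ[ℝ] ℝ} (hl : l v = 0) (hl' : l' v = 0)
    (hle : ∀ j, l (A j) ≤ l' (A j)) (hlt : ∃ j, l (A j) < l' (A j)) (i : Fin 3) :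
    l (B i) < l' (B i) := by
  have c0 : 0 < vol e v (B i) (A 1) (A 2) := by
    rw [← vol_rotate_last]; exact H.vol_v_A_A_B i 1
  have c1 : 0 < vol e v (A 0) (B i) (A 2) := by
    rw [vol_rotate_last]; exact H.vol_v_A_A_B i 2
  have c2 : 0 < vol e v (A 0) (A 1) (B i) := H.vol_v_A_A_B i 0
  have hD : 0 < vol e v (A 0) (A 1) (A 2) := H.vol_v_A_A_A 0
  have key := affine_cramer (l' - l) e v (A 0) (A 1) (A 2) (B i)
  simp only [AffineMap.coe_sub, Pi.sub_apply, hl, hl', sub_zero, mul_zero, zero_add] at key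
  have n0 := mul_nonneg c0.le (sub_nonneg.2 (hle 0))
  have n1 := mul_nonneg c1.le (sub_nonneg.2 (hle 1))
  have n2 := mul_nonneg c2.le (sub_nonneg.2 (hle 2))
  have hpos : 0 < vol e v (A 0) (A 1) (A 2) * (l' (B i) - l (B i)) := by
    rw [key]
    obtain ⟨j, hj⟩ := hlt
    fin_cases j
    · have := mul_pos c0 (sub_pos.2 hj)
      simp only [Fin.zero_eta] at this; linarith
    · have := mul_pos c1 (sub_pos.2 hj)
      simp only [Fin.mk_one] at this; linarith
    · have := mul_pos c2 (sub_pos.2 hj)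
      simp only [Fin.reduceFinMk] at this; linarith
  exact sub_pos.1 (pos_of_mul_pos_right hpos hD.le)

theorem card_eq_three {W T : Finset E3} (hT : IsFar e v h W T) : T.card = 3 := by
  obtain ⟨a, b, c, rfl, -, -, -, hD, -⟩ := hT
  rw [Finset.card_eq_three]
  refine ⟨a, b, c, ?_, ?_, ?_, rfl⟩
  · rintro rfl; simp [vol_self₂₃] at hD
  · rintro rfl; simp [vol_self₂₄] at hD
  · rintro rfl; simp [vol_self₃₄] at hD

theorem exists_A_notMem (H : AttachedSigns e m A B p v f)
    (hh : GenericHeights e v (outerVertices m A p v f) h) {T : Finset E3}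
    (hT : IsFar e v h (outerVertices m A p v f) T) (hTA : T ≠ bottomVertices A) :
    ∃ j, A j ∉ T := by
  by_contra! hc
  refine hTA (Finset.eq_of_subset_of_card_le (fun x hx => ?_) ?_).symm
  · obtain ⟨i, rfl⟩ := mem_bottomVertices.1 hx
    exact hc i
  · rw [card_eq_three hT, card_eq_three (H.isFar_bottomVertices hh)]

/-- For simplices with apex `v`, compare the dual functionals of the far triangle and of the bottom
triangle. On the `A j` the first is at most the second, with equality only on the far triangle, and
on the `B j` it is strictly smaller. Chain simplices are separated from the far ones by the bottom
plane. -/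
theorem meet_far_inner (H : AttachedSigns e m A B p v f)
    (hh : GenericHeights e v (outerVertices m A p v f) h) {T t : Finset E3}
    (hT : IsFar e v h (outerVertices m A p v f) T) (hTA : T ≠ bottomVertices A)
    (ht : t ∈ innerTets m A B p v) : MeetInFace (insert v T) t := by
  obtain ⟨l, hl, hlT, hlW, hlm⟩ := hT.exists_functional hh
  obtain ⟨l', hl', hlT', hlW', hlm'⟩ := (H.isFar_bottomVertices hh).exists_functional hh
  have hA' : ∀ j, l' (A j) = h (A j) := fun j => hlT' _ (mem_bottomVertices.2 ⟨j, rfl⟩)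
  have hA : ∀ j, l (A j) ≤ l' (A j) := fun j => by rw [hA']; exact hlW _ (A_mem_outer A j)
  have hlt : ∃ j, l (A j) < l' (A j) := by
    obtain ⟨j, hj⟩ := H.exists_A_notMem hh hT hTA
    refine ⟨j, lt_of_le_of_ne (hA j) fun h0 => hj (hlm _ (A_mem_outer A j) ?_)⟩
    rw [h0, hA']
  have hB := H.lt_B hl hl' hA hlt
  have key : ∀ s : Finset E3, (∀ x ∈ s, (∃ j, x = A j) ∨ ∃ j, x = B j) →
      MeetInFace (insert v T) (insert v s) := by
    intro s hs
    refine meetInFace_of_lifting hl hl' (fun x hx => ?_) (fun x hx => ?_) fun x hx h0 => ?_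
    · rw [hlT x hx]; exact hlW' x (hT.subset hx)
    · rcases hs x hx with ⟨j, rfl⟩ | ⟨j, rfl⟩
      exacts [hA j, (hB j).le]
    · rcases hs x hx with ⟨j, rfl⟩ | ⟨j, rfl⟩
      · exact hlm _ (A_mem_outer A j) (by rw [h0, hA'])
      · exact absurd h0 (hB j).ne
  rcases mem_innerTets.1 ht with rfl | ⟨i, rfl⟩ | ⟨i, rfl⟩ | ⟨i, k, hk, rfl⟩
  · exact key {B 0, B 1, B 2} (by simp)
  · exact key {A i, A (i + 1), B i} (by simp)
  · exact key {A (i + 1), B (i + 1), B i} (by simp)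
  · have hAr : ∀ {x}, x ∈ chainVertices m p → 0 ≤ vol e (A 0) (A 1) (A 2) x ∧
        (vol e (A 0) (A 1) (A 2) x = 0 → x ∈ bottomVertices A) := by
      intro x hx
      by_cases hxA : x ∈ bottomVertices A
      · refine ⟨?_, fun _ => hxA⟩
        obtain ⟨i, rfl⟩ := mem_bottomVertices.1 hxA
        fin_cases i <;> simp [vol_self₁₄, vol_self₂₄, vol_self₃₄]
      · have hne : ∀ i, x ≠ A i := fun i hi => hxA (mem_bottomVertices.2 ⟨i, hi⟩)
        have := H.bottom 0 x hx (hne _) (hne _) (hne _)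
        exact ⟨this.le, fun h0 => absurd h0 this.ne'⟩
    refine MeetInFace.symm (convexHull_inter_of_separated (volMap e (A 0) (A 1) (A 2))
      (r := bottomVertices A)
      (affineIndependent_coe_three (d := v) (H.v_bottom 0).ne) (fun x hx => ?_) fun x hx => ?_)
    · simp only [chainTet, Finset.mem_insert, Finset.mem_singleton] at hx
      rcases hx with rfl | rfl | rfl | rfl
      exacts [hAr (H.B_mem _), hAr (H.A_mem _), hAr (H.p_mem i (by omega)),
        hAr (H.p_mem i (by omega))]
    · rcases Finset.mem_insert.1 hx with rfl | hx
      · exact ⟨(H.v_bottom 0).le, fun h0 => absurd h0 (H.v_bottom 0).ne⟩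
      · by_cases hxA : x ∈ bottomVertices A
        · refine ⟨?_, fun _ => hxA⟩
          obtain ⟨i, rfl⟩ := mem_bottomVertices.1 hxA
          exact le_of_eq (by fin_cases i <;> simp [vol_self₁₄, vol_self₂₄, vol_self₃₄])
        · have := H.outer_bottom (hT.subset hx) hxA
          exact ⟨this.le, fun h0 => absurd h0 this.ne⟩

end AttachedSigns

/-- The simplices with apex `v` over the far triangles other than the bottom facet. -/
noncomputable def farTriangles (e : ℝ) (m : ℕ) (A : Fin 3 → E3) (p : Fin 3 → ℕ → E3) (v : E3)
    (f : Fin 3 → E3) (h : E3 → ℝ) : Finset (Finset E3) :=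
  (outerVertices m A p v f).powerset.filter
    fun T => IsFar e v h (outerVertices m A p v f) T ∧ T ≠ bottomVertices A

theorem triple_congr {a b a' b' : E3} (h : ({a', b'} : Finset E3) = {a, b}) (c : E3) :
    ({a', b', c} : Finset E3) = {a, b, c} := by
  have := congrArg (· ∪ {c}) h
  simpa only [Finset.insert_union, Finset.singleton_union] using this

theorem exists_triple_of_card_inter {s T : Finset E3} (hT : T.card = 3) (hs : (T ∩ s).card = 2) :
    ∃ a b d, a ≠ b ∧ d ≠ a ∧ d ≠ b ∧ T ∩ s = {a, b} ∧ T = {a, b, d} ∧ d ∉ s := by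
  obtain ⟨a, b, hab, h⟩ := Finset.card_eq_two.1 hs
  have h1 : (T \ s).card = 1 := by
    have := Finset.card_inter_add_card_sdiff T s
    omega
  obtain ⟨d, hd⟩ := Finset.card_eq_one.1 h1
  have hd' : d ∈ T \ s := by simp [hd]
  have hds := (Finset.mem_sdiff.1 hd').2
  have ha : a ∈ T ∩ s := by simp [h]
  have hb : b ∈ T ∩ s := by simp [h]
  refine ⟨a, b, d, hab, ?_, ?_, h, ?_, hds⟩
  · rintro rfl; exact hds (Finset.mem_inter.1 ha).2
  · rintro rfl; exact hds (Finset.mem_inter.1 hb).2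
  · have : T ∩ s ∪ T \ s = T := by
      ext x; simp only [Finset.mem_union, Finset.mem_inter, Finset.mem_sdiff]; tauto
    rw [← this, h, hd]
    ext x
    simp only [Finset.mem_union, Finset.mem_insert, Finset.mem_singleton, or_assoc]

/-! ### Counting far triangles -/

namespace AttachedSigns

variable {e : ℝ} {m : ℕ} {A B : Fin 3 → E3} {p : Fin 3 → ℕ → E3} {v : E3} {f : Fin 3 → E3}
  {h : E3 → ℝ}

theorem outer_eq_A_or_f {w : E3} (hw : w ∈ outerVertices m A p v f) (hwA : w ∉ bottomVertices A) :
    w ∈ Finset.univ.image f := by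
  rcases Finset.mem_union.1 hw with h | h
  · exact absurd h hwA
  · exact (Finset.mem_filter.1 h).1

/-- Such a triangle is determined by the bottom edge it contains: the bottom triangle is far and
occupies one side of the edge, which leaves room for one triangle on the other. -/
theorem card_far_two (H : AttachedSigns e m A B p v f)
    (hh : GenericHeights e v (outerVertices m A p v f) h) :
    ((farTriangles e m A p v f h).filter fun T => (T ∩ bottomVertices A).card = 2).card ≤ 3 := by
  have hAF := H.isFar_bottomVertices hh
  have hc : ((bottomVertices A).powersetCard 2).card = 3 := by
    rw [Finset.card_powersetCard, card_eq_three hAF]; rfl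
  refine le_of_le_of_eq ?_ hc
  refine Finset.card_le_card_of_injOn (fun T => T ∩ bottomVertices A) (fun T hT => ?_) ?_
  · simp only [Finset.coe_filter, mem_ofPred_eq] at hT
    simp [Finset.mem_powersetCard, hT.2]
  · intro T hT T' hT' heq
    simp only [Finset.coe_filter, mem_ofPred_eq, farTriangles, Finset.mem_filter] at hT hT' heq
    obtain ⟨⟨-, hfar, -⟩, hcard⟩ := hT
    obtain ⟨⟨-, hfar', -⟩, hcard'⟩ := hT'
    obtain ⟨a, b, d, hab, hda, hdb, hi, rfl, hd⟩ :=
      exists_triple_of_card_inter (card_eq_three hfar) hcard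
    obtain ⟨a', b', d', hab', hda', hdb', hi', rfl, hd'⟩ :=
      exists_triple_of_card_inter (card_eq_three hfar') hcard'
    have hpair : ({a', b'} : Finset E3) = {a, b} := by rw [← hi, ← hi', heq]
    have hT'eq : ({a', b', d'} : Finset E3) = {a, b, d'} := triple_congr hpair d'
    have hd'a : d' ≠ a := by
      rintro rfl
      have : d' ∈ ({a', b'} : Finset E3) := by simp [hpair]
      simp [hda', hdb'] at this
    have hd'b : d' ≠ b := by
      rintro rfl
      have : d' ∈ ({a', b'} : Finset E3) := by simp [hpair]
      simp [hda', hdb'] at this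
    rw [hT'eq] at hfar' ⊢
    have hsub : (bottomVertices A ∩ {a, b, d}).card = 2 := by rw [Finset.inter_comm]; exact hcard
    obtain ⟨a₁, b₁, c, -, hca, hcb, hi₁, hA, hcT⟩ :=
      exists_triple_of_card_inter (card_eq_three hAF) hsub
    rw [Finset.inter_comm, hi] at hi₁
    have hA' : bottomVertices A = {a, b, c} := by
      rw [hA, triple_congr hi₁.symm]
    simp only [Finset.mem_insert, Finset.mem_singleton, not_or] at hcT
    have hcA : c ∈ bottomVertices A := by simp [hA']
    rw [hA'] at hAF
    have n0 := hAF.vol_ne_zero hab (Ne.symm hcT.1) (Ne.symm hcT.2.1)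
    have n1 := hfar.vol_ne_zero hab hda.symm hdb.symm
    have n2 := hfar'.vol_ne_zero hab hd'a.symm hd'b.symm
    have o1 : vol e v a b c * vol e v a b d < 0 := by
      refine lt_of_le_of_ne (not_lt.1 fun hp => hd ?_) (mul_ne_zero n0 n1)
      rw [hAF.eq_of_edge hh hfar hda hdb hp]; exact hcA
    have o2 : vol e v a b c * vol e v a b d' < 0 := by
      refine lt_of_le_of_ne (not_lt.1 fun hp => hd' ?_) (mul_ne_zero n0 n2)
      rw [hAF.eq_of_edge hh hfar' hd'a hd'b hp]; exact hcA
    have o3 : 0 < vol e v a b d * vol e v a b d' := by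
      have h1 := mul_pos_of_neg_of_neg o1 o2
      have h2 : vol e v a b c * vol e v a b d * (vol e v a b c * vol e v a b d')
        = (vol e v a b c * vol e v a b c) * (vol e v a b d * vol e v a b d') := by ring
      rw [h2] at h1
      exact pos_of_mul_pos_right h1 (mul_self_nonneg _)
    rw [hfar.eq_of_edge hh hfar' hd'a hd'b o3]

/-- The bottom triangle lies in the cone from `v` over `F`, and the planes in question bound that
cone. -/
theorem vol_f_f_A (H : AttachedSigns e m A B p v f) {x y : E3} (hx : x ∈ Finset.univ.image f)
    (hy : y ∈ Finset.univ.image f) :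
    (∀ i, 0 ≤ vol e v x y (A i)) ∨ ∀ i, vol e v x y (A i) ≤ 0 := by
  obtain ⟨j, -, rfl⟩ := Finset.mem_image.1 hx
  obtain ⟨k, -, rfl⟩ := Finset.mem_image.1 hy
  have hc := fun i => H.cone _ (H.A_mem i)
  have hs : ∀ a b i, vol e v a b (A i) = -vol e v b a (A i) := fun a b i => vol_swap₂₃ _ _ _ _ _
  fin_cases j <;> fin_cases k
  · exact Or.inl fun i => (vol_self₂₃ _ _ _ _).ge
  · exact Or.inl fun i => (hc i).1
  · exact Or.inr fun i => by rw [hs]; exact neg_nonpos.2 (hc i).2.2.1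
  · exact Or.inr fun i => by rw [hs]; exact neg_nonpos.2 (hc i).1
  · exact Or.inl fun i => (vol_self₂₃ _ _ _ _).ge
  · exact Or.inl fun i => (hc i).2.1
  · exact Or.inl fun i => (hc i).2.2.1
  · exact Or.inr fun i => by rw [hs]; exact neg_nonpos.2 (hc i).2.1
  · exact Or.inl fun i => (vol_self₂₃ _ _ _ _).ge

theorem card_image_f_le (f : Fin 3 → E3) : (Finset.univ.image f).card ≤ 3 :=
  Finset.card_image_le.trans (by simp)

/-- Such a triangle is determined by its two vertices of `F`: all the `A i` are on one side of the
plane through them and `v`, and each side of an edge carries one far triangle. -/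
theorem card_far_one (H : AttachedSigns e m A B p v f)
    (hh : GenericHeights e v (outerVertices m A p v f) h) :
    ((farTriangles e m A p v f h).filter fun T => (T ∩ bottomVertices A).card = 1).card ≤ 3 := by
  have hc : ((Finset.univ.image f).powersetCard 2).card ≤ 3 := by
    rw [Finset.card_powersetCard]
    exact (Nat.choose_le_choose 2 (card_image_f_le f)).trans (by decide)
  refine le_trans ?_ hc
  have hsd : ∀ {T : Finset E3}, IsFar e v h (outerVertices m A p v f) T →
      (T ∩ bottomVertices A).card = 1 → (T ∩ (T \ bottomVertices A)).card = 2 := by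
    intro T hT h1
    rw [Finset.inter_eq_right.2 Finset.sdiff_subset]
    have := Finset.card_inter_add_card_sdiff T (bottomVertices A)
    have := card_eq_three hT
    omega
  have hmem : ∀ {T : Finset E3}, IsFar e v h (outerVertices m A p v f) T →
      T \ bottomVertices A ⊆ Finset.univ.image f := by
    intro T hT x hx
    rw [Finset.mem_sdiff] at hx
    exact outer_eq_A_or_f (hT.subset hx.1) hx.2
  refine Finset.card_le_card_of_injOn (fun T => T \ bottomVertices A) (fun T hT => ?_) ?_
  · simp only [Finset.coe_filter, mem_ofPred_eq, farTriangles, Finset.mem_filter] at hT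
    have h2 := hsd hT.1.2.1 hT.2
    rw [Finset.inter_eq_right.2 Finset.sdiff_subset] at h2
    simp only [Finset.mem_coe, Finset.mem_powersetCard]
    exact ⟨hmem hT.1.2.1, h2⟩
  · intro T hT T' hT' heq
    simp only [Finset.coe_filter, mem_ofPred_eq, farTriangles, Finset.mem_filter] at hT hT' heq
    obtain ⟨⟨-, hfar, -⟩, hcard⟩ := hT
    obtain ⟨⟨-, hfar', -⟩, hcard'⟩ := hT'
    have hm := hmem hfar
    have hs' := hsd hfar' hcard'
    obtain ⟨a, b, d, hab, hda, hdb, hi, hTeq, hd⟩ :=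
      exists_triple_of_card_inter (card_eq_three hfar) (hsd hfar hcard)
    rw [Finset.inter_eq_right.2 Finset.sdiff_subset] at hi
    obtain ⟨a', b', d', hab', hda', hdb', hi', hTeq', hd'⟩ :=
      exists_triple_of_card_inter (card_eq_three hfar') hs'
    rw [Finset.inter_eq_right.2 Finset.sdiff_subset, ← heq, hi] at hi'
    have hT'eq : T' = {a, b, d'} := by rw [hTeq', triple_congr hi'.symm]
    have hdA : d ∈ bottomVertices A := by
      by_contra hn; exact hd (Finset.mem_sdiff.2 ⟨by simp [hTeq], hn⟩)
    have hdA' : d' ∈ bottomVertices A := by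
      by_contra hn; exact hd' (Finset.mem_sdiff.2 ⟨by simp [hTeq'], hn⟩)
    have ha : a ∈ T \ bottomVertices A := by simp [hi]
    have hb : b ∈ T \ bottomVertices A := by simp [hi]
    have hd'a : d' ≠ a := by rintro rfl; exact (Finset.mem_sdiff.1 ha).2 hdA'
    have hd'b : d' ≠ b := by rintro rfl; exact (Finset.mem_sdiff.1 hb).2 hdA'
    have haf := hm ha
    have hbf := hm hb
    rw [hTeq] at hfar ⊢
    rw [hT'eq] at hfar' ⊢
    have n1 := hfar.vol_ne_zero hab hda.symm hdb.symm
    have n2 := hfar'.vol_ne_zero hab hd'a.symm hd'b.symm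
    obtain ⟨i, rfl⟩ := mem_bottomVertices.1 hdA
    obtain ⟨i', rfl⟩ := mem_bottomVertices.1 hdA'
    have o3 : 0 < vol e v a b (A i) * vol e v a b (A i') := by
      refine lt_of_le_of_ne ?_ (mul_ne_zero n1 n2).symm
      rcases H.vol_f_f_A haf hbf with hs | hs
      exacts [mul_nonneg (hs i) (hs i'), mul_nonneg_of_nonpos_of_nonpos (hs i) (hs i')]
    rw [hfar.eq_of_edge hh hfar' hd'a hd'b o3]

/-- A far triangle without a vertex `A i` would consist of the vertices of `F`. Then `A 0` would be
on the side of `v` of the plane of `F`, and beyond it by attachment, hence in `F`. Being extreme, it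
would be a vertex of the triangle after all. -/
theorem far_inter_bottom_nonempty (H : AttachedSigns e m A B p v f)
    (hh : GenericHeights e v (outerVertices m A p v f) h) {T : Finset E3}
    (hT : IsFar e v h (outerVertices m A p v f) T) : (T ∩ bottomVertices A).Nonempty := by
  by_contra hne
  rw [Finset.not_nonempty_iff_eq_empty, ← Finset.disjoint_iff_inter_eq_empty,
    Finset.disjoint_left] at hne
  have hsub : T ⊆ Finset.univ.image f := fun x hx => outer_eq_A_or_f (hT.subset hx) (hne hx)
  have hTf : T = Finset.univ.image f := Finset.eq_of_subset_of_card_le hsub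
    ((card_image_f_le f).trans (card_eq_three hT).ge)
  have hfT : ∀ j, f j ∈ T := fun j => by rw [hTf]; simp
  obtain ⟨a, b, c, hTabc, ha, hb, hc, hD, hlift⟩ := hT
  have hzero : ∀ x ∈ T, volMap e a b c x = 0 := by
    intro x hx
    simp only [hTabc, Finset.mem_insert, Finset.mem_singleton] at hx
    rcases hx with rfl | rfl | rfl <;> simp [vol_self₁₄, vol_self₂₄, vol_self₃₄]
  have key := vol_mul_affine_eq (e := e) (hzero _ (hfT 0)) (hzero _ (hfT 1)) (hzero _ (hfT 2)) v
    (A 0)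
  have hrev : ∀ x, volMap e a b c x = -vol e x a b c := fun x => by
    simp only [volMap_apply, vol, det3, PiLp.sub_apply]; ring
  rw [hrev, hrev] at key
  have hA := hh.of_nonneg a ha b hb c hc _ (A_mem_outer A 0) (hlift _ (A_mem_outer A 0))
  rw [lift_one] at hA
  have hcone := H.cone _ (H.A_mem 0)
  have hv := H.vol_f_f_f_v
  have z : vol e (f 0) (f 1) (f 2) (A 0) = 0 := by
    refine le_antisymm ?_ hcone.2.2.2
    have h1 := mul_nonneg_of_nonpos_of_nonpos hv.le (neg_nonpos.2 hA)
    by_contra hn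
    have := mul_pos (not_le.1 hn) hD
    linarith
  have h4 : A 0 ∈ convexHull ℝ ({v, f 0, f 1, f 2} : Set E3) := by
    refine mem_convexHull_four H.facet_pos ?_ ?_ ?_ hcone.1
    · rw [show vol e (A 0) (f 0) (f 1) (f 2) = -vol e (f 0) (f 1) (f 2) (A 0) by
        simp only [vol, det3, PiLp.sub_apply]; ring, z, neg_zero]
    · rw [← vol_rotate_last]; exact hcone.2.1
    · rw [vol_rotate_last]; exact hcone.2.2.1
  have h5 := mem_convexHull_zeros (s := {v, f 0, f 1, f 2}) (f := -volMap e (f 0) (f 1) (f 2))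
    (fun y hy => by
      simp only [Finset.mem_insert, Finset.mem_singleton] at hy
      rcases hy with rfl | rfl | rfl | rfl <;>
        simp [vol_self₁₄, vol_self₂₄, vol_self₃₄, hv.le]) (x := A 0) (by simpa using h4)
    (by simp [z])
  have h6 : A 0 ∈ convexHull ℝ (range f) := by
    refine convexHull_mono (fun y hy => ?_) h5
    simp only [Finset.coe_filter, Finset.mem_insert, Finset.mem_singleton, mem_ofPred_eq] at hy
    obtain ⟨rfl | rfl | rfl | rfl, hy⟩ := hy
    · simp [hv.ne] at hy
    all_goals exact mem_range_self _
  have hsubQ : convexHull ℝ (range f) ⊆ convexHull ℝ (attachedPoints m p v f) :=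
    convexHull_mono fun y hy => Or.inr (Or.inl hy)
  obtain ⟨j, hj⟩ := extremePoints_convexHull_subset
    (inter_extremePoints_subset_extremePoints_of_subset hsubQ ⟨h6, H.A_extreme 0⟩)
  exact hne (hfT j) (mem_bottomVertices.2 ⟨0, hj⟩)

theorem card_farTriangles_le (H : AttachedSigns e m A B p v f)
    (hh : GenericHeights e v (outerVertices m A p v f) h) :
    (farTriangles e m A p v f h).card ≤ 6 := by
  have hsub : farTriangles e m A p v f h ⊆
      ((farTriangles e m A p v f h).filter fun T => (T ∩ bottomVertices A).card = 2) ∪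
      (farTriangles e m A p v f h).filter fun T => (T ∩ bottomVertices A).card = 1 := by
    intro T hT
    simp only [Finset.mem_union, Finset.mem_filter, hT, true_and]
    simp only [farTriangles, Finset.mem_filter] at hT
    obtain ⟨-, hfar, hne⟩ := hT
    have h0 := Finset.card_pos.2 (H.far_inter_bottom_nonempty hh hfar)
    have h1 := Finset.card_le_card (Finset.inter_subset_left : T ∩ bottomVertices A ⊆ T)
    rw [card_eq_three hfar] at h1
    have h3 : (T ∩ bottomVertices A).card ≠ 3 := fun h3 => by
      obtain ⟨j, hj⟩ := H.exists_A_notMem hh hfar hne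
      have := Finset.eq_of_subset_of_card_le
        (Finset.inter_subset_right : T ∩ bottomVertices A ⊆ bottomVertices A)
        (by rw [h3, card_eq_three (H.isFar_bottomVertices hh)])
      exact hj (Finset.inter_eq_right.1 this (mem_bottomVertices.2 ⟨j, rfl⟩))
    omega
  have := (Finset.card_le_card hsub).trans (Finset.card_union_le _ _)
  have := H.card_far_two hh
  have := H.card_far_one hh
  omega

/-! ### Covering the hull -/

theorem mem_inner_of_bottom (H : AttachedSigns e m A B p v f) {x : E3}
    (hx : x ∈ convexHull ℝ (attachedPoints m p v f))
    (hxA : ∀ i, 0 ≤ vol e v (A i) (A (i + 1)) x) :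
    ∃ t ∈ innerTets m A B p v, x ∈ convexHull ℝ (t : Set E3) := by
  rcases H.mem_inner (H.mem_region hx) hxA with h | ⟨i, h⟩ | ⟨i, h⟩ | ⟨i, k, hk, h⟩
  exacts [⟨_, mem_innerTets.2 (Or.inl rfl), h⟩, ⟨_, mem_innerTets.2 (Or.inr (Or.inl ⟨i, rfl⟩)), h⟩,
    ⟨_, mem_innerTets.2 (Or.inr (Or.inr (Or.inl ⟨i, rfl⟩))), h⟩,
    ⟨_, mem_innerTets.2 (Or.inr (Or.inr (Or.inr ⟨i, k, hk, rfl⟩))), h⟩]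

theorem v_mem_hull (v : E3) : v ∈ convexHull ℝ (attachedPoints m p v f) :=
  subset_convexHull _ _ (Or.inl rfl)

theorem vol_v_A_A_nonneg_of_mem_bottom (H : AttachedSigns e m A B p v f) {z : E3}
    (hz : z ∈ convexHull ℝ (range A)) (i : Fin 3) : 0 ≤ vol e v (A i) (A (i + 1)) z := by
  rw [range_fin3 A i] at hz
  exact cone_nonneg_of_mem_convexHull (H.vol_v_A_A_A i) hz

/-- The segment from `v` to `x` crosses the bottom plane inside the region, hence in the bottom
triangle, so `x` is in the cone over it. -/
theorem mem_inner_of_above (H : AttachedSigns e m A B p v f) {x : E3}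
    (hx : x ∈ convexHull ℝ (attachedPoints m p v f)) (hxA : 0 ≤ vol e (A 0) (A 1) (A 2) x) :
    ∃ t ∈ innerTets m A B p v, x ∈ convexHull ℝ (t : Set E3) := by
  obtain ⟨t, ht0, ht1, ht⟩ := exists_zero_between (g := volMap e (A 0) (A 1) (A 2)) (a := v) (b := x)
    (by simpa using H.v_bottom 0) (by simpa using hxA)
  have hzQ := (convex_convexHull ℝ (attachedPoints m p v f)).add_smul_sub_mem (v_mem_hull v) hx
    ⟨ht0.le, ht1⟩
  have hz := H.region_bottom _ (H.mem_region hzQ) (by simpa using ht)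
  refine H.mem_inner_of_bottom hx fun i => ?_
  have h1 := H.vol_v_A_A_nonneg_of_mem_bottom hz i
  rw [← volMap_apply, map_add_smul_sub] at h1
  simp only [volMap_apply, vol_self₁₄, zero_add, sub_zero] at h1
  exact nonneg_of_mul_nonneg_right h1 ht0

/-- By Krein–Milman, `x` is on a segment from the hull of `v` and the outer vertices to the hull of
the cupola vertices. That segment leaves the lower half-space through the bottom triangle, which
already belongs to the first hull, and `x` comes before the crossing. -/
theorem mem_hull_outer (H : AttachedSigns e m A B p v f) {x : E3}
    (hx : x ∈ convexHull ℝ (attachedPoints m p v f)) (hxA : vol e (A 0) (A 1) (A 2) x < 0) :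
    x ∈ convexHull ℝ (insert v (outerVertices m A p v f : Set E3)) := by
  set Q := convexHull ℝ (attachedPoints m p v f) with hQ
  have hcomp : IsCompact Q := (finite_attachedPoints m p v f).isCompact_convexHull ℝ
  have hfin : (Q.extremePoints ℝ).Finite :=
    (finite_attachedPoints m p v f).subset extremePoints_convexHull_subset
  have hKM : convexHull ℝ (Q.extremePoints ℝ) = Q := by
    have := closure_convexHull_extremePoints hcomp (convex_convexHull ℝ _)
    rwa [(hfin.isCompact_convexHull ℝ).isClosed.closure_eq] at this
  have hbQ : insert v (outerVertices m A p v f : Set E3) ⊆ Q := by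
    rintro y (rfl | hy)
    exacts [v_mem_hull _, (H.outer_extreme hy).1]
  have hsub : Q.extremePoints ℝ ⊆
      insert v (outerVertices m A p v f : Set E3) ∪ chainVertices m p := by
    intro y hy
    rcases extremePoints_convexHull_subset hy with rfl | ⟨j, rfl⟩ | hy'
    · exact Or.inl (Or.inl rfl)
    · exact Or.inl (Or.inr (Finset.mem_union_right _ (Finset.mem_filter.2
        ⟨Finset.mem_image_of_mem _ (Finset.mem_univ j), hy⟩)))
    · exact Or.inr hy'
  rw [← hKM] at hx
  have hx' := convexHull_mono hsub hx
  rw [convexHull_union (Set.insert_nonempty _ _) ⟨_, H.A_mem 0⟩, mem_convexJoin] at hx'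
  obtain ⟨d, hd, c, hc, hseg⟩ := hx'
  rw [segment_eq_image'] at hseg
  obtain ⟨s, ⟨hs0, hs1⟩, rfl⟩ := hseg
  have hφc : 0 ≤ vol e (A 0) (A 1) (A 2) c := by
    refine nonneg_of_mem_convexHull (f := volMap e (A 0) (A 1) (A 2)) (fun y hy => ?_) hc
    by_cases hyA : ∃ i, y = A i
    · obtain ⟨i, rfl⟩ := hyA
      exact ge_of_eq (by fin_cases i <;> simp [vol_self₁₄, vol_self₂₄, vol_self₃₄])
    · push Not at hyA
      exact (H.bottom 0 y hy (hyA _) (hyA _) (hyA _)).le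
  have hlin := map_add_smul_sub (volMap e (A 0) (A 1) (A 2)) d c
  have hxs := hlin s
  simp only [volMap_apply] at hlin hxs
  simp only at hxA
  rw [hxs] at hxA
  have hφd : vol e (A 0) (A 1) (A 2) d < 0 := by
    by_contra hn
    have := mul_nonneg hs0 hφc
    have := mul_nonneg (sub_nonneg.2 hs1) (not_lt.1 hn)
    linarith
  obtain ⟨t, ht0, ht1, ht⟩ := exists_zero_between (g := volMap e (A 0) (A 1) (A 2)) (a := d) (b := c)
    (by simpa using hφd) (by simpa using hφc)
  have hdQ : d ∈ Q := convexHull_min hbQ (convex_convexHull ℝ _) hd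
  have hcQ : c ∈ Q := convexHull_mono (fun y hy => Or.inr (Or.inr hy)) hc
  have hzQ := (convex_convexHull ℝ (attachedPoints m p v f)).add_smul_sub_mem hdQ hcQ ⟨ht0.le, ht1⟩
  have hz := H.region_bottom _ (H.mem_region hzQ) (by simpa using ht)
  have hz' : d + t • (c - d) ∈ convexHull ℝ (insert v (outerVertices m A p v f : Set E3)) := by
    refine convexHull_mono ?_ hz
    rintro _ ⟨i, rfl⟩
    exact Or.inr (A_mem_outer A i)
  have hst : s ≤ t := by
    rw [volMap_apply, hlin] at ht
    by_contra hn
    have := mul_pos (sub_pos.2 (not_le.1 hn)) (by linarith :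
      0 < vol e (A 0) (A 1) (A 2) c - vol e (A 0) (A 1) (A 2) d)
    linarith
  have := (convex_convexHull ℝ (insert v (outerVertices m A p v f : Set E3))).add_smul_sub_mem hd hz'
    (t := s / t) ⟨by positivity, (div_le_one ht0).2 hst⟩
  rwa [add_sub_cancel_left, smul_smul, div_mul_cancel₀ _ ht0.ne'] at this

theorem mem_iUnion_of_generic (H : AttachedSigns e m A B p v f) (he : e ≠ 0)
    (hh : GenericHeights e v (outerVertices m A p v f) h) {x : E3}
    (hx : x ∈ convexHull ℝ (attachedPoints m p v f)) (hxv : x ≠ v)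
    (hgen : ∀ a ∈ outerVertices m A p v f, ∀ b ∈ outerVertices m A p v f,
      x - v ∉ Submodule.span ℝ {a - v, b - v}) :
    ∃ t ∈ innerTets m A B p v ∪ (farTriangles e m A p v f h).image (insert v),
      x ∈ convexHull ℝ (t : Set E3) := by
  have left : (∃ t ∈ innerTets m A B p v, x ∈ convexHull ℝ (t : Set E3)) →
      ∃ t ∈ innerTets m A B p v ∪ (farTriangles e m A p v f h).image (insert v),
        x ∈ convexHull ℝ (t : Set E3) := fun ⟨t, ht, h⟩ => ⟨t, Finset.mem_union_left _ ht, h⟩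
  rcases le_or_gt 0 (vol e (A 0) (A 1) (A 2) x) with hA | hA
  · exact left (H.mem_inner_of_above hx hA)
  obtain ⟨a, b, c, hT, hxT⟩ := exists_isFar_mem he hh (H.mem_hull_outer hx hA) hxv hgen
  by_cases hTA : ({a, b, c} : Finset E3) = bottomVertices A
  · refine left (H.mem_inner_of_bottom hx fun i => ?_)
    refine nonneg_of_mem_convexHull (f := volMap e v (A i) (A (i + 1))) (fun y hy => ?_) hxT
    rcases hy with rfl | hy
    · simp [vol_self₁₄]
    · have hy' : y ∈ bottomVertices A := by
        rw [← hTA]; simpa using hy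
      obtain ⟨j, rfl⟩ := mem_bottomVertices.1 hy'
      exact H.vol_v_A_A_nonneg_of_mem_bottom (subset_convexHull _ _ (mem_range_self j)) i
  · refine ⟨insert v {a, b, c}, Finset.mem_union_right _ (Finset.mem_image_of_mem _ ?_), ?_⟩
    · exact Finset.mem_filter.2 ⟨Finset.mem_powerset.2 hT.subset, hT, hTA⟩
    · simpa using hxT

theorem exists_triangulation (H : AttachedSigns e m A B p v f) (he : e ≠ 0)
    (hint : (interior (convexHull ℝ (attachedPoints m p v f))).Nonempty) :
    ∃ T : Finset (Finset E3),
      IsTriangulation (convexHull ℝ (attachedPoints m p v f)) T ∧ T.card ≤ 3 * m + 16 := by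
  obtain ⟨h, hh⟩ := exists_genericHeights e v (outerVertices m A p v f)
  set Q := convexHull ℝ (attachedPoints m p v f) with hQ
  set T := innerTets m A B p v ∪ (farTriangles e m A p v f h).image (insert v) with hTdef
  have hfar : ∀ {t}, t ∈ (farTriangles e m A p v f h).image (insert v) → ∃ s,
      t = insert v s ∧ IsFar e v h (outerVertices m A p v f) s ∧ s ≠ bottomVertices A := by
    intro t ht
    obtain ⟨s, hs, rfl⟩ := Finset.mem_image.1 ht
    exact ⟨s, rfl, (Finset.mem_filter.1 hs).2⟩
  have hvol : ∀ t ∈ T, ∃ a b c d, t = {a, b, c, d} ∧ vol e a b c d ≠ 0 := by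
    intro t ht
    rcases Finset.mem_union.1 ht with ht | ht
    · exact H.exists_vol_of_mem_innerTets ht
    · obtain ⟨s, rfl, hs, -⟩ := hfar ht
      exact hs.exists_vol
  have hext : ∀ t ∈ T, (t : Set E3) ⊆ Q.extremePoints ℝ := by
    intro t ht x hx
    rcases Finset.mem_union.1 ht with ht | ht
    · rcases mem_innerTets.1 ht with rfl | ⟨i, rfl⟩ | ⟨i, rfl⟩ | ⟨i, k, hk, rfl⟩
      · simp only [topTet, Finset.coe_insert, Finset.coe_singleton, mem_insert_iff,
          mem_singleton_iff] at hx
        rcases hx with rfl | rfl | rfl | rfl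
        exacts [H.v_extreme, H.B_extreme _, H.B_extreme _, H.B_extreme _]
      · simp only [lowTet, Finset.coe_insert, Finset.coe_singleton, mem_insert_iff,
          mem_singleton_iff] at hx
        rcases hx with rfl | rfl | rfl | rfl
        exacts [H.v_extreme, H.A_extreme _, H.A_extreme _, H.B_extreme _]
      · simp only [highTet, Finset.coe_insert, Finset.coe_singleton, mem_insert_iff,
          mem_singleton_iff] at hx
        rcases hx with rfl | rfl | rfl | rfl
        exacts [H.v_extreme, H.A_extreme _, H.B_extreme _, H.B_extreme _]
      · simp only [chainTet, Finset.coe_insert, Finset.coe_singleton, mem_insert_iff,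
          mem_singleton_iff] at hx
        rcases hx with rfl | rfl | rfl | rfl
        exacts [H.B_extreme _, H.A_extreme _, H.p_extreme _ (by omega), H.p_extreme _ (by omega)]
    · obtain ⟨s, rfl, hs, -⟩ := hfar ht
      rw [Finset.coe_insert] at hx
      rcases hx with rfl | hx
      exacts [H.v_extreme, H.outer_extreme (hs.subset hx)]
  refine ⟨T, ⟨?_, ?_, hext, ?_, ?_⟩, ?_⟩
  · intro t ht
    obtain ⟨a, b, c, d, rfl, hD⟩ := hvol t ht
    exact card_of_vol_ne_zero hD
  · intro t ht
    obtain ⟨a, b, c, d, rfl, hD⟩ := hvol t ht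
    exact affineIndependent_coe_of_vol_ne_zero hD
  · refine Subset.antisymm (iUnion₂_subset fun t ht => ?_) fun x hx => ?_
    · exact convexHull_min (fun y hy => (hext t ht hy).1) (convex_convexHull ℝ _)
    · by_contra hn
      -- The union is closed and the hull is the closure of its interior, so a missing point yields
      -- a missing open set, and with it a missing generic point.
      have hclosed : IsClosed (⋃ t ∈ T, convexHull ℝ (t : Set E3)) :=
        T.finite_toSet.isClosed_biUnion fun t _ => (isCompact_convexHull_finset t).isClosed
      have hcl : x ∈ closure (interior Q) := by
        rw [(convex_convexHull ℝ _).closure_interior_eq_closure_of_nonempty_interior hint]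
        exact subset_closure hx
      have hne := mem_closure_iff.1 hcl _ hclosed.isOpen_compl hn
      obtain ⟨y, hy, hyv, hgen⟩ := exists_generic v (outerVertices m A p v f)
        (hclosed.isOpen_compl.inter isOpen_interior) hne
      obtain ⟨t, ht, hyt⟩ := H.mem_iUnion_of_generic he hh (interior_subset hy.2) hyv hgen
      exact hy.1 (mem_biUnion (x := t) ht hyt)
  · intro s hs t ht
    rcases Finset.mem_union.1 hs with hs | hs <;> rcases Finset.mem_union.1 ht with ht | ht
    · exact H.meet_inner hs ht
    · obtain ⟨t, rfl, hT, hne⟩ := hfar ht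
      exact (H.meet_far_inner hh hT hne hs).symm
    · obtain ⟨s, rfl, hS, hne⟩ := hfar hs
      exact H.meet_far_inner hh hS hne ht
    · obtain ⟨s, rfl, hS, -⟩ := hfar hs
      obtain ⟨t, rfl, hT, -⟩ := hfar ht
      exact hS.meetInFace hh hT
  · have h1 : T.card ≤ _ := Finset.card_union_le (innerTets m A B p v)
      ((farTriangles e m A p v f h).image (insert v))
    have h2 := Finset.card_image_le (s := farTriangles e m A p v f h) (f := insert v)
    have h3 := H.card_farTriangles_le hh
    have h4 := card_innerTets_le (m := m) (A := A) (B := B) (p := p) (v := v)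
    omega

end AttachedSigns

/-! ### Assembling the proof -/

/-- A segment from another point of `F` could be prolonged beyond a relatively interior `v`,
contradicting extremality. -/
theorem eq_of_mem_intrinsicInterior_of_mem_extremePoints {F : Set E3} {v w : E3}
    (hv : v ∈ F.extremePoints ℝ) (hi : v ∈ intrinsicInterior ℝ F) (hw : w ∈ F) : w = v := by
  obtain ⟨y, hy, rfl⟩ := mem_intrinsicInterior.1 hi
  have hwF : w ∈ affineSpan ℝ F := subset_affineSpan _ _ hw
  have hline : ∀ t : ℝ, AffineMap.lineMap (y : E3) w t ∈ affineSpan ℝ F := fun t =>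
    AffineMap.lineMap_mem t y.2 hwF
  have hcont : Continuous fun t : ℝ =>
      (⟨AffineMap.lineMap (y : E3) w t, hline t⟩ : affineSpan ℝ F) :=
    Continuous.subtype_mk AffineMap.lineMap_continuous _
  have h0 : (0 : ℝ) ∈ (fun t : ℝ => (⟨AffineMap.lineMap (y : E3) w t, hline t⟩ : affineSpan ℝ F)) ⁻¹'
      interior (Subtype.val ⁻¹' F) := by
    simpa using hy
  obtain ⟨ε, hε, hball⟩ := Metric.isOpen_iff.1 (isOpen_interior.preimage hcont) 0 h0
  have hz := interior_subset (hball (show -(ε / 2) ∈ Metric.ball 0 ε by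
    rw [Metric.mem_ball, dist_zero_right, Real.norm_eq_abs, abs_neg, abs_of_pos (by positivity)]
    linarith))
  simp only [mem_preimage] at hz
  refine (mem_extremePoints.1 hv).2 _ hz _ hw ?_ |>.2
  refine ⟨1 / (1 + ε / 2), (ε / 2) / (1 + ε / 2), by positivity, by positivity, by field_simp, ?_⟩
  have h1 : (1 + ε / 2) ≠ 0 := by positivity
  rw [AffineMap.lineMap_apply_module]
  rw [smul_add, smul_smul, smul_smul, add_assoc, ← add_smul]
  have e1 : 1 / (1 + ε / 2) * (1 - -(ε / 2)) = 1 := by field_simp; ring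
  have e2 : 1 / (1 + ε / 2) * -(ε / 2) + ε / 2 / (1 + ε / 2) = 0 := by field_simp; ring
  rw [e1, e2, one_smul, zero_smul, add_zero]

theorem vol_ne_zero_of_affineIndependent {e : ℝ} (he : e ≠ 0) {f : Fin 3 → E3}
    (hf : AffineIndependent ℝ f) {φ : E3 →ᵃ[ℝ] ℝ} (hφ : ∀ j, φ (f j) = 0) {v : E3} (hv : φ v ≠ 0) :
    vol e v (f 0) (f 1) (f 2) ≠ 0 := by
  intro h0
  obtain ⟨α, β, γ, hne, hrel⟩ :=
    exists_relation_of_det3_eq_zero ((mul_eq_zero.1 h0).resolve_left he)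
  have hlin : ∀ j, φ.linear (f j - v) = -φ v := fun j => by
    rw [← vsub_eq_sub, φ.linearMap_vsub, hφ, vsub_eq_sub, zero_sub]
  have h1 := congrArg φ.linear hrel
  simp only [map_add, map_smul, hlin, map_zero, smul_eq_mul] at h1
  have hsum : α + β + γ = 0 := by
    have : (α + β + γ) * φ v = 0 := by linarith
    exact (mul_eq_zero.1 this).resolve_right hv
  have h2 := (affineIndependent_iff_of_fintype ℝ f).1 hf ![α, β, γ]
    (by simpa [Fin.sum_univ_three] using hsum) (by
      rw [Finset.weightedVSub_eq_weightedVSubOfPoint_of_sum_eq_zero _ _ _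
        (by simpa [Fin.sum_univ_three] using hsum) v, Finset.weightedVSubOfPoint_apply]
      simpa [Fin.sum_univ_three] using hrel)
  have a0 := h2 0
  have a1 := h2 1
  have a2 := h2 2
  simp at a0 a1 a2
  rcases hne with h | h | h
  exacts [h a0, h a1, h a2]

theorem IsPolytope3.convexHull_extremePoints {C : Set E3} (hC : IsPolytope3 C) :
    convexHull ℝ (C.extremePoints ℝ) = C := by
  obtain ⟨⟨S, rfl⟩, -⟩ := hC
  have hfin : ((convexHull ℝ (S : Set E3)).extremePoints ℝ).Finite :=
    S.finite_toSet.subset extremePoints_convexHull_subset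
  have := closure_convexHull_extremePoints (isCompact_convexHull_finset S) (convex_convexHull ℝ _)
  rwa [(hfin.isCompact_convexHull ℝ).isClosed.closure_eq] at this

theorem mainTheorem10 (m : ℕ) (P F C : Set E3) (A B : Fin 3 → E3) (q : Fin 3 → Fin (m + 2) → E3)
    (hP : IsPolytope3 P) (hF : IsTriangle F)
    (hC : IsCupola m A B q C)
    (hattach : AttachedAlong P F C (convexHull ℝ (range A)))
    (hV : IsTriangle (F ∩ visibilityCone A B))
    (hVF : F ∩ visibilityCone A B ⊆ intrinsicInterior ℝ F)
    (v : E3) (hv : v ∈ P.extremePoints ℝ) (hvV : v ∈ interior (visibilityCone A B)) :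
    ∃ T : Finset (Finset E3),
      IsTriangulation (convexHull ℝ ({v} ∪ F ∪ C)) T ∧ T.card ≤ 3 * m + 16 := by
  obtain ⟨f, hf, hFf⟩ := hF
  obtain ⟨e, p, he, hvert, hCreg, hbreg, hbneg, hCpos, hzero, hsigns⟩ := hC.exists_signs
  have hFne : F.Nonempty := by rw [hFf]; exact (range_nonempty f).convexHull
  obtain ⟨φ, hφ, hφF⟩ := exists_affine_of_isExposed hattach.facet_left.1 hFne
  have hFP : F ⊆ P := by rw [hφF]; exact fun x hx => hx.1
  have hfF : ∀ j, f j ∈ F := fun j => by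
    rw [hFf]; exact subset_convexHull _ _ (mem_range_self j)
  -- If `v` were in `F`, it would be extreme there, and also relatively interior because it belongs
  -- to the visibility cone. Then `F` would be a single point.
  have hvF : v ∉ F := by
    intro hvF
    have hvext : v ∈ F.extremePoints ℝ :=
      inter_extremePoints_subset_extremePoints_of_subset hFP ⟨hvF, hv⟩
    have hvint := hVF ⟨hvF, interior_subset hvV⟩
    have h0 := eq_of_mem_intrinsicInterior_of_mem_extremePoints hvext hvint (hfF 0)
    have h1 := eq_of_mem_intrinsicInterior_of_mem_extremePoints hvext hvint (hfF 1)
    exact absurd (hf.injective (h0.trans h1.symm)) (by simp)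
  have hvol := vol_ne_zero_of_affineIndependent he hf
    (fun j => by have := hfF j; rw [hφF] at this; exact this.2)
    (fun h0 => hvF (by rw [hφF]; exact ⟨hv.1, h0⟩) : φ v ≠ 0)
  -- The vertices of `F` are reordered to be positively oriented as seen from `v`.
  obtain ⟨g, hg, hgpos⟩ : ∃ g : Fin 3 → E3, range g = range f ∧ 0 < vol e v (g 0) (g 1) (g 2) := by
    rcases lt_or_gt_of_ne hvol with h | h
    · refine ⟨![f 1, f 0, f 2], ?_, ?_⟩
      · rw [range_fin3 f 0, range_fin3 _ 0]
        exact insert_comm _ _ _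
      · show 0 < vol e v (f 1) (f 0) (f 2)
        rw [vol_swap₂₃]; linarith
    · exact ⟨f, rfl, h⟩
  have hFg : F = convexHull ℝ {g 0, g 1, g 2} := by rw [hFf, ← hg, range_fin3 g 0]; rfl
  have hcone : ∀ x ∈ C, 0 ≤ vol e v (g 0) (g 1) x ∧ 0 ≤ vol e v (g 1) (g 2) x ∧
      0 ≤ vol e v (g 2) (g 0) x ∧ 0 ≤ vol e (g 0) (g 1) (g 2) x := by
    obtain ⟨⟨S, rfl⟩, hint⟩ := hP
    exact fun x hx => cone_of_mem_polytopeBeyond hint hattach.facet_left hFg hv.1 hgpos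
      (hattach.right_beyond hx)
  have hvC : v ∉ C := fun hvC => by
    have h1 := (hcone v hvC).2.2.2
    have h2 : vol e (g 0) (g 1) (g 2) v = -vol e v (g 0) (g 1) (g 2) := by
      simp only [vol, det3, PiLp.sub_apply]; ring
    linarith
  have hgb : ∀ j, g j ∈ polytopeBeyond C (convexHull ℝ (range A)) := fun j => by
    refine hattach.left_beyond (hFP ?_)
    rw [hFf, ← hg]
    exact subset_convexHull _ _ (mem_range_self j)
  have hvertC : chainVertices m p ⊆ C := by rw [← hvert]; exact extremePoints_subset
  have H : AttachedSigns e m A B p v g :=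
    { toCupolaSigns := hsigns v (hattach.left_beyond hv.1) hvC hvV
      vertices_region := hvertC.trans hCreg
      facet_region := fun j => hbreg (hgb j)
      facet_bottom := fun j => hbneg _ (hgb j)
      region_bottom := hzero
      facet_pos := hgpos
      cone := fun x hx => hcone x (hvertC hx) }
  have hQ : convexHull ℝ ({v} ∪ F ∪ C) = convexHull ℝ (attachedPoints m p v g) := by
    refine Subset.antisymm (convexHull_min ?_ (convex_convexHull ℝ _)) (convexHull_mono ?_)
    · rintro x ((rfl | hx) | hx)
      · exact subset_convexHull _ _ (Or.inl rfl)
      · rw [hFf, ← hg] at hx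
        exact convexHull_mono (fun y hy => Or.inr (Or.inl hy)) hx
      · rw [← hC.isPolytope.convexHull_extremePoints, hvert] at hx
        exact convexHull_mono (fun y hy => Or.inr (Or.inr hy)) hx
    · rintro x (rfl | hx | hx)
      · exact Or.inl (Or.inl rfl)
      · refine Or.inl (Or.inr ?_)
        rw [hFf, ← hg]
        exact subset_convexHull _ _ hx
      · exact Or.inr (hvertC hx)
  rw [hQ]
  refine H.exists_triangulation he (hC.isPolytope.2.mono (interior_mono ?_))
  rw [← hQ]
  exact fun x hx => subset_convexHull _ _ (Or.inr hx)
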